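/- Let $d\in\{2,3\}$ and let $\Omega\subset\mathbb R^d$ be a bounded convex polygonal/polyhedral domain. Let $\mathcal T_h$ be a conforming mesh of $\Omega$ into convex polytopes, with mesh size $h=\max_K \operatorname{diam}K$ and set of edges/faces $\mathcal E_h$; $\bm n$ is the outward unit normal on $\partial K$. Let $\bm V(K)\subset H(\mathrm{div};K)$ (with normal traces in $L^2(\partial K)$), $W(K)\subset H^1(K)$, $M(e)\subset L^2(e)$ and $\bm N(e)\subset\{\bm r\in L^2(e)^d:(I-\bm n\otimes\bm n)\bm r=\bm 0\}$ be finite-dimensional spaces ($K\in\mathcal T_h$, $e\in\mathcal E_h$) with $\nabla W(K)\subset\bm V(K)$, $\nabla\cdot\bm V(K)\subset W(K)$ and, for every face $e$ of $K$: (A1) $\mu\bm n\in\bm N(e)$ for $\mu\in M(e)$; (A2) $\bm r\cdot\bm n\in M(e)$ for $\bm r\in\bm N(e)$; (A3) $\bm v|_e\cdot\bm n\in M(e)$ for $\bm v\in\bm V(K)$; (A4) $w|_e\in M(e)$ for $w\in W(K)$. Put $\bm V_h=\prod_K\bm V(K)$, $W_h=\prod_K W(K)$, $\bm N_h=\prod_{e}\bm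 N(e)$, $M_h=\{\mu\in\prod_{e}M(e):\mu=0\text{ on }\partial\Omega\}$ (single-valued functions on $\mathcal E_h$), and let $T(M_h)=\prod_K\prod_{e\subset\partial K}M(e)$, $\bm T(\bm N_h)=\prod_K\prod_{e\subset\partial K}\bm N(e)$ be the double-valued hybrid spaces. Let $(\cdot,\cdot)_{\mathcal T_h}=\sum_K(\cdot,\cdot)_K$, $\langle\cdot,\cdot\rangle_{\partial\mathcal T_h}=\sum_K\int_{\partial K}\cdot\,\cdot\,ds$, $\|w\|_{\partial\mathcal T_h}^2=\langle w,w\rangle_{\partial\mathcal T_h}$, and let $\tau>0$ be constant on each face of each element. Let $f\in L^2(\Omega)$. The unified formulation seeks $(\bm q_h,u_h,\widehat{\bm q}_h,\widehat u_h)\in\bm V_h\times W_h\times\bm T(\bm N_h)\times T(M_h)$ with $$(\bm q_h,\bm v)_{\mathcal T_h}-(u_h,\nabla\cdot\bm v)_{\mathcal T_h}+\langle\widehat u_h,\bm v\cdot\bm n\rangle_{\partial\mathcal T_h}=0\quad\forall\bm v\in\bm V_h,\tag{1}$$ $$-(\bm q_h,\nabla w)_{\mathcal T_h}+\langle\widehat{\bm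 q}_h\cdot\bm n,w\rangle_{\partial\mathcal T_h}=(f,w)\quad\forall w\in W_h,\tag{2}$$ $$\langle\widehat{\bm q}_h\cdot\bm n,\mu\rangle_{\partial\mathcal T_h}=0\quad\forall\mu\in M_h,\tag{3}$$ $$\langle\widehat u_h,\bm r\cdot\bm n\rangle_{\partial\mathcal T_h}=0\quad\forall\bm r\in\bm N_h,\tag{4}$$ $$(\bm q_h-\widehat{\bm q}_h)\cdot\bm n+\tau(u_h-\widehat u_h)=0\quad\text{on }\partial K\ \ \forall K\in\mathcal T_h,\tag{5}$$ where on each interior face $\widehat u_h$ or $\widehat{\bm q}_h$ is single valued. (i) (Stability.) Let $A\in\mathbb R$ and $\tau_0>0$. There is a constant $C>0$ depending only on $\Omega$, $A$ and $\tau_0$ (in particular not on $h$) such that, whenever $\tau\ge\tau_0$ and $\|\bm\theta\cdot\bm n-(\bm P_{\bm V}\bm\theta)\cdot\bm n\|_{\partial\mathcal T_h}\le A\,h^{1/2}|\bm\theta|_{1,\Omega}$ for all smooth vector fields $\bm\theta:\mathbb R^d\to\mathbb R^d$ ($\bm P_{\bm V}$ is the $L^2$-projection onto $\bm V_h$), every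 solution of the unified formulation satisfies $$\|\bm q_h\|^2+\|\tau^{1/2}(u_h-\widehat u_h)\|^2_{\partial\mathcal T_h}\le C\|f\|^2 .$$ (ii) (Well-posedness.) For every mesh, spaces and $\tau>0$ as above (without the approximation property) and every $f\in L^2(\Omega)$, each of the following has exactly one solution: the Dirichlet-type method, which seeks $(\bm q_h,u_h,\widehat u_h)\in\bm V_h\times W_h\times M_h$ with (1), (2), (3), where $\widehat{\bm q}_h\cdot\bm n:=\bm q_h\cdot\bm n+\tau(u_h-\widehat u_h)$; the Neumann-type method, which seeks $(\bm q_h,u_h,\widehat{\bm q}_h)\in\bm V_h\times W_h\times\bm N_h$ with (1), (2), (4), where $\widehat u_h:=u_h+\tau^{-1}(\bm q_h-\widehat{\bm q}_h)\cdot\bm n$; for every set $D\subset\mathcal E_h$ of faces, the mixed-type method, in which the unknown hybrid variable is the restriction of an element of $M_h$ to the faces in $D$ (with $\widehat{\bm q}_h\cdot\bm n$ given there as in the Dirichlet-type method) and the restriction of an element of $\bm N_h$ to the other faces (with $\widehat u_h$ given there as in the Neumann-type method), subject to (1), (2), (3) for all $\mu\in M_h$ vanishing off $D$, and (4) for all $\bm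 r\in\bm N_h$ vanishing on $D$; and the unified formulation. -/

import Mathlib

open MeasureTheory
open scoped ContDiff

noncomputable section

namespace HDG

/-- Euclidean space `ℝ^d`. -/
abbrev E (d : ℕ) : Type := EuclideanSpace ℝ (Fin d)

/-- The `i`-th standard unit vector. -/
def stdVec {d : ℕ} (i : Fin d) : E d := EuclideanSpace.single i 1

/-- The divergence of a (differentiable) vector field. -/
def divg {d : ℕ} (θ : E d → E d) (x : E d) : ℝ := ∑ i, (fderiv ℝ θ x (stdVec i)) i

/-- The square of the Frobenius norm of the Jacobian matrix of a (differentiable) vector field. -/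
def jacSq {d : ℕ} (θ : E d → E d) (x : E d) : ℝ := ∑ i, ‖fderiv ℝ θ x (stdVec i)‖ ^ 2

/-! ### Polytopes, facets, meshes -/

/-- A convex polytope with nonempty interior. -/
def IsPolytope {d : ℕ} (K : Set (E d)) : Prop :=
  (∃ s : Finset (E d), K = convexHull ℝ (s : Set (E d))) ∧ (interior K).Nonempty

/-- A bounded convex polygonal (`d = 2`) or polyhedral (`d = 3`) domain: the interior of a
convex polytope. -/
def IsConvexPolyhedralDomain {d : ℕ} (Ω : Set (E d)) : Prop :=
  ∃ P : Set (E d), IsPolytope P ∧ Ω = interior P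

/-- `n` is a unit vector and `F` is the part of `K` which is extreme in the direction `n`.  If `K`
is a polytope and `F` a facet of `K`, then `n` is the outward unit normal to `K` on `F`. -/
def IsOutwardNormal {d : ℕ} (K F : Set (E d)) (n : E d) : Prop :=
  ‖n‖ = 1 ∧ F = {x ∈ K | ∀ y ∈ K, inner ℝ n y ≤ inner ℝ n x}

/-- `F` is a facet (an edge for `d = 2`, a face for `d = 3`) of the polytope `K`. -/
def IsFacet {d : ℕ} (K F : Set (E d)) : Prop :=
  Module.finrank ℝ (vectorSpan ℝ F) + 1 = d ∧ ∃ n, IsOutwardNormal K F n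

/-- A conforming mesh of `Ω`: finitely many convex polytopes with disjoint interiors covering the
closure of `Ω`, any two of which meet in a common (possibly empty) face. `faces` is the set
`ℰ_h` of all edges/faces of the elements. -/
structure Mesh {d : ℕ} (Ω : Set (E d)) where
  elems : Finset (Set (E d))
  faces : Finset (Set (E d))
  polytope : ∀ K ∈ elems, IsPolytope K
  cover : (⋃ K ∈ elems, K) = closure Ω
  disjoint_interior : ∀ K ∈ elems, ∀ K' ∈ elems, K ≠ K' → Disjoint (interior K) (interior K')
  conforming : ∀ K ∈ elems, ∀ K' ∈ elems, IsExposed ℝ K (K ∩ K')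
  mem_faces : ∀ F, F ∈ faces ↔ ∃ K ∈ elems, IsFacet K F

/-! ### Lebesgue spaces on elements and faces -/

/-- The `(d-1)`-dimensional surface measure on `ℝ^d`. -/
abbrev surf (d : ℕ) : Measure (E d) := μHE[d - 1]

/-- `L²(K)`. -/
abbrev L2 {d : ℕ} (K : Set (E d)) : Type := Lp ℝ 2 (volume.restrict K)

/-- `L²(K)^d`. -/
abbrev L2v {d : ℕ} (K : Set (E d)) : Type := Lp (E d) 2 (volume.restrict K)

/-- `L²(F)` for a face `F`. -/
abbrev L2F {d : ℕ} (F : Set (E d)) : Type := Lp ℝ 2 ((surf d).restrict F)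

/-- `L²(F)^d` for a face `F`. -/
abbrev L2Fv {d : ℕ} (F : Set (E d)) : Type := Lp (E d) 2 ((surf d).restrict F)

/-- `r ↦ r · n` on `L²(F)^d`. -/
def dotN {d : ℕ} {F : Set (E d)} (n : E d) : L2Fv F →L[ℝ] L2F F :=
  (innerSL ℝ n).compLpL 2 ((surf d).restrict F)

/-- `μ ↦ μ n` on `L²(F)`. -/
def smulN {d : ℕ} {F : Set (E d)} (n : E d) : L2F F →L[ℝ] L2Fv F :=
  (ContinuousLinearMap.toSpanSingleton ℝ n).compLpL 2 ((surf d).restrict F)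

variable {d : ℕ} {Ω : Set (E d)}

namespace Mesh

/-- The elements of the mesh. -/
abbrev Elem (T : Mesh Ω) : Type := {K : Set (E d) // K ∈ T.elems}

/-- The edges/faces of the mesh. -/
abbrev Face (T : Mesh Ω) : Type := {F : Set (E d) // F ∈ T.faces}

/-- The edges/faces of the element `K`. -/
abbrev Facet (T : Mesh Ω) (K : T.Elem) : Type := {F : Set (E d) // IsFacet K.1 F}

/-- A face of an element, as a face of the mesh. -/
abbrev toFace (T : Mesh Ω) {K : T.Elem} (F : T.Facet K) : T.Face :=
  ⟨F.1, (T.mem_faces F.1).2 ⟨K.1, K.2, F.2⟩⟩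

instance instFintypeFacet (T : Mesh Ω) (K : T.Elem) : Fintype (T.Facet K) :=
  Fintype.ofInjective (fun F => T.toFace F) (fun F G h => Subtype.ext (by simpa using h))

/-- The outward unit normal vector to `K` on its face `F`. -/
def normal (T : Mesh Ω) {K : T.Elem} (F : T.Facet K) : E d := F.2.2.choose

/-- The mesh size. -/
def size (T : Mesh Ω) : ℝ := ⨆ K : T.Elem, Metric.diam K.1

/-! ### Functions with gradient and trace, vector fields with divergence and normal trace -/

/-- Triples consisting of a function on `K`, a vector field on `K` and a function on `∂K`. -/
abbrev ScalarData (T : Mesh Ω) (K : T.Elem) : Type :=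
  L2 K.1 × L2v K.1 × (∀ F : T.Facet K, L2F F.1)

/-- Triples consisting of a vector field on `K`, a function on `K` and a function on `∂K`. -/
abbrev VectorData (T : Mesh Ω) (K : T.Elem) : Type :=
  L2v K.1 × L2 K.1 × (∀ F : T.Facet K, L2F F.1)

/-- `w = (u, g, t)` with `u ∈ H¹(K)`, `g = ∇u` its weak gradient and `t = u|_{∂K}` its trace.
Both are determined by `u` through Green's formula
`(∇u, θ)_K + (u, ∇·θ)_K = ⟨u, θ·n⟩_{∂K}` for all smooth fields `θ`. -/
def IsH1 (T : Mesh Ω) {K : T.Elem} (w : T.ScalarData K) : Prop :=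
  ∀ θ : E d → E d, ContDiff ℝ ∞ θ →
    (∫ x in K.1, inner ℝ (w.2.1 x) (θ x)) + (∫ x in K.1, w.1 x * divg θ x) =
      ∑ F : T.Facet K, ∫ x in F.1, w.2.2 F x * inner ℝ (θ x) (T.normal F) ∂(surf d)

/-- `v = (q, δ, s)` with `q ∈ H(div; K)`, `δ = ∇·q` its weak divergence and `s = q·n ∈ L²(∂K)` its
normal trace. Both are determined by `q` through Green's formula
`(q, ∇u)_K + (∇·q, u)_K = ⟨q·n, u⟩_{∂K}` for all `u ∈ H¹(K)`. -/
def IsHdiv (T : Mesh Ω) {K : T.Elem} (v : T.VectorData K) : Prop :=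
  ∀ w : T.ScalarData K, T.IsH1 w →
    inner ℝ v.1 w.2.1 + inner ℝ v.2.1 w.1 = ∑ F : T.Facet K, inner ℝ (v.2.2 F) (w.2.2 F)

/-- Scalar functions on `∂𝒯_h`, i.e. double valued on interior faces. -/
abbrev Bdry (T : Mesh Ω) : Type := ∀ K : T.Elem, ∀ F : T.Facet K, L2F F.1

/-- `⟨a, b⟩_{∂𝒯_h}`. -/
def bdryInner (T : Mesh Ω) (a b : T.Bdry) : ℝ :=
  ∑ K : T.Elem, ∑ F : T.Facet K, inner ℝ (a K F) (b K F)

end Mesh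

/-! ### Finite element spaces -/

/-- Local finite element spaces `V(K)`, `W(K)`, `M(e)`, `N(e)` satisfying `∇W(K) ⊂ V(K)`,
`∇·V(K) ⊂ W(K)`, `(I - n ⊗ n) r = 0` for `r ∈ N(e)`, and Assumptions (A1)-(A4). A member of `W(K)`
is recorded with its gradient and trace, a member of `V(K)` with its divergence and normal
trace. -/
structure FESpaces (T : Mesh Ω) where
  V : ∀ K : T.Elem, Submodule ℝ (T.VectorData K)
  W : ∀ K : T.Elem, Submodule ℝ (T.ScalarData K)
  M : ∀ F : Set (E d), Submodule ℝ (L2F F)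
  N : ∀ F : Set (E d), Submodule ℝ (L2Fv F)
  finV : ∀ K, FiniteDimensional ℝ (V K)
  finW : ∀ K, FiniteDimensional ℝ (W K)
  finM : ∀ F ∈ T.faces, FiniteDimensional ℝ (M F)
  finN : ∀ F ∈ T.faces, FiniteDimensional ℝ (N F)
  hdivV : ∀ K, ∀ v ∈ V K, T.IsHdiv v
  h1W : ∀ K, ∀ w ∈ W K, T.IsH1 w
  gradW : ∀ K, ∀ w ∈ W K, ∃ v ∈ V K, v.1 = w.2.1
  divV : ∀ K, ∀ v ∈ V K, ∃ w ∈ W K, w.1 = v.2.1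
  normalN : ∀ (K : T.Elem) (F : T.Facet K), ∀ r ∈ N F.1,
    smulN (T.normal F) (dotN (T.normal F) r) = r
  A1 : ∀ (K : T.Elem) (F : T.Facet K), ∀ μ ∈ M F.1, smulN (T.normal F) μ ∈ N F.1
  A2 : ∀ (K : T.Elem) (F : T.Facet K), ∀ r ∈ N F.1, dotN (T.normal F) r ∈ M F.1
  A3 : ∀ (K : T.Elem) (F : T.Facet K), ∀ v ∈ V K, v.2.2 F ∈ M F.1
  A4 : ∀ (K : T.Elem) (F : T.Facet K), ∀ w ∈ W K, w.2.2 F ∈ M F.1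

namespace FESpaces

variable {T : Mesh Ω}

/-- The global space `V_h`. -/
abbrev Vh (S : FESpaces T) : Type := ∀ K : T.Elem, S.V K

/-- The global space `W_h`. -/
abbrev Wh (S : FESpaces T) : Type := ∀ K : T.Elem, S.W K

/-- The single-valued hybrid space `M_h`, with vanishing values on `∂Ω`. -/
def Mh (S : FESpaces T) : Submodule ℝ (∀ F : T.Face, S.M F.1) where
  carrier := {μ | ∀ F : T.Face, F.1 ⊆ frontier Ω → μ F = 0}
  add_mem' := fun ha hb F hF => by simp [ha F hF, hb F hF]
  zero_mem' := fun F _ => rfl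
  smul_mem' := fun c a ha F hF => by simp [ha F hF]

/-- The single-valued hybrid space `N_h`. -/
abbrev Nh (S : FESpaces T) : Type := ∀ F : T.Face, S.N F.1

/-- The double-valued hybrid space `T(M_h) = ∏_K M(∂K)`. -/
abbrev TMh (S : FESpaces T) : Type := ∀ K : T.Elem, ∀ F : T.Facet K, S.M F.1

/-- The double-valued hybrid space `T(N_h) = ∏_K N(∂K)`. -/
abbrev TNh (S : FESpaces T) : Type := ∀ K : T.Elem, ∀ F : T.Facet K, S.N F.1

/-- The trace of `u ∈ W_h` on `∂𝒯_h`. -/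
def trace (S : FESpaces T) (u : S.Wh) : T.Bdry := fun K F => (u K).1.2.2 F

/-- The normal trace `q · n` of `q ∈ V_h` on `∂𝒯_h`. -/
def ntrace (S : FESpaces T) (q : S.Vh) : T.Bdry := fun K F => (q K).1.2.2 F

/-- The values on `∂𝒯_h` of a single-valued scalar hybrid function. -/
def ofM (S : FESpaces T) (μ : ∀ F : T.Face, S.M F.1) : T.Bdry := fun _ F => (μ (T.toFace F)).1

/-- The function `r · n` on `∂𝒯_h` of a single-valued vector hybrid function. -/
def ofN (S : FESpaces T) (r : S.Nh) : T.Bdry :=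
  fun _ F => dotN (T.normal F) (r (T.toFace F)).1

/-- The values on `∂𝒯_h` of a double-valued scalar hybrid function. -/
def ofTM (S : FESpaces T) (μ : S.TMh) : T.Bdry := fun K F => (μ K F).1

/-- The function `r · n` on `∂𝒯_h` of a double-valued vector hybrid function. -/
def ofTN (S : FESpaces T) (r : S.TNh) : T.Bdry := fun K F => dotN (T.normal F) (r K F).1

/-- `(q, v) - (u, ∇·v) + ⟨û, v·n⟩ = 0` for all `v ∈ V_h`. -/
def GradEq (S : FESpaces T) (q : S.Vh) (u : S.Wh) (uhat : T.Bdry) : Prop :=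
  ∀ v : S.Vh, (∑ K, inner ℝ (q K).1.1 (v K).1.1) - (∑ K, inner ℝ (u K).1.1 (v K).1.2.1)
    + T.bdryInner uhat (S.ntrace v) = 0

/-- `-(q, ∇w) + ⟨q̂·n, w⟩ = (f, w)` for all `w ∈ W_h`; here `qn` stands for `q̂·n`. -/
def DivEq (S : FESpaces T) (f : E d → ℝ) (q : S.Vh) (qn : T.Bdry) : Prop :=
  ∀ w : S.Wh, -(∑ K, inner ℝ (q K).1.1 (w K).1.2.1) + T.bdryInner qn (S.trace w) =
    ∑ K : T.Elem, ∫ x in K.1, f x * (w K).1.1 x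

/-- The unified formulation for `(q_h, u_h, q̂_h, û_h) ∈ V_h × W_h × T(N_h) × T(M_h)`. -/
def IsUnifiedSolution (S : FESpaces T) (τ : ∀ K : T.Elem, T.Facet K → ℝ) (f : E d → ℝ)
    (q : S.Vh) (u : S.Wh) (qhat : S.TNh) (uhat : S.TMh) : Prop :=
  S.GradEq q u (S.ofTM uhat) ∧
  S.DivEq f q (S.ofTN qhat) ∧
  (∀ μ ∈ S.Mh, T.bdryInner (S.ofTN qhat) (S.ofM μ) = 0) ∧
  (∀ r : S.Nh, T.bdryInner (S.ofTM uhat) (S.ofN r) = 0) ∧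
  (∀ (K : T.Elem) (F : T.Facet K),
    (S.ntrace q K F - S.ofTN qhat K F) + τ K F • (S.trace u K F - S.ofTM uhat K F) = 0)

/-- On every interior face, one of the hybrid variables `q̂_h`, `û_h` is single valued. -/
def EitherSingleValued (S : FESpaces T) (qhat : S.TNh) (uhat : S.TMh) : Prop :=
  ∀ (F : Set (E d)),
    (∀ (K K' : T.Elem) (h : IsFacet K.1 F) (h' : IsFacet K'.1 F),
      uhat K ⟨F, h⟩ = uhat K' ⟨F, h'⟩) ∨
    (∀ (K K' : T.Elem) (h : IsFacet K.1 F) (h' : IsFacet K'.1 F),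
      qhat K ⟨F, h⟩ = qhat K' ⟨F, h'⟩)

/-- The Dirichlet-type method for `(q_h, u_h, û_h) ∈ V_h × W_h × M_h`, with
`q̂_h·n := q_h·n + τ (u_h - û_h)`. -/
def IsDirichletSolution (S : FESpaces T) (τ : ∀ K : T.Elem, T.Facet K → ℝ) (f : E d → ℝ)
    (q : S.Vh) (u : S.Wh) (uhat : S.Mh) : Prop :=
  let qn : T.Bdry := fun K F => S.ntrace q K F + τ K F • (S.trace u K F - S.ofM uhat.1 K F)
  S.GradEq q u (S.ofM uhat.1) ∧
  S.DivEq f q qn ∧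
  (∀ μ ∈ S.Mh, T.bdryInner qn (S.ofM μ) = 0)

/-- The Neumann-type method for `(q_h, u_h, q̂_h) ∈ V_h × W_h × N_h`, with
`û_h := u_h + τ⁻¹ (q_h - q̂_h)·n`. -/
def IsNeumannSolution (S : FESpaces T) (τ : ∀ K : T.Elem, T.Facet K → ℝ) (f : E d → ℝ)
    (q : S.Vh) (u : S.Wh) (qhat : S.Nh) : Prop :=
  let ub : T.Bdry := fun K F => S.trace u K F + (τ K F)⁻¹ • (S.ntrace q K F - S.ofN qhat K F)
  S.GradEq q u ub ∧
  S.DivEq f q (S.ofN qhat) ∧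
  (∀ r : S.Nh, T.bdryInner ub (S.ofN r) = 0)

/-- The members of `M_h` vanishing outside the set `D` of faces. -/
def MhOn (S : FESpaces T) (D : Set T.Face) : Submodule ℝ (∀ F : T.Face, S.M F.1) where
  carrier := {μ | μ ∈ S.Mh ∧ ∀ F, F ∉ D → μ F = 0}
  add_mem' := fun ha hb => ⟨S.Mh.add_mem ha.1 hb.1, fun F hF => by simp [ha.2 F hF, hb.2 F hF]⟩
  zero_mem' := ⟨S.Mh.zero_mem, fun F _ => rfl⟩
  smul_mem' := fun c a ha => ⟨S.Mh.smul_mem c ha.1, fun F hF => by simp [ha.2 F hF]⟩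

/-- The members of `N_h` vanishing on the set `D` of faces. -/
def NhOff (S : FESpaces T) (D : Set T.Face) : Submodule ℝ (∀ F : T.Face, S.N F.1) where
  carrier := {r | ∀ F, F ∈ D → r F = 0}
  add_mem' := fun ha hb F hF => by simp [ha F hF, hb F hF]
  zero_mem' := fun F _ => rfl
  smul_mem' := fun c a ha F hF => by simp [ha F hF]

open Classical in
/-- The mixed-type method: the unknown hybrid variable is `û_h` on the faces in `D` and
`q̂_h` on the other faces; on `D`, `q̂_h·n := q_h·n + τ (u_h - û_h)`, and on the
other faces `û_h := u_h + τ⁻¹ (q_h - q̂_h)·n`. -/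
def IsMixedSolution (S : FESpaces T) (τ : ∀ K : T.Elem, T.Facet K → ℝ) (f : E d → ℝ)
    (D : Set T.Face) (q : S.Vh) (u : S.Wh) (qhat : S.NhOff D) (uhat : S.MhOn D) : Prop :=
  let ub : T.Bdry := fun K F =>
    if T.toFace F ∈ D then S.ofM uhat.1 K F
    else S.trace u K F + (τ K F)⁻¹ • (S.ntrace q K F - S.ofN qhat.1 K F)
  let qn : T.Bdry := fun K F =>
    if T.toFace F ∈ D then S.ntrace q K F + τ K F • (S.trace u K F - S.ofM uhat.1 K F)
    else S.ofN qhat.1 K F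
  S.GradEq q u ub ∧
  S.DivEq f q qn ∧
  (∀ μ ∈ S.MhOn D, T.bdryInner qn (S.ofM μ) = 0) ∧
  (∀ r ∈ S.NhOff D, T.bdryInner ub (S.ofN r) = 0)

/-- First-order approximation by `V_h`: with `P_V` the `L²`-projection onto `V_h`,
`‖θ·n - (P_V θ)·n‖_{∂𝒯_h} ≤ A h^{1/2} |θ|_{1,Ω}` for all smooth vector fields `θ`. -/
def HasNormalApproximation (S : FESpaces T) (A : ℝ) : Prop :=
  ∀ θ : E d → E d, ContDiff ℝ ∞ θ → ∀ p : S.Vh,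
    (∀ v : S.Vh, ∑ K, inner ℝ (p K).1.1 (v K).1.1 =
      ∑ K : T.Elem, ∫ x in K.1, inner ℝ (θ x) ((v K).1.1 x)) →
    Real.sqrt (∑ K : T.Elem, ∑ F : T.Facet K,
        ∫ x in F.1, (inner ℝ (θ x) (T.normal F) - S.ntrace p K F x) ^ 2 ∂(surf d)) ≤
      A * Real.sqrt T.size * Real.sqrt (∫ x in Ω, jacSq θ x)

end FESpaces

end HDG

end

open MeasureTheory
open scoped ContDiff

noncomputable section

/-! ### Calculus on half-spaces -/

namespace HDG

/-! All formulations are rewritings of one problem, `IsCoreSolution`: a trace `a` with values in the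
spaces `M(F)`, single valued and zero on `∂Ω`, whose numerical flux `q·n + τ(u - a)` is
conservative, that is, takes opposite values on the two sides of an interior face. Assumptions
`A1`-`A4` put every jump into the test spaces, so the weak continuity equations hold strongly. Since
`τ > 0`, trace and flux determine each other. It is then enough to solve and to bound the core
problem.

Single-valued traces are orthogonal to conservative fluxes (`bdryInner_eq_zero`). Testing the core
problem with its own solution therefore gives the energy identity `‖q‖² + ‖τ^{1/2}(u - a)‖² = (f,
u)` (`IsCoreSolution.energy`).

The function `u` is controlled by a duality argument that needs no elliptic regularity. For a smooth
field `θ` with projection `p` onto `V_h`, `(u, ∇·θ) = (q, p) + ⟨u - a, θ·n - p·n⟩`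
(`sum_integral_mul_divg`). No boundary condition on `θ` is needed, because `a` vanishes on `∂Ω`. It
remains to bound `‖u‖` by such pairings with a constant that does not depend on the mesh. For this,
`u` is extended by zero to a cube containing `Ω` and expanded in plane waves whose frequencies are
shifted away from zero. Every trigonometric polynomial in these waves is the divergence of a smooth
field with comparable `H¹` norm (`HDG.exists_infsup`, `Mesh.exists_infsup`).

Stability follows by bounding `‖u‖` by the square root of the energy and cancelling that root. For
zero load the energy vanishes, the pairings vanish with it, and so does `u`. This is uniqueness, and
existence follows because the Dirichlet-type method is a square linear system.

Two geometric facts support this. An interior face belongs to exactly two elements, which have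
opposite normals there. Moreover the gradient, divergence and traces recorded with a function are
determined by it, so that a vanishing field or function means a vanishing member of the finite
element space (`IsHdiv.eq_zero`, `IsH1.eq_zero`). The second fact comes from Green's formula on a
half-space, applied near the relative interior of a facet. -/

/-- An isometric parametrization of the hyperplane orthogonal to a unit vector. -/
theorem exists_hyperplane_chart {m : ℕ} {n : E (m + 1)} (hn : ‖n‖ = 1) :
    ∃ ι : E m →ₗᵢ[ℝ] E (m + 1), (∀ y, inner ℝ n (ι y) = 0) ∧
      (∀ x, inner ℝ n x = 0 → ∃ y, ι y = x) ∧
      MeasurePreserving (fun p : ℝ × E m => p.1 • n + ι p.2) (volume.prod volume) volume := by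
  have hn0 : n ≠ 0 := by rintro rfl; simp at hn
  have : Fact (Module.finrank ℝ (E (m + 1)) = m + 1) := ⟨by simp⟩
  let e : E m ≃ₗᵢ[ℝ] (Submodule.span ℝ {n})ᗮ :=
    (OrthonormalBasis.fromOrthogonalSpanSingleton m hn0).repr.symm
  let ι : E m →ₗᵢ[ℝ] E (m + 1) := (Submodule.subtypeₗᵢ _).comp e.toLinearIsometry
  have hι : ∀ y, inner ℝ n (ι y) = 0 := fun y =>
    Submodule.mem_orthogonal_singleton_iff_inner_right.1 (e y).2
  refine ⟨ι, hι, fun x hx => ?_, ?_⟩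
  · refine ⟨e.symm ⟨x, Submodule.mem_orthogonal_singleton_iff_inner_right.2 hx⟩, ?_⟩
    simp [ι]
  -- The plain product carries the sup norm, so the map is an isometry only on the `L²` product.
  -- Volume is preserved both by linear isometries of equal dimension and by the change of norm
  -- `toLp`.
  · let l : WithLp 2 (ℝ × E m) →ₗᵢ[ℝ] E (m + 1) :=
      { toFun := fun p => p.fst • n + ι p.snd
        map_add' := fun p q => by simp [add_smul]; abel
        map_smul' := fun c p => by simp [mul_smul]
        norm_map' := fun p => by
          have h : ‖p.fst • n + ι p.snd‖ ^ 2 = ‖p‖ ^ 2 := by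
            rw [norm_add_sq_real, inner_smul_left, hι, WithLp.prod_norm_sq_eq_of_L2, norm_smul, hn]
            simp
          have := (sq_eq_sq₀ (norm_nonneg _) (norm_nonneg _)).1 h
          simpa using this }
    have hfr : Module.finrank ℝ (WithLp 2 (ℝ × E m)) = Module.finrank ℝ (E (m + 1)) := by
      rw [(WithLp.linearEquiv 2 ℝ (ℝ × E m)).finrank_eq]
      simp [add_comm]
    have h1 := (l.toLinearIsometryEquiv hfr).measurePreserving
    have h2 := WithLp.volume_preserving_toLp ℝ (E m)
    exact h1.comp h2

variable {m : ℕ} {n : E (m + 1)}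

theorem isometry_chart (ι : E m →ₗᵢ[ℝ] E (m + 1)) (c : E (m + 1)) :
    Isometry (fun y => c + ι y) :=
  ((IsometryEquiv.addLeft c).isometry).comp ι.isometry

theorem range_chart {ι : E m →ₗᵢ[ℝ] E (m + 1)} (hn : ‖n‖ = 1) (h0 : ∀ y, inner ℝ n (ι y) = 0)
    (hs : ∀ x, inner ℝ n x = 0 → ∃ y, ι y = x) (c : ℝ) :
    Set.range (fun y => c • n + ι y) = {x | inner ℝ n x = c} := by
  have hnn : inner ℝ n n = 1 := by rw [real_inner_self_eq_norm_sq, hn]; norm_num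
  ext x
  constructor
  · rintro ⟨y, rfl⟩
    simp [inner_add_right, inner_smul_right, h0, hn]
  · intro hx
    obtain ⟨y, hy⟩ := hs (x - c • n) (by
      rw [inner_sub_right, inner_smul_right, hnn, mul_one]; exact sub_eq_zero.2 hx)
    exact ⟨y, by simp [hy]⟩

/-- An isometry carries the `m`-dimensional Hausdorff measure to its restriction to the range, and
on `E m` that measure is Lebesgue measure. -/
theorem surf_restrict_hyperplane {ι : E m →ₗᵢ[ℝ] E (m + 1)} (hn : ‖n‖ = 1)
    (h0 : ∀ y, inner ℝ n (ι y) = 0) (hs : ∀ x, inner ℝ n x = 0 → ∃ y, ι y = x) (c : ℝ) :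
    (surf (m + 1)).restrict {x | inner ℝ n x = c} =
      (volume : Measure (E m)).map (fun y => c • n + ι y) := by
  rw [← EuclideanSpace.euclideanHausdorffMeasure_eq_volume,
    (isometry_chart ι _).map_euclideanHausdorffMeasure, range_chart hn h0 hs]
  rfl

/-- Integration by parts against the constant function `1`. -/
theorem integral_fderiv_eq_zero {φ : E m → ℝ} (hφ : ContDiff ℝ 1 φ) (hc : HasCompactSupport φ)
    (w : E m) : ∫ y, fderiv ℝ φ y w = 0 := by
  have hi : Integrable φ := hφ.continuous.integrable_of_hasCompactSupport hc
  have hi' : Integrable (fun y => fderiv ℝ φ y w) :=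
    ((hφ.continuous_fderiv one_ne_zero).clm_apply continuous_const).integrable_of_hasCompactSupport
      (hc.fderiv_apply ℝ w)
  have := integral_bilinear_hasLineDerivAt_right_eq_neg_left_of_integrable (μ := volume)
    (f := fun _ : E m => (1 : ℝ)) (f' := fun _ => 0) (g := φ) (g' := fun y => fderiv ℝ φ y w)
    (v := w) (B := ContinuousLinearMap.mul ℝ ℝ) (by simp) (by simpa using hi') (by simpa using hi)
    (fun x _ => by simpa using (hasFDerivAt_const (1 : ℝ) x).hasLineDerivAt w)
    (fun x _ => ((hφ.differentiable one_ne_zero) x).hasFDerivAt.hasLineDerivAt w)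
  simpa using this

/-- Integration by parts on a half-space, for one compactly supported function. -/
theorem integral_halfspace_fderiv (hn : ‖n‖ = 1) {ψ : E (m + 1) → ℝ} (hψ : ContDiff ℝ 1 ψ)
    (hc : HasCompactSupport ψ) (c : ℝ) (v : E (m + 1)) :
    ∫ x in {x | inner ℝ n x ≤ c}, fderiv ℝ ψ x v =
      inner ℝ n v * ∫ x in {x | inner ℝ n x = c}, ψ x ∂(surf (m + 1)) := by
  have hnn : inner ℝ n n = 1 := by rw [real_inner_self_eq_norm_sq, hn]; norm_num
  obtain ⟨ι, h0, hs, hmp⟩ := exists_hyperplane_chart hn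
  have hmeas : MeasurableSet {x : E (m + 1) | inner ℝ n x ≤ c} :=
    measurableSet_le (by fun_prop) measurable_const
  have hcont : ∀ v, Continuous (fun x => fderiv ℝ ψ x v) := fun v =>
    (hψ.continuous_fderiv one_ne_zero).clm_apply continuous_const
  have hint : ∀ v, Integrable (fun x => fderiv ℝ ψ x v) := fun v =>
    (hcont v).integrable_of_hasCompactSupport (hc.fderiv_apply ℝ v)
  have hpre : (fun p : ℝ × E m => p.1 • n + ι p.2) ⁻¹' {x | inner ℝ n x ≤ c} =
      Set.Iic c ×ˢ Set.univ := by
    ext p; simp [inner_add_right, inner_smul_right, h0, hn]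
  have hmpr : MeasurePreserving (fun p : ℝ × E m => p.1 • n + ι p.2)
      ((volume.restrict (Set.Iic c)).prod volume) (volume.restrict {x | inner ℝ n x ≤ c}) := by
    have := hmp.restrict_preimage hmeas
    rwa [hpre, ← Measure.prod_restrict, Measure.restrict_univ] at this
  have hcl : Topology.IsClosedEmbedding (fun p : ℝ × E m => p.1 • n + ι p.2) := by
    apply Topology.IsClosedEmbedding.of_continuous_injective_isClosedMap
    · fun_prop
    · rintro ⟨s, y⟩ ⟨s', y'⟩ h
      have h1 := congrArg (fun x => inner ℝ n x) h
      simp [inner_add_right, inner_smul_right, h0, hn] at h1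
      subst h1
      simpa using h
    · have hl : IsClosedMap (LinearMap.toContinuousLinearMap
        ((LinearMap.toSpanSingleton ℝ (E (m+1)) n).coprod ι.toLinearMap)) := by
        apply (LinearMap.isClosedEmbedding_of_injective _).isClosedMap
        rw [LinearMap.ker_eq_bot]
        rintro ⟨s, y⟩ ⟨s', y'⟩ h
        have h1 := congrArg (fun x => inner ℝ n x) h
        simp [inner_add_right, inner_smul_right, h0, hn] at h1
        subst h1
        simpa using h
      exact hl
  have hint' : ∀ v, Integrable (fun p : ℝ × E m => fderiv ℝ ψ (p.1 • n + ι p.2) v)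
      ((volume.restrict (Set.Iic c)).prod volume) := fun v =>
    hmpr.integrable_comp_of_integrable (hint v).integrableOn
  have hchange : ∀ v, ∫ x in {x | inner ℝ n x ≤ c}, fderiv ℝ ψ x v =
      ∫ p, fderiv ℝ ψ (p.1 • n + ι p.2) v ∂((volume.restrict (Set.Iic c)).prod volume) := by
    intro v
    rw [← hmpr.map_eq, integral_map hmpr.measurable.aemeasurable
      (hcont v).aestronglyMeasurable]
  -- On each slice parallel to the boundary, a tangential derivative of `ψ` is a derivative of a
  -- compactly supported function on `E m`, so it integrates to zero.
  have htan : ∀ w, ∫ x in {x | inner ℝ n x ≤ c}, fderiv ℝ ψ x (ι w) = 0 := by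
    intro w
    rw [hchange, integral_prod _ (hint' _)]
    apply integral_eq_zero_of_ae
    refine Filter.Eventually.of_forall fun s => ?_
    have hd : ∀ y, fderiv ℝ (fun y => ψ (s • n + ι y)) y w = fderiv ℝ ψ (s • n + ι y) (ι w) := by
      intro y
      have h1 : HasFDerivAt (fun y => s • n + ι y) (ι.toContinuousLinearMap) y :=
        (ι.toContinuousLinearMap.hasFDerivAt).const_add _
      have h2 := ((hψ.differentiable one_ne_zero) (s • n + ι y)).hasFDerivAt.comp y h1
      have h3 := h2.fderiv
      simp only [Function.comp_def] at h3
      rw [h3]; rfl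
    simp only [Pi.zero_apply]
    rw [← integral_fderiv_eq_zero (φ := fun y => ψ (s • n + ι y))
      (hψ.comp (by fun_prop)) (hc.comp_isClosedEmbedding (isometry_chart ι _).isClosedEmbedding) w]
    simp_rw [hd]
  -- In the normal direction the fundamental theorem of calculus on `Iic c` leaves only the value at
  -- the boundary.
  have hnor : ∫ x in {x | inner ℝ n x ≤ c}, fderiv ℝ ψ x n =
      ∫ x in {x | inner ℝ n x = c}, ψ x ∂(surf (m + 1)) := by
    rw [hchange, integral_prod_symm _ (hint' _), surf_restrict_hyperplane hn h0 hs,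
      integral_map (isometry_chart ι _).continuous.measurable.aemeasurable
        hψ.continuous.aestronglyMeasurable]
    congr 1
    ext y
    have hiso : Isometry (fun s : ℝ => s • n + ι y) := by
      apply Isometry.of_dist_eq
      intro s t
      rw [dist_add_right, dist_eq_norm, dist_eq_norm, ← sub_smul, norm_smul, hn, mul_one]
    rw [← HasCompactSupport.integral_Iic_deriv_eq (f := fun s : ℝ => ψ (s • n + ι y))
      (hψ.comp (by fun_prop)) (hc.comp_isClosedEmbedding hiso.isClosedEmbedding) c]
    congr 1
    ext s
    have h1 : HasDerivAt (fun s : ℝ => s • n + ι y) n s := by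
      simpa using ((hasDerivAt_id s).smul_const n).add_const (ι y)
    exact ((((hψ.differentiable one_ne_zero) _).hasFDerivAt.comp_hasDerivAt s h1).deriv).symm
  obtain ⟨w, hw⟩ := hs (v - inner ℝ n v • n) (by
    rw [inner_sub_right, inner_smul_right, hnn, mul_one, sub_self])
  have hv : v = inner ℝ n v • n + ι w := by rw [hw]; abel
  have : ∀ x, fderiv ℝ ψ x v = inner ℝ n v * fderiv ℝ ψ x n + fderiv ℝ ψ x (ι w) := by
    intro x
    conv_lhs => rw [hv]
    rw [map_add, map_smul, smul_eq_mul]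
  simp_rw [this]
  rw [integral_add ((hint n).integrableOn.const_mul _) (hint _).integrableOn, htan, add_zero,
    integral_const_mul, hnor]

/-- The divergence theorem on a half-space for compactly supported fields. -/
theorem integral_halfspace_divg (hn : ‖n‖ = 1) {Φ : E (m + 1) → E (m + 1)} (hΦ : ContDiff ℝ 1 Φ)
    (hc : HasCompactSupport Φ) (c : ℝ) :
    ∫ x in {x | inner ℝ n x ≤ c}, divg Φ x =
      ∫ x in {x | inner ℝ n x = c}, inner ℝ (Φ x) n ∂(surf (m + 1)) := by
  have hcomp : ∀ i, ContDiff ℝ 1 (fun x => Φ x i) := fun i => by fun_prop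
  have hcs : ∀ i, HasCompactSupport (fun x => Φ x i) := fun i =>
    hc.comp_left (g := fun y : E (m + 1) => y i) rfl
  have hd : ∀ x i, (fderiv ℝ Φ x (stdVec i)) i = fderiv ℝ (fun x => Φ x i) x (stdVec i) := by
    intro x i
    have h1 := (EuclideanSpace.proj (𝕜 := ℝ) i : E (m + 1) →L[ℝ] ℝ).hasFDerivAt.comp x
      ((hΦ.differentiable one_ne_zero) x).hasFDerivAt
    have h2 := h1.fderiv
    change fderiv ℝ (fun x => Φ x i) x = _ at h2
    rw [h2]; rfl
  obtain ⟨ι, h0, hs, -⟩ := exists_hyperplane_chart hn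
  have hint : ∀ i, Integrable (fun x => Φ x i)
      ((surf (m + 1)).restrict {x | inner ℝ n x = c}) := by
    intro i
    rw [surf_restrict_hyperplane hn h0 hs, integrable_map_measure
      (hcomp i).continuous.aestronglyMeasurable
      (isometry_chart ι _).continuous.measurable.aemeasurable]
    exact ((hcomp i).continuous.comp (isometry_chart ι _).continuous).integrable_of_hasCompactSupport
      ((hcs i).comp_isClosedEmbedding (isometry_chart ι _).isClosedEmbedding)
  have hint2 : ∀ i, Integrable (fun x => fderiv ℝ (fun x => Φ x i) x (stdVec i))
      (volume.restrict {x | inner ℝ n x ≤ c}) := fun i =>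
    ((((hcomp i).continuous_fderiv one_ne_zero).clm_apply
      continuous_const).integrable_of_hasCompactSupport ((hcs i).fderiv_apply ℝ _)).integrableOn
  simp only [divg, hd]
  rw [integral_finsetSum _ (fun i _ => hint2 i)]
  simp_rw [fun i => integral_halfspace_fderiv hn (hcomp i) (hcs i) c (stdVec i)]
  have : ∀ x, inner ℝ (Φ x) n = ∑ i, n i * Φ x i := fun x => by simp [PiLp.inner_apply]
  simp_rw [this]
  rw [integral_finsetSum _ (fun i _ => (hint i).const_mul _)]
  refine Finset.sum_congr rfl fun i _ => ?_
  rw [integral_const_mul, stdVec, EuclideanSpace.inner_single_right]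
  simp

end HDG

/-! ### Facets of polytopes and the combinatorics of meshes -/

namespace HDG

theorem IsPolytope.convex {d : ℕ} {K : Set (E d)} (h : IsPolytope K) : Convex ℝ K := by
  obtain ⟨⟨s, rfl⟩, -⟩ := h
  exact convex_convexHull ℝ _

theorem IsPolytope.isCompact {d : ℕ} {K : Set (E d)} (h : IsPolytope K) : IsCompact K := by
  obtain ⟨⟨s, rfl⟩, -⟩ := h
  exact s.finite_toSet.isCompact_convexHull ℝ

theorem IsPolytope.isClosed {d : ℕ} {K : Set (E d)} (h : IsPolytope K) : IsClosed K :=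
  h.isCompact.isClosed

variable {m : ℕ} {K F : Set (E (m + 1))} {n : E (m + 1)} {c : ℝ}

theorem exists_pos_add_smul_mem {d : ℕ} {x : E d} {V : Set (E d)} (hV : V ∈ nhds x) (v : E d) :
    ∃ s : ℝ, 0 < s ∧ s < 1 ∧ x + s • v ∈ V := by
  have hc : Continuous (fun s : ℝ => x + s • v) := by fun_prop
  have ht : Filter.Tendsto (fun s : ℝ => x + s • v) (nhdsWithin 0 (Set.Ioi 0)) (nhds x) := by
    simpa using (hc.tendsto 0).mono_left nhdsWithin_le_nhds
  obtain ⟨s, ⟨h1, h2⟩, h3⟩ := (((ht.eventually hV).and self_mem_nhdsWithin).and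
    (nhdsWithin_le_nhds (Iio_mem_nhds (one_pos : (0 : ℝ) < 1)))).exists
  exact ⟨s, h2, h3, h1⟩

/-- `F` is a facet of the polytope `K` with outward unit normal `n`, in the hyperplane
`⟪n, x⟫ = c`. -/
structure IsFacetWith (K F : Set (E (m + 1))) (n : E (m + 1)) (c : ℝ) : Prop where
  polytope : IsPolytope K
  norm_eq : ‖n‖ = 1
  eq : F = {x ∈ K | inner ℝ n x = c}
  le : ∀ x ∈ K, inner ℝ n x ≤ c
  nonempty : F.Nonempty
  finrank_eq : Module.finrank ℝ (vectorSpan ℝ F) = m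

theorem IsOutwardNormal.exists_isFacetWith (hm : 1 ≤ m) (hK : IsPolytope K)
    (hd : Module.finrank ℝ (vectorSpan ℝ F) + 1 = m + 1) (hn : IsOutwardNormal K F n) :
    ∃ c, IsFacetWith K F n c := by
  -- For `m = 0` the empty set would satisfy the dimension condition; `1 ≤ m` excludes it.
  have hne : F.Nonempty := by
    rw [Set.nonempty_iff_ne_empty]
    rintro rfl
    rw [vectorSpan_empty, finrank_bot] at hd; omega
  obtain ⟨h1, h2⟩ := hn
  obtain ⟨x, hx⟩ := id hne
  have hx' := hx
  rw [h2] at hx'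
  refine ⟨inner ℝ n x, hK, h1, ?_, fun y hy => hx'.2 y hy, hne, by omega⟩
  rw [h2]
  ext z
  constructor
  · rintro ⟨hz, hz'⟩
    exact ⟨hz, le_antisymm (hx'.2 z hz) (hz' x hx'.1)⟩
  · rintro ⟨hz, hz'⟩
    exact ⟨hz, fun y hy => hz'.symm ▸ hx'.2 y hy⟩

/-- The interior of `F` relative to the hyperplane `⟪n, x⟫ = c`. -/
def relInt (F : Set (E (m + 1))) (n : E (m + 1)) (c : ℝ) : Set (E (m + 1)) :=
  {x ∈ F | ∃ ε > 0, ∀ y, dist y x < ε → inner ℝ n y = c → y ∈ F}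

theorem relInt_neg : relInt F (-n) (-c) = relInt F n c := by
  simp [relInt]

/-- Near its points, `K` lies on one side of the hyperplane `⟪n, x⟫ = c` only and fills it. -/
def oneSided (K : Set (E (m + 1))) (n : E (m + 1)) (c : ℝ) : Set (E (m + 1)) :=
  interior (K ∪ {x | c < inner ℝ n x})

theorem mem_of_mem_oneSided {x : E (m + 1)} (hx : x ∈ oneSided K n c) (h : inner ℝ n x ≤ c) :
    x ∈ K := by
  rcases interior_subset hx with h' | h'
  · exact h'
  · exact absurd h (not_le.2 h')

theorem oneSided_mem_nhds {x : E (m + 1)} (hx : x ∈ oneSided K n c) : oneSided K n c ∈ nhds x :=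
  isOpen_interior.mem_nhds hx

namespace IsFacetWith

theorem inner_self_normal (h : IsFacetWith K F n c) : inner ℝ n n = 1 := by
  rw [real_inner_self_eq_norm_sq, h.norm_eq]; norm_num

theorem convex (h : IsFacetWith K F n c) : Convex ℝ F := by
  rw [h.eq]
  exact h.polytope.convex.inter (convex_hyperplane (innerSL ℝ n).toLinearMap.isLinear c)

theorem isClosed (h : IsFacetWith K F n c) : IsClosed F := by
  rw [h.eq]
  exact h.polytope.isClosed.inter (isClosed_eq (by fun_prop) continuous_const)

theorem subset (h : IsFacetWith K F n c) : F ⊆ K := by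
  rw [h.eq]; exact Set.sep_subset _ _

theorem isCompact (h : IsFacetWith K F n c) : IsCompact F :=
  h.polytope.isCompact.of_isClosed_subset h.isClosed h.subset

theorem inner_eq (h : IsFacetWith K F n c) {x : E (m + 1)} (hx : x ∈ F) : inner ℝ n x = c := by
  rw [h.eq] at hx; exact hx.2

theorem lt_of_mem_interior (h : IsFacetWith K F n c) {x : E (m + 1)} (hx : x ∈ interior K) :
    inner ℝ n x < c := by
  obtain ⟨ε, h2, -, h1⟩ := exists_pos_add_smul_mem (mem_interior_iff_mem_nhds.1 hx) n
  have := h.le _ h1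
  rw [inner_add_right, inner_smul_right, h.inner_self_normal] at this
  linarith

theorem chart_mem_relInt (h : IsFacetWith K F n c) {ι : E m →ₗᵢ[ℝ] E (m + 1)}
    (h0 : ∀ y, inner ℝ n (ι y) = 0) (hs : ∀ x, inner ℝ n x = 0 → ∃ y, ι y = x) {y : E m}
    (hy : y ∈ interior ((fun y => c • n + ι y) ⁻¹' F)) : c • n + ι y ∈ relInt F n c := by
  obtain ⟨ε, hε, hb⟩ := Metric.mem_nhds_iff.1 (mem_interior_iff_mem_nhds.1 hy)
  refine ⟨hb (Metric.mem_ball_self hε), ε, hε, fun z hz hz' => ?_⟩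
  have : z ∈ Set.range (fun y => c • n + ι y) := by
    rw [range_chart h.norm_eq h0 hs]; exact hz'
  obtain ⟨w, rfl⟩ := this
  refine hb ?_
  rwa [Metric.mem_ball, ← (isometry_chart ι (c • n)).dist_eq]

/-- In the chart the facet is a convex subset of `E m` whose vector span has the full dimension `m`,
and such a set has interior points. -/
theorem nonempty_interior_chart (h : IsFacetWith K F n c) {ι : E m →ₗᵢ[ℝ] E (m + 1)}
    (h0 : ∀ y, inner ℝ n (ι y) = 0) (hs : ∀ x, inner ℝ n x = 0 → ∃ y, ι y = x) :
    (interior ((fun y => c • n + ι y) ⁻¹' F)).Nonempty := by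
  let φ : E m →ᵃ[ℝ] E (m + 1) := AffineMap.const ℝ (E m) (c • n) + ι.toLinearMap.toAffineMap
  have hφ : (φ : E m → E (m + 1)) = fun y => c • n + ι y := by ext; simp [φ]
  have hconv : Convex ℝ ((fun y => c • n + ι y) ⁻¹' F) := by
    rw [← hφ]; exact h.convex.affine_preimage φ
  have himg : φ '' ((fun y => c • n + ι y) ⁻¹' F) = F := by
    rw [hφ, Set.image_preimage_eq_inter_range, range_chart h.norm_eq h0 hs]
    exact Set.inter_eq_left.2 fun x hx => h.inner_eq hx
  have hne : ((fun y => c • n + ι y) ⁻¹' F).Nonempty := by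
    have := h.nonempty
    rw [← himg] at this
    exact this.of_image
  rw [hconv.interior_nonempty_iff_affineSpan_eq_top,
    AffineSubspace.affineSpan_eq_top_iff_vectorSpan_eq_top_of_nonempty _ _ _ hne]
  apply Submodule.eq_top_of_finrank_eq
  have h1 := h.finrank_eq
  rw [← himg, ← AffineMap.map_vectorSpan] at h1
  have h2 : φ.linear = ι.toLinearMap := by ext; simp [φ]
  rw [h2, (Submodule.equivMapOfInjective ι.toLinearMap ι.injective _).finrank_eq.symm] at h1
  simpa using h1

theorem nonempty_relInt (h : IsFacetWith K F n c) : (relInt F n c).Nonempty := by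
  obtain ⟨ι, h0, hs, -⟩ := exists_hyperplane_chart h.norm_eq
  obtain ⟨y, hy⟩ := h.nonempty_interior_chart h0 hs
  exact ⟨_, h.chart_mem_relInt h0 hs hy⟩

theorem surf_restrict (h : IsFacetWith K F n c) {ι : E m →ₗᵢ[ℝ] E (m + 1)}
    (h0 : ∀ y, inner ℝ n (ι y) = 0) (hs : ∀ x, inner ℝ n x = 0 → ∃ y, ι y = x)
    {s : Set (E (m + 1))} (hsF : s ⊆ F) (hms : MeasurableSet s) :
    surf (m + 1) s = volume ((fun y => c • n + ι y) ⁻¹' s) := by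
  have h1 : surf (m + 1) s = (surf (m + 1)).restrict {x | inner ℝ n x = c} s := by
    rw [Measure.restrict_apply hms, Set.inter_eq_left.2]
    exact fun x hx => h.inner_eq (hsF hx)
  rw [h1, surf_restrict_hyperplane h.norm_eq h0 hs,
    Measure.map_apply (isometry_chart ι _).continuous.measurable hms]

theorem surf_lt_top (h : IsFacetWith K F n c) : surf (m + 1) F < ⊤ := by
  obtain ⟨ι, h0, hs, -⟩ := exists_hyperplane_chart h.norm_eq
  rw [h.surf_restrict h0 hs subset_rfl h.isClosed.measurableSet]
  exact ((isometry_chart ι _).isClosedEmbedding.isCompact_preimage h.isCompact).measure_lt_top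

/-- A relatively open set containing the relative interior of a facet has full measure in it. -/
theorem surf_diff_eq_zero (h : IsFacetWith K F n c) {U : Set (E (m + 1))} (hU : IsOpen U)
    (hr : relInt F n c ⊆ U) : surf (m + 1) (F \ U) = 0 := by
  obtain ⟨ι, h0, hs, -⟩ := exists_hyperplane_chart h.norm_eq
  rw [h.surf_restrict h0 hs Set.sdiff_subset (h.isClosed.measurableSet.diff hU.measurableSet)]
  let φ : E m →ᵃ[ℝ] E (m + 1) := AffineMap.const ℝ (E m) (c • n) + ι.toLinearMap.toAffineMap
  have hφ : (φ : E m → E (m + 1)) = fun y => c • n + ι y := by ext; simp [φ]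
  have hconv : Convex ℝ ((fun y => c • n + ι y) ⁻¹' F) := by
    rw [← hφ]; exact h.convex.affine_preimage φ
  -- What is left of `F` lies, in the chart, in the frontier of a convex set, which is a Lebesgue
  -- null set.
  refine measure_mono_null ?_ (hconv.addHaar_frontier volume)
  rintro y ⟨hy1, hy2⟩
  exact ⟨subset_closure hy1, fun hy => hy2 (hr (h.chart_mem_relInt h0 hs hy))⟩

/-- Project centrally from an interior point `k` of `K` onto the hyperplane. The projection `f` is
continuous near `x` and fixes `x`, so it sends nearby points to `F`. A nearby point below the
hyperplane then lies on a segment from `k` to a point of `F`, hence in `K`. -/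
theorem relInt_subset_oneSided (h : IsFacetWith K F n c) : relInt F n c ⊆ oneSided K n c := by
  rintro x ⟨hxF, ε, hε, hx⟩
  obtain ⟨k, hk⟩ := h.polytope.2
  have hkc := h.lt_of_mem_interior hk
  have hxc := h.inner_eq hxF
  set δ := c - inner ℝ n k with hδ
  have hδ0 : 0 < δ := by linarith
  let t : E (m + 1) → ℝ := fun y => (c - inner ℝ n y) / δ
  have ht : Continuous t := by fun_prop
  have htx : t x = 0 := by simp [t, hxc]
  let f : E (m + 1) → E (m + 1) := fun y => (1 - t y)⁻¹ • (y - t y • k)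
  have hf : ContinuousAt f x := by
    have h1 : ContinuousAt (fun y => (1 - t y)⁻¹) x :=
      (continuous_const.sub ht).continuousAt.inv₀ (by simp [htx])
    exact h1.smul (continuous_id.sub (ht.smul continuous_const)).continuousAt
  have hfx : f x = x := by simp [f, htx]
  refine mem_interior_iff_mem_nhds.2 ?_
  have e1 : ∀ᶠ y in nhds x, dist (f y) x < ε := by
    have := hf.tendsto
    rw [hfx] at this
    exact this (Metric.ball_mem_nhds x hε)
  have e2 : ∀ᶠ y in nhds x, t y < 1 := by
    have := ht.tendsto x
    rw [htx] at this
    exact this (Iio_mem_nhds one_pos)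
  filter_upwards [e1, e2] with y h1 h2
  rcases lt_or_ge c (inner ℝ n y) with h3 | h3
  · exact Or.inr h3
  left
  have ht0 : 0 ≤ t y := div_nonneg (by linarith) hδ0.le
  have h4 : (1 - t y) ≠ 0 := by linarith
  have htd : t y * δ = c - inner ℝ n y := div_mul_cancel₀ _ hδ0.ne'
  have hfF : f y ∈ F := by
    refine hx _ h1 ?_
    simp only [f, inner_smul_right, inner_sub_right]
    rw [inv_mul_eq_div, div_eq_iff h4]
    rw [hδ] at htd
    linarith
  have : y = (1 - t y) • f y + t y • k := by
    simp only [f, smul_smul, mul_inv_cancel₀ h4, one_smul]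
    abel
  rw [this]
  exact h.polytope.convex (h.subset hfF) (interior_subset hk) (by linarith) ht0 (by ring)

/-- From a relative interior point one can move within `F` along the component `v` of `p` tangential
to the hyperplane. This increases `p` unless `v = 0`. -/
theorem eq_smul_of_isMax (h : IsFacetWith K F n c) {x p : E (m + 1)} (hx : x ∈ relInt F n c)
    (hp : ∀ y ∈ F, inner ℝ p y ≤ inner ℝ p x) : p = (inner ℝ n p : ℝ) • n := by
  obtain ⟨hxF, ε, hε, hx'⟩ := hx
  set v := p - (inner ℝ n p : ℝ) • n with hv
  have hnv : inner ℝ n v = 0 := by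
    rw [hv, inner_sub_right, inner_smul_right, h.inner_self_normal]; ring
  have hpv : inner ℝ p v = ‖v‖ ^ 2 := by
    have : p = v + (inner ℝ n p : ℝ) • n := by rw [hv]; abel
    conv_lhs => rw [this]
    rw [inner_add_left, inner_smul_left, hnv, real_inner_self_eq_norm_sq]; simp
  obtain ⟨s, h2', -, h1⟩ := exists_pos_add_smul_mem (Metric.ball_mem_nhds x hε) v
  have h3 := hp _ (hx' _ h1 (by
    rw [inner_add_right, inner_smul_right, hnv, mul_zero, add_zero, h.inner_eq hxF]))
  rw [inner_add_right, inner_smul_right, hpv] at h3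
  have h4 : ‖v‖ ^ 2 ≤ 0 := by
    by_contra h5
    nlinarith [mul_pos h2' (not_le.1 h5)]
  have h5 : v = 0 := by
    simpa using le_antisymm h4 (sq_nonneg ‖v‖)
  rw [hv] at h5
  exact sub_eq_zero.1 h5

variable {K' : Set (E (m + 1))} {n' : E (m + 1)} {c' : ℝ}

theorem normal_eq_or_neg (h : IsFacetWith K F n c) (h' : IsFacetWith K' F n' c') :
    n' = n ∨ n' = -n := by
  obtain ⟨x, hx⟩ := h.nonempty_relInt
  have h1 := h.eq_smul_of_isMax (p := n') hx (fun y hy => by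
    rw [h'.inner_eq hy, h'.inner_eq hx.1])
  have h2 := congrArg norm h1
  rw [norm_smul, h.norm_eq, h'.norm_eq, mul_one, Real.norm_eq_abs] at h2
  rcases (abs_eq (zero_le_one)).1 h2.symm with h3 | h3 <;> rw [h3] at h1 <;> simp [h1]

/-- With equal normals both polytopes would fill the same side of the hyperplane near a relative
interior point of `F`, so their interiors would meet. -/
theorem normal_eq_neg (h : IsFacetWith K F n c) (h' : IsFacetWith K' F n' c')
    (hd : Disjoint (interior K) (interior K')) : n' = -n := by
  rcases h.normal_eq_or_neg h' with rfl | h1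
  swap
  · exact h1
  exfalso
  obtain ⟨x, hx⟩ := h.nonempty_relInt
  have hc : c' = c := by rw [← h.inner_eq hx.1, h'.inner_eq hx.1]
  subst hc
  have hxU := h.relInt_subset_oneSided hx
  have hxU' := h'.relInt_subset_oneSided hx
  obtain ⟨s, h3', -, h12⟩ := exists_pos_add_smul_mem
    (Filter.inter_mem (oneSided_mem_nhds hxU) (oneSided_mem_nhds hxU')) (-n')
  rw [smul_neg, ← sub_eq_add_neg] at h12
  obtain ⟨h1, h2⟩ := h12
  have hlt : inner ℝ n' (x - s • n') < c' := by
    rw [inner_sub_right, inner_smul_right, h.inner_self_normal, h.inner_eq hx.1]; linarith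
  have hop : IsOpen (oneSided K n' c' ∩ oneSided K' n' c' ∩ {y | inner ℝ n' y < c'}) :=
    (isOpen_interior.inter isOpen_interior).inter (isOpen_lt (by fun_prop) continuous_const)
  refine Set.disjoint_left.1 hd (?_ : x - s • n' ∈ interior K) ?_
  · exact interior_maximal (fun y hy => mem_of_mem_oneSided hy.1.1 (le_of_lt hy.2)) hop
      ⟨⟨h1, h2⟩, hlt⟩
  · exact interior_maximal (fun y hy => mem_of_mem_oneSided hy.1.2 (le_of_lt hy.2)) hop
      ⟨⟨h1, h2⟩, hlt⟩

/-- The points near which `K` is a half-space bounded by one facet belong to no other facet. -/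
theorem eq_of_mem_oneSided {G : Set (E (m + 1))} (h : IsFacetWith K F n c)
    (hG : IsFacetWith K G n' c') {x : E (m + 1)} (hxG : x ∈ G) (hx : x ∈ oneSided K n c) :
    G = F := by
  have hxK := hG.subset hxG
  -- A point of `oneSided` strictly below the hyperplane is interior to `K`, and no facet passes
  -- through the interior.
  have hxc : inner ℝ n x = c := by
    by_contra hne
    have hlt : inner ℝ n x < c := lt_of_le_of_ne (h.le x hxK) hne
    have hop : IsOpen (oneSided K n c ∩ {y | inner ℝ n y < c}) :=
      isOpen_interior.inter (isOpen_lt (by fun_prop) continuous_const)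
    have : x ∈ interior K :=
      interior_maximal (fun y hy => mem_of_mem_oneSided hy.1 (le_of_lt hy.2)) hop ⟨hx, hlt⟩
    exact absurd (hG.inner_eq hxG) (hG.lt_of_mem_interior this).ne
  have hxF : x ∈ F := by rw [h.eq]; exact ⟨hxK, hxc⟩
  obtain ⟨ε, hε, hb⟩ := Metric.mem_nhds_iff.1 (oneSided_mem_nhds hx)
  have hxr : x ∈ relInt F n c := by
    refine ⟨hxF, ε, hε, fun y hy hyc => ?_⟩
    rw [h.eq]
    exact ⟨mem_of_mem_oneSided (hb hy) hyc.le, hyc⟩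
  have h1 := h.eq_smul_of_isMax (p := n') hxr (fun y hy => by
    rw [hG.inner_eq hxG]; exact hG.le y (h.subset hy))
  have h2 := congrArg norm h1
  rw [norm_smul, h.norm_eq, hG.norm_eq, mul_one, Real.norm_eq_abs] at h2
  have h3 : n' = n := by
    rcases (abs_eq (zero_le_one)).1 h2.symm with h3 | h3
    · rw [h1, h3, one_smul]
    -- Opposite normals would put an interior point of `K` strictly on both sides of the hyperplane.
    · exfalso
      obtain ⟨k, hk⟩ := h.polytope.2
      have h4 := h.lt_of_mem_interior hk
      have h5 := hG.lt_of_mem_interior hk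
      rw [← hG.inner_eq hxG, h1, h3] at h5
      simp only [neg_smul, one_smul, inner_neg_left] at h5
      linarith
  subst h3
  rw [hG.eq, h.eq, ← hxc, hG.inner_eq hxG]

/-- The relative interior is dense in the facet: moving from any point of `F` a little towards a
relative interior point gives a relative interior point. -/
theorem exists_mem_relInt_of_isOpen (h : IsFacetWith K F n c) {V : Set (E (m + 1))}
    (hV : IsOpen V) (hne : (F ∩ V).Nonempty) : (relInt F n c ∩ V).Nonempty := by
  obtain ⟨x₁, hx₁F, hx₁V⟩ := hne
  obtain ⟨x₀, hx₀F, ε, hε, hx₀⟩ := h.nonempty_relInt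
  obtain ⟨t, h2', h3', h1⟩ := exists_pos_add_smul_mem (hV.mem_nhds hx₁V) (x₀ - x₁)
  have hr : x₁ + t • (x₀ - x₁) = (1 - t) • x₁ + t • x₀ := by module
  rw [hr] at h1
  -- The homothety with centre `x₁` and ratio `t` maps the disc of radius `ε` about `x₀` to one of
  -- radius `t * ε`, which stays in `F` by convexity.
  refine ⟨_, ⟨h.convex hx₁F hx₀F (by linarith) h2'.le (by ring), t * ε, by positivity, ?_⟩, h1⟩
  intro y hy hyc
  have hy' : y = (1 - t) • x₁ + t • (x₀ + t⁻¹ • (y - ((1 - t) • x₁ + t • x₀))) := by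
    rw [smul_add, smul_smul, mul_inv_cancel₀ h2'.ne', one_smul]; abel
  rw [hy']
  refine h.convex hx₁F (hx₀ _ ?_ ?_) (by linarith) h2'.le (by ring)
  · rw [dist_eq_norm, add_sub_cancel_left, norm_smul, norm_inv, Real.norm_eq_abs,
      abs_of_pos h2', inv_mul_lt_iff₀ h2', ← dist_eq_norm]
    exact hy
  · rw [inner_add_right, inner_smul_right, inner_sub_right, inner_add_right, inner_smul_right,
      inner_smul_right, hyc, h.inner_eq hx₁F, h.inner_eq hx₀F]
    ring

end IsFacetWith

theorem IsConvexPolyhedralDomain.isOpen {d : ℕ} {Ω : Set (E d)}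
    (h : IsConvexPolyhedralDomain Ω) : IsOpen Ω := by
  obtain ⟨P, -, rfl⟩ := h; exact isOpen_interior

theorem IsConvexPolyhedralDomain.convex {d : ℕ} {Ω : Set (E d)}
    (h : IsConvexPolyhedralDomain Ω) : Convex ℝ Ω := by
  obtain ⟨P, hP, rfl⟩ := h; exact hP.convex.interior

theorem IsConvexPolyhedralDomain.isBounded {d : ℕ} {Ω : Set (E d)}
    (h : IsConvexPolyhedralDomain Ω) : Bornology.IsBounded Ω := by
  obtain ⟨P, hP, rfl⟩ := h; exact hP.isCompact.isBounded.subset interior_subset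

theorem IsConvexPolyhedralDomain.interior_closure {d : ℕ} {Ω : Set (E d)}
    (h : IsConvexPolyhedralDomain Ω) : interior (closure Ω) = Ω := by
  obtain ⟨P, hP, rfl⟩ := h
  rw [hP.convex.closure_interior_eq_closure_of_nonempty_interior hP.2, hP.isClosed.closure_eq]

/-! ### Adjacency: the elements on the two sides of a face. -/

namespace Mesh

variable {Ω : Set (E (m + 1))} (T : Mesh Ω)

theorem elem_polytope (K : T.Elem) : IsPolytope K.1 := T.polytope K.1 K.2

theorem elem_subset (K : T.Elem) : K.1 ⊆ closure Ω := by
  rw [← T.cover]; exact Set.subset_biUnion_of_mem (u := fun K => K) K.2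

theorem elem_disjoint {K K' : T.Elem} (h : K ≠ K') : Disjoint (interior K.1) (interior K'.1) :=
  T.disjoint_interior _ K.2 _ K'.2 (fun h' => h (Subtype.ext h'))

theorem exists_isFacetWith (hm : 1 ≤ m) {K : T.Elem} (F : T.Facet K) :
    ∃ c, IsFacetWith K.1 F.1 (T.normal F) c :=
  IsOutwardNormal.exists_isFacetWith hm (T.elem_polytope K) F.2.1 F.2.2.choose_spec

theorem norm_normal {K : T.Elem} (F : T.Facet K) : ‖T.normal F‖ = 1 := F.2.2.choose_spec.1

theorem normal_eq_neg (hm : 1 ≤ m) {K K' : T.Elem} (hne : K ≠ K') {F : Set (E (m + 1))}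
    (h : IsFacet K.1 F) (h' : IsFacet K'.1 F) :
    T.normal (⟨F, h'⟩ : T.Facet K') = -T.normal (⟨F, h⟩ : T.Facet K) := by
  obtain ⟨c, hc⟩ := T.exists_isFacetWith hm (⟨F, h⟩ : T.Facet K)
  obtain ⟨c', hc'⟩ := T.exists_isFacetWith hm (⟨F, h'⟩ : T.Facet K')
  exact hc.normal_eq_neg hc' (T.elem_disjoint hne)

/-- A face belongs to at most two elements. -/
theorem eq_of_isFacet (hm : 1 ≤ m) {K K' K'' : T.Elem} (hne : K ≠ K') (hne' : K ≠ K'')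
    {F : Set (E (m + 1))} (h : IsFacet K.1 F) (h' : IsFacet K'.1 F) (h'' : IsFacet K''.1 F) :
    K' = K'' := by
  by_contra hne''
  have h1 := T.normal_eq_neg hm hne h h'
  have h2 := T.normal_eq_neg hm hne' h h''
  -- Three pairwise opposite vectors all vanish, which contradicts `‖n‖ = 1`.
  have h3 := T.normal_eq_neg hm hne'' h' h''
  rw [h2, h1, neg_neg] at h3
  have h4 := T.norm_normal (⟨F, h⟩ : T.Facet K)
  rw [show T.normal (⟨F, h⟩ : T.Facet K) = 0 from by
    have h5 : (2 : ℝ) • T.normal (⟨F, h⟩ : T.Facet K) = 0 := by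
      rw [two_smul]; nth_rw 1 [← h3]; exact neg_add_cancel _
    exact (smul_eq_zero.1 h5).resolve_left two_ne_zero, norm_zero] at h4
  exact zero_ne_one h4

/-- A face shared by two elements does not lie on the boundary. -/
theorem not_subset_frontier (hm : 1 ≤ m) (hΩ : IsConvexPolyhedralDomain Ω) {K K' : T.Elem}
    (hne : K ≠ K') {F : Set (E (m + 1))} (h : IsFacet K.1 F) (h' : IsFacet K'.1 F) :
    ¬ F ⊆ frontier Ω := by
  intro hF
  obtain ⟨c, hc⟩ := T.exists_isFacetWith hm (⟨F, h⟩ : T.Facet K)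
  obtain ⟨c', hc'⟩ := T.exists_isFacetWith hm (⟨F, h'⟩ : T.Facet K')
  obtain ⟨x, hx⟩ := hc.nonempty_relInt
  rw [T.normal_eq_neg hm hne h h'] at hc'
  have hcc : c' = -c := by
    rw [← hc'.inner_eq hx.1, ← hc.inner_eq hx.1, inner_neg_left]
  subst hcc
  have hxU := hc.relInt_subset_oneSided hx
  have hxU' := hc'.relInt_subset_oneSided (relInt_neg ▸ hx)
  -- The two elements fill the two sides of the hyperplane near `x`, so `x` is interior to `closure
  -- Ω`, and hence lies in the open set `Ω`.
  have hxi : x ∈ interior (closure Ω) := by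
    refine mem_interior_iff_mem_nhds.2 ?_
    filter_upwards [oneSided_mem_nhds hxU, oneSided_mem_nhds hxU'] with y hy hy'
    rcases le_total (inner ℝ (T.normal (⟨F, h⟩ : T.Facet K)) y) c with h1 | h1
    · exact T.elem_subset K (mem_of_mem_oneSided hy h1)
    · exact T.elem_subset K' (mem_of_mem_oneSided hy' (by rw [inner_neg_left]; linarith))
  rw [hΩ.interior_closure] at hxi
  have := hF hx.1
  rw [hΩ.isOpen.frontier_eq] at this
  exact this.2 hxi

/-- A face which does not lie on the boundary is shared by two elements. -/
theorem exists_neighbor (hm : 1 ≤ m) (hΩ : IsConvexPolyhedralDomain Ω) {K : T.Elem}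
    {F : Set (E (m + 1))} (h : IsFacet K.1 F) (hF : ¬ F ⊆ frontier Ω) :
    ∃ K' : T.Elem, K ≠ K' ∧ IsFacet K'.1 F := by
  obtain ⟨c, hc⟩ := T.exists_isFacetWith hm (⟨F, h⟩ : T.Facet K)
  set n := T.normal (⟨F, h⟩ : T.Facet K) with hn
  obtain ⟨x₁, hx₁, hx₁'⟩ := Set.not_subset.1 hF
  have hx₁Ω : x₁ ∈ Ω := by
    by_contra hx
    rw [hΩ.isOpen.frontier_eq] at hx₁'
    exact hx₁' ⟨T.elem_subset K (hc.subset hx₁), hx⟩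
  obtain ⟨x, hx, hxΩ⟩ := hc.exists_mem_relInt_of_isOpen hΩ.isOpen ⟨x₁, hx₁, hx₁Ω⟩
  have hcl : IsClosed (⋃ K' ∈ {K' : T.Elem | K ≠ K'}, K'.1) :=
    Set.Finite.isClosed_biUnion (Set.toFinite _) fun K' _ => (T.elem_polytope K').isClosed
  -- The points `x + s n` with small `s > 0` are in `Ω` but beyond the facet, hence in elements
  -- other than `K`. The union of these finitely many closed sets contains the limit `x`.
  have hxC : x ∈ ⋃ K' ∈ {K' : T.Elem | K ≠ K'}, K'.1 := by
    have hcont : Filter.Tendsto (fun s : ℝ => x + s • n) (nhdsWithin 0 (Set.Ioi 0)) (nhds x) := by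
      have : Continuous (fun s : ℝ => x + s • n) := by fun_prop
      simpa using (this.tendsto 0).mono_left nhdsWithin_le_nhds
    refine hcl.mem_of_tendsto hcont ?_
    filter_upwards [hcont (hΩ.isOpen.mem_nhds hxΩ), self_mem_nhdsWithin] with s h1 h2
    have h2' : (0 : ℝ) < s := h2
    have h3 : x + s • n ∈ ⋃ K ∈ T.elems, K := by rw [T.cover]; exact subset_closure h1
    obtain ⟨K', hK', hxK'⟩ := Set.mem_iUnion₂.1 h3
    refine Set.mem_iUnion₂.2 ⟨⟨K', hK'⟩, ?_, hxK'⟩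
    rintro rfl
    have := hc.le _ hxK'
    rw [inner_add_right, inner_smul_right, hc.inner_self_normal, hc.inner_eq hx.1] at this
    linarith
  obtain ⟨K', hne, hxK'⟩ := Set.mem_iUnion₂.1 hxC
  refine ⟨K', hne, ?_⟩
  have hxK := hc.subset hx.1
  have hnsub : ∀ {A B : T.Elem}, A ≠ B → ¬ A.1 ⊆ B.1 := by
    intro A B hAB hs
    obtain ⟨k, hk⟩ := (T.elem_polytope A).2
    exact Set.disjoint_left.1 (T.elem_disjoint hAB) hk (interior_mono hs hk)
  obtain ⟨l, hl⟩ := T.conforming K.1 K.2 K'.1 K'.2 ⟨x, hxK, hxK'⟩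
  -- The functional exposing `K ∩ K'` in `K` is maximal over `F` at the relative interior point `x`,
  -- so it is a multiple `a` of `n`. An interior point of `K` excludes `a < 0`, and `a = 0` would
  -- give `K ⊆ K'`. For `a > 0` the exposed set is `F`.
  have hFB : F = K.1 ∩ K'.1 := by
    set p := (InnerProductSpace.toDual ℝ (E (m + 1))).symm l with hp
    have hpl : ∀ y, l y = inner ℝ p y := fun y => by simp [hp]
    have hxB : x ∈ K.1 ∩ K'.1 := ⟨hxK, hxK'⟩
    have hxB' := hxB
    rw [hl] at hxB'
    have hpn := hc.eq_smul_of_isMax (p := p) hx (fun y hy => by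
      rw [← hpl, ← hpl]; exact hxB'.2 y (hc.subset hy))
    set a : ℝ := inner ℝ n p with ha
    have hla : ∀ y, l y = a * inner ℝ n y := fun y => by
      rw [hpl, hpn, inner_smul_left]; rfl
    obtain ⟨k, hk⟩ := (T.elem_polytope K).2
    have hkc := hc.lt_of_mem_interior hk
    have hxn := hc.inner_eq hx.1
    have h1 := hxB'.2 k (interior_subset hk)
    rw [hla, hla, hxn] at h1
    rcases lt_trichotomy a 0 with h2 | h2 | h2
    · nlinarith
    · exfalso
      refine hnsub hne fun y hy => ?_
      have : y ∈ K.1 ∩ K'.1 := by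
        rw [hl]; exact ⟨hy, fun z _ => by rw [hla, hla, h2]; simp⟩
      exact this.2
    · rw [hl]
      ext y
      constructor
      · intro hy
        exact ⟨hc.subset hy, fun z hz => by
          rw [hla, hla, hc.inner_eq hy]; exact mul_le_mul_of_nonneg_left (hc.le z hz) h2.le⟩
      · rintro ⟨hy, hy'⟩
        have h3 := hy' x hxK
        rw [hla, hla] at h3
        have h4 := le_of_mul_le_mul_left h3 h2
        have h5 : y ∈ {x ∈ K.1 | inner ℝ n x = c} :=
          ⟨hy, le_antisymm (hc.le y hy) (hxn ▸ h4)⟩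
        rw [← hc.eq] at h5
        exact h5
  -- Conformity seen from `K'` supplies a functional exposing the same set in `K'`. It is nonzero,
  -- since otherwise `K' ⊆ K`, and its normalization is the outward normal.
  obtain ⟨l', hl'⟩ := T.conforming K'.1 K'.2 K.1 K.2 ⟨x, hxK', hxK⟩
  set p := (InnerProductSpace.toDual ℝ (E (m + 1))).symm l' with hp
  have hpl : ∀ y, l' y = inner ℝ p y := fun y => by simp [hp]
  have hp0 : p ≠ 0 := by
    intro h0
    refine hnsub hne.symm fun y hy => ?_
    have : y ∈ K'.1 ∩ K.1 := by
      rw [hl']; exact ⟨hy, fun z _ => by rw [hpl, hpl, h0]; simp⟩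
    exact this.2
  have hp1 : 0 < ‖p‖⁻¹ := inv_pos.2 (norm_pos_iff.2 hp0)
  refine ⟨h.1, ‖p‖⁻¹ • p, ?_, ?_⟩
  · rw [norm_smul, norm_inv, norm_norm, inv_mul_cancel₀ (norm_ne_zero_iff.2 hp0)]
  · rw [hFB, Set.inter_comm, hl']
    ext y
    simp only [hpl, inner_smul_left, Set.mem_ofPred_eq]
    refine and_congr_right fun _ => forall₂_congr fun z _ => ?_
    exact (mul_le_mul_iff_right₀ hp1).symm

end Mesh
end HDG

/-! ### Green's formula near a facet; traces are determined by the function -/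

namespace HDG

theorem divg_smul {d : ℕ} {φ : E d → ℝ} {θ : E d → E d} {x : E d} (hφ : DifferentiableAt ℝ φ x)
    (hθ : DifferentiableAt ℝ θ x) :
    divg (fun y => φ y • θ y) x = inner ℝ (gradient φ x) (θ x) + φ x * divg θ x := by
  have h1 : θ x = ∑ i, θ x i • stdVec i := by
    ext j
    simp [stdVec, Finset.sum_apply, Pi.single_apply]
  have h2 : inner ℝ (gradient φ x) (θ x) = ∑ i, θ x i * fderiv ℝ φ x (stdVec i) := by
    rw [inner_gradient_left]
    conv_lhs => rw [h1]
    simp [map_sum]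
  rw [h2]
  simp only [divg]
  rw [fderiv_fun_smul hφ hθ, Finset.mul_sum, ← Finset.sum_add_distrib]
  refine Finset.sum_congr rfl fun i _ => ?_
  simp
  ring

variable {m : ℕ}

/-- Green's formula for functions supported where `K` coincides with a half-space. -/
theorem green_oneSided {K : Set (E (m + 1))} {n : E (m + 1)} {c : ℝ} (hn : ‖n‖ = 1)
    (hK : ∀ x ∈ K, inner ℝ n x ≤ c) {φ : E (m + 1) → ℝ} (hφ : ContDiff ℝ ∞ φ)
    (hc : HasCompactSupport φ) (hs : tsupport φ ⊆ oneSided K n c) {θ : E (m + 1) → E (m + 1)}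
    (hθ : ContDiff ℝ ∞ θ) :
    (∫ x in K, inner ℝ (gradient φ x) (θ x)) + (∫ x in K, φ x * divg θ x) =
      ∫ x in {x ∈ K | inner ℝ n x = c}, φ x * inner ℝ (θ x) n ∂(surf (m + 1)) := by
  have hφd : Differentiable ℝ φ := hφ.differentiable (by simp)
  have hθd : Differentiable ℝ θ := hθ.differentiable (by simp)
  have hg : Continuous (gradient φ) :=
    (InnerProductSpace.toDual ℝ (E (m + 1))).symm.continuous.comp (hφ.continuous_fderiv (by simp))
  have hgs : HasCompactSupport (gradient φ) :=
    (hc.fderiv (𝕜 := ℝ)).comp_left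
      (g := (InnerProductSpace.toDual ℝ (E (m + 1))).symm) (map_zero _)
  have hdθ : Continuous (divg θ) := by
    have h1 : Continuous (fderiv ℝ θ) := hθ.continuous_fderiv (by simp)
    unfold divg
    refine continuous_finsetSum _ fun i _ => ?_
    exact (EuclideanSpace.proj (𝕜 := ℝ) i).continuous.comp (h1.clm_apply continuous_const)
  have hi1 : Integrable (fun x => inner ℝ (gradient φ x) (θ x)) :=
    (hg.inner hθ.continuous).integrable_of_hasCompactSupport
      (hgs.mono fun x hx h => hx (by simp [h]))
  have hi2 : Integrable (fun x => φ x * divg θ x) :=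
    (hφ.continuous.mul hdθ).integrable_of_hasCompactSupport hc.mul_right
  -- In the half-space the function `φ` vanishes off `K`, so integrals over `K` and over its part in
  -- the hyperplane become integrals over the half-space and the whole hyperplane.
  have hzero : ∀ x, inner ℝ n x ≤ c → x ∉ K → x ∉ tsupport φ := fun x h1 h2 h3 =>
    h2 (mem_of_mem_oneSided (hs h3) h1)
  rw [← integral_add hi1.integrableOn hi2.integrableOn]
  have h1 := integral_halfspace_divg hn (Φ := fun y => φ y • θ y)
    ((hφ.smul hθ).of_le (by simp)) hc.smul_right c
  simp_rw [fun x => divg_smul (hφd x) (hθd x)] at h1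
  have hmeasH : MeasurableSet {x : E (m + 1) | inner ℝ n x ≤ c} :=
    measurableSet_le (by fun_prop) measurable_const
  have hmeasE : MeasurableSet {x : E (m + 1) | inner ℝ n x = c} :=
    measurableSet_eq_fun (by fun_prop) measurable_const
  have h2 := setIntegral_eq_of_subset_of_forall_sdiff_eq_zero (μ := volume)
    (f := fun x => inner ℝ (gradient φ x) (θ x) + φ x * divg θ x) hmeasH
    (fun x hx => hK x hx : K ⊆ {x | inner ℝ n x ≤ c}) (fun x hx => by
      have h3 := hzero x hx.1 hx.2
      have h4 : φ x = 0 := image_eq_zero_of_notMem_tsupport h3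
      have h5 : fderiv ℝ φ x = 0 := by
        by_contra h6
        exact h3 (support_fderiv_subset ℝ h6)
      simp [gradient, h4, h5])
  have h6 := setIntegral_eq_of_subset_of_forall_sdiff_eq_zero (μ := surf (m + 1))
    (f := fun x => φ x * inner ℝ (θ x) n) hmeasE
    (fun x hx => hx.2 : {x ∈ K | inner ℝ n x = c} ⊆ {x | inner ℝ n x = c}) (fun x hx => by
      have h3 := hzero x (le_of_eq hx.1) (fun h => hx.2 ⟨h, hx.1⟩)
      simp [image_eq_zero_of_notMem_tsupport h3])
  rw [← h2, h1, ← h6]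
  simp [inner_smul_left]

theorem isFiniteMeasure_surf_facet (hm : 1 ≤ m) {Ω : Set (E (m + 1))} (T : Mesh Ω) {K : T.Elem}
    (F : T.Facet K) : IsFiniteMeasure ((surf (m + 1)).restrict F.1) := by
  obtain ⟨c, hc⟩ := T.exists_isFacetWith hm F
  exact ⟨by rw [Measure.restrict_apply_univ]; exact hc.surf_lt_top⟩

theorem IsPolytope.isFiniteMeasure {d : ℕ} {K : Set (E d)} (hK : IsPolytope K) :
    IsFiniteMeasure (volume.restrict K) :=
  ⟨by rw [Measure.restrict_apply_univ]; exact hK.isCompact.measure_lt_top⟩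

theorem IsPolytope.ae_mem_interior {d : ℕ} {K : Set (E d)} (hK : IsPolytope K) :
    ∀ᵐ x ∂(volume.restrict K), x ∈ interior K := by
  rw [ae_iff, Measure.restrict_apply' hK.isClosed.measurableSet]
  refine measure_mono_null ?_ (hK.convex.addHaar_frontier volume)
  rintro x ⟨h1, h2⟩
  rw [hK.isClosed.frontier_eq]
  exact ⟨h2, h1⟩

namespace Mesh

variable {Ω : Set (E (m + 1))} (T : Mesh Ω)

open Classical in
/-- A smooth function supported where `K` coincides with a half-space bounded by `F`, with its
gradient and trace, is in `H¹(K)`. -/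
theorem exists_isH1_of_facet (hm : 1 ≤ m) {K : T.Elem} (F : T.Facet K) {c : ℝ}
    (hF : IsFacetWith K.1 F.1 (T.normal F) c) {φ : E (m + 1) → ℝ} (hφ : ContDiff ℝ ∞ φ)
    (hc : HasCompactSupport φ) (hs : tsupport φ ⊆ oneSided K.1 (T.normal F) c) :
    ∃ w : T.ScalarData K, T.IsH1 w ∧ w.1 =ᵐ[volume.restrict K.1] φ ∧
      w.2.2 F =ᵐ[(surf (m + 1)).restrict F.1] φ ∧ ∀ G, G ≠ F → w.2.2 G = 0 := by
  have := (T.elem_polytope K).isFiniteMeasure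
  have := isFiniteMeasure_surf_facet hm T F
  have hg : Continuous (gradient φ) :=
    (InnerProductSpace.toDual ℝ (E (m + 1))).symm.continuous.comp (hφ.continuous_fderiv (by simp))
  have hgs : HasCompactSupport (gradient φ) :=
    (hc.fderiv (𝕜 := ℝ)).comp_left
      (g := (InnerProductSpace.toDual ℝ (E (m + 1))).symm) (map_zero _)
  have m1 : MemLp φ 2 (volume.restrict K.1) := hφ.continuous.memLp_of_hasCompactSupport hc
  have m2 : MemLp (gradient φ) 2 (volume.restrict K.1) := hg.memLp_of_hasCompactSupport hgs
  have m3 : MemLp φ 2 ((surf (m + 1)).restrict F.1) := hφ.continuous.memLp_of_hasCompactSupport hc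
  obtain ⟨t, ht, ht'⟩ : ∃ t : (∀ G : T.Facet K, L2F G.1),
      t F =ᵐ[(surf (m + 1)).restrict F.1] φ ∧ ∀ G, G ≠ F → t G = 0 :=
    ⟨Pi.single F m3.toLp, by rw [Pi.single_eq_same]; exact m3.coeFn_toLp,
      fun G hG => Pi.single_eq_of_ne hG _⟩
  refine ⟨(m1.toLp, m2.toLp, t), fun θ hθ => ?_, m1.coeFn_toLp, ht, ht'⟩
  have hgr := green_oneSided hF.norm_eq hF.le hφ hc hs hθ
  rw [← hF.eq] at hgr
  rw [Fintype.sum_eq_single F]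
  · refine Eq.trans (congrArg₂ (· + ·) (integral_congr_ae ?_) (integral_congr_ae ?_))
      (hgr.trans (integral_congr_ae ?_))
    · filter_upwards [m2.coeFn_toLp] with x hx
      rw [hx]
    · filter_upwards [m1.coeFn_toLp] with x hx
      rw [hx]
    · filter_upwards [ht] with x hx
      rw [hx]
  · intro G hG
    refine integral_eq_zero_of_ae ?_
    filter_upwards [Lp.coeFn_zero ℝ 2 ((surf (m + 1)).restrict G.1)] with x hx
    rw [ht' G hG, hx]; simp

/-- A smooth function supported in the interior of `K`, with its gradient and zero trace, is in
`H¹(K)`. -/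
theorem exists_isH1_of_interior {K : T.Elem} {φ : E (m + 1) → ℝ} (hφ : ContDiff ℝ ∞ φ)
    (hc : HasCompactSupport φ) (hs : tsupport φ ⊆ interior K.1) :
    ∃ w : T.ScalarData K, T.IsH1 w ∧ w.1 =ᵐ[volume.restrict K.1] φ ∧ w.2.2 = 0 := by
  have := (T.elem_polytope K).isFiniteMeasure
  have hg : Continuous (gradient φ) :=
    (InnerProductSpace.toDual ℝ (E (m + 1))).symm.continuous.comp (hφ.continuous_fderiv (by simp))
  have hgs : HasCompactSupport (gradient φ) :=
    (hc.fderiv (𝕜 := ℝ)).comp_left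
      (g := (InnerProductSpace.toDual ℝ (E (m + 1))).symm) (map_zero _)
  have m1 : MemLp φ 2 (volume.restrict K.1) := hφ.continuous.memLp_of_hasCompactSupport hc
  have m2 : MemLp (gradient φ) 2 (volume.restrict K.1) := hg.memLp_of_hasCompactSupport hgs
  refine ⟨(m1.toLp, m2.toLp, 0), fun θ hθ => ?_, m1.coeFn_toLp, rfl⟩
  obtain ⟨R, hR⟩ := (T.elem_polytope K).isCompact.isBounded.exists_norm_le
  -- Any direction serves: the hyperplane at height `R + 1` misses `K`, so the half-space formula
  -- has no boundary term.
  set n : E (m + 1) := stdVec 0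
  have hn : ‖n‖ = 1 := by simp [n, stdVec]
  have hK : ∀ x ∈ K.1, inner ℝ n x ≤ R := fun x hx => by
    refine (real_inner_le_norm _ _).trans ?_
    rw [hn, one_mul]; exact hR x hx
  have hK' : ∀ x ∈ K.1, inner ℝ n x ≤ R + 1 := fun x hx => (hK x hx).trans (by linarith)
  have hgr := green_oneSided hn hK' hφ hc
    (hs.trans (interior_mono Set.subset_union_left)) hθ
  have hemp : {x ∈ K.1 | inner ℝ n x = R + 1} = ∅ := by
    ext x
    simp only [Set.mem_ofPred_eq, Set.mem_empty_iff_false, iff_false, not_and]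
    intro hx h
    have := hK x hx
    linarith
  rw [hemp, Measure.restrict_empty, integral_zero_measure] at hgr
  rw [Finset.sum_eq_zero]
  · convert hgr using 2
    · refine integral_congr_ae ?_
      filter_upwards [m2.coeFn_toLp] with x hx
      rw [hx]
    · refine integral_congr_ae ?_
      filter_upwards [m1.coeFn_toLp] with x hx
      rw [hx]
  · intro G _
    refine integral_eq_zero_of_ae ?_
    filter_upwards [Lp.coeFn_zero ℝ 2 ((surf (m + 1)).restrict G.1)] with x hx
    rw [Pi.zero_apply, hx]; simp

theorem ae_mem_oneSided {K : T.Elem} (F : T.Facet K) {c : ℝ}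
    (hF : IsFacetWith K.1 F.1 (T.normal F) c) :
    ∀ᵐ x ∂((surf (m + 1)).restrict F.1), x ∈ oneSided K.1 (T.normal F) c := by
  rw [ae_iff, Measure.restrict_apply' hF.isClosed.measurableSet]
  refine measure_mono_null ?_ (hF.surf_diff_eq_zero isOpen_interior hF.relInt_subset_oneSided)
  rintro x ⟨h1, h2⟩
  exact ⟨h2, h1⟩

variable {T}

/-- A field in `H(div; K)` determines its divergence and normal trace. -/
theorem IsHdiv.eq_zero (hm : 1 ≤ m) {K : T.Elem} {v : T.VectorData K} (hv : T.IsHdiv v)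
    (h0 : v.1 = 0) : v = 0 := by
  have := (T.elem_polytope K).isFiniteMeasure
  -- With vanishing field, Green's formula against functions supported in the interior makes the
  -- divergence orthogonal to all of them. Functions supported near one facet then do the same for
  -- the normal trace.
  have hδ : v.2.1 = 0 := by
    have h1 : ∀ᵐ x ∂(volume.restrict K.1), x ∈ interior K.1 → v.2.1 x = 0 := by
      refine isOpen_interior.ae_eq_zero_of_integral_contDiff_smul_eq_zero
        (((Lp.memLp v.2.1).integrable one_le_two).locallyIntegrable.locallyIntegrableOn _) ?_
      intro φ hφ hc hs
      obtain ⟨w, hw, hw1, hw2⟩ := T.exists_isH1_of_interior hφ hc hs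
      have h2 := hv w hw
      rw [h0, hw2] at h2
      simp only [inner_zero_left, Pi.zero_apply, inner_zero_right, Finset.sum_const_zero,
        zero_add] at h2
      rw [← h2, L2.inner_def]
      refine integral_congr_ae ?_
      filter_upwards [hw1] with x hx
      rw [hx]; simp
    refine Lp.ext ?_
    filter_upwards [h1, (T.elem_polytope K).ae_mem_interior,
      Lp.coeFn_zero ℝ 2 (volume.restrict K.1)] with x h2 h3 h4
    rw [h2 h3, h4]; rfl
  have hs : v.2.2 = 0 := by
    funext F
    have := isFiniteMeasure_surf_facet hm T F
    obtain ⟨c, hF⟩ := T.exists_isFacetWith hm F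
    have h1 : ∀ᵐ x ∂((surf (m + 1)).restrict F.1),
        x ∈ oneSided K.1 (T.normal F) c → v.2.2 F x = 0 := by
      refine isOpen_interior.ae_eq_zero_of_integral_contDiff_smul_eq_zero
        (((Lp.memLp (v.2.2 F)).integrable one_le_two).locallyIntegrable.locallyIntegrableOn _) ?_
      intro φ hφ hc hs
      obtain ⟨w, hw, -, hw2, hw3⟩ := T.exists_isH1_of_facet hm F hF hφ hc hs
      have h2 := hv w hw
      rw [h0, hδ, Fintype.sum_eq_single F (fun G hG => by rw [hw3 G hG, inner_zero_right])] at h2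
      simp only [inner_zero_left, add_zero] at h2
      rw [h2, L2.inner_def]
      refine integral_congr_ae ?_
      filter_upwards [hw2] with x hx
      rw [hx]; simp
    refine Lp.ext ?_
    filter_upwards [h1, T.ae_mem_oneSided F hF,
      Lp.coeFn_zero ℝ 2 ((surf (m + 1)).restrict F.1)] with x h2 h3 h4
    rw [h2 h3, Pi.zero_apply, h4]; rfl
  exact Prod.ext h0 (Prod.ext hδ hs)

/-- A function in `H¹(K)` determines its gradient and trace. -/
theorem IsH1.eq_zero (hm : 1 ≤ m) {K : T.Elem} {w : T.ScalarData K} (hw : T.IsH1 w)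
    (h0 : w.1 = 0) : w = 0 := by
  have := (T.elem_polytope K).isFiniteMeasure
  have hw0 : ∀ θ : E (m + 1) → E (m + 1), ContDiff ℝ ∞ θ →
      (∫ x in K.1, inner ℝ (w.2.1 x) (θ x)) =
        ∑ F : T.Facet K, ∫ x in F.1, w.2.2 F x * inner ℝ (θ x) (T.normal F) ∂(surf (m + 1)) := by
    intro θ hθ
    rw [← hw θ hθ, h0, left_eq_add]
    refine integral_eq_zero_of_ae ?_
    filter_upwards [Lp.coeFn_zero ℝ 2 (volume.restrict K.1)] with x hx
    rw [hx]; simp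
  have hg : w.2.1 = 0 := by
    have hint : Integrable w.2.1 (volume.restrict K.1) := (Lp.memLp w.2.1).integrable one_le_two
    have h1 : ∀ᵐ x ∂(volume.restrict K.1), x ∈ interior K.1 → w.2.1 x = 0 := by
      refine isOpen_interior.ae_eq_zero_of_integral_contDiff_smul_eq_zero
        (hint.locallyIntegrable.locallyIntegrableOn _) ?_
      intro φ hφ hc hs
      refine ext_inner_left ℝ fun e => ?_
      have hsm : Integrable (fun x => φ x • w.2.1 x) (volume.restrict K.1) := by
        obtain ⟨C, hC⟩ := hφ.continuous.bounded_above_of_compact_support hc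
        exact hint.bdd_smul C hφ.continuous.aestronglyMeasurable (Filter.Eventually.of_forall hC)
      rw [inner_zero_right, ← integral_inner hsm]
      -- The test field `φ e` vanishes on every facet, so each component of the gradient is
      -- orthogonal to `φ`.
      have h2 := hw0 (fun x => φ x • e) (hφ.smul contDiff_const)
      rw [Finset.sum_eq_zero] at h2
      · rw [← h2]
        refine integral_congr_ae (Filter.Eventually.of_forall fun x => ?_)
        simp only [inner_smul_right]
        rw [real_inner_comm]
      · intro F _
        obtain ⟨c, hF⟩ := T.exists_isFacetWith hm F
        refine setIntegral_eq_zero_of_forall_eq_zero fun x hx => ?_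
        have : φ x = 0 := by
          refine image_eq_zero_of_notMem_tsupport fun h => ?_
          exact absurd (hF.inner_eq hx) (hF.lt_of_mem_interior (hs h)).ne
        simp [this]
    refine Lp.ext ?_
    filter_upwards [h1, (T.elem_polytope K).ae_mem_interior,
      Lp.coeFn_zero (E (m + 1)) 2 (volume.restrict K.1)] with x h2 h3 h4
    rw [h2 h3, h4]; rfl
  have hs : w.2.2 = 0 := by
    funext F
    have := isFiniteMeasure_surf_facet hm T F
    obtain ⟨c, hF⟩ := T.exists_isFacetWith hm F
    have h1 : ∀ᵐ x ∂((surf (m + 1)).restrict F.1),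
        x ∈ oneSided K.1 (T.normal F) c → w.2.2 F x = 0 := by
      refine isOpen_interior.ae_eq_zero_of_integral_contDiff_smul_eq_zero
        (((Lp.memLp (w.2.2 F)).integrable one_le_two).locallyIntegrable.locallyIntegrableOn _) ?_
      intro φ hφ hc hs
      -- The field `φ n` has normal component `φ` on `F`, and it vanishes on the other facets
      -- because `oneSided` meets none of them.
      have h2 := hw0 (fun x => φ x • T.normal F) (hφ.smul contDiff_const)
      rw [hg, Fintype.sum_eq_single F] at h2
      · rw [integral_eq_zero_of_ae] at h2
        · rw [h2]
          refine integral_congr_ae (Filter.Eventually.of_forall fun x => ?_)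
          simp only [inner_smul_left, hF.inner_self_normal]
          simp [mul_comm]
        · filter_upwards [Lp.coeFn_zero (E (m + 1)) 2 (volume.restrict K.1)] with x hx
          rw [hx]; simp
      · intro G hG
        obtain ⟨c', hG'⟩ := T.exists_isFacetWith hm G
        refine setIntegral_eq_zero_of_forall_eq_zero fun x hx => ?_
        have : φ x = 0 := by
          refine image_eq_zero_of_notMem_tsupport fun h => hG ?_
          exact Subtype.ext (hF.eq_of_mem_oneSided hG' hx (hs h))
        simp [this]
    refine Lp.ext ?_
    filter_upwards [h1, T.ae_mem_oneSided F hF,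
      Lp.coeFn_zero ℝ 2 ((surf (m + 1)).restrict F.1)] with x h2 h3 h4
    rw [h2 h3, Pi.zero_apply, h4]; rfl
  exact Prod.ext h0 (Prod.ext hg hs)

end Mesh
end HDG

/-! ### A divergence inf-sup inequality on a cube, by Fourier series -/

namespace HDG

section Fourier

attribute [local instance] instMeasureSpaceUnitAddCircle

/-- A half-open cube of side `L`. -/
def cube (d : ℕ) (L : ℝ) : Set (E d) := {x | ∀ i, L⁻¹ * x i ∈ Set.Ioc (-1 / 2 : ℝ) (-1 / 2 + 1)}

theorem measurableSet_cube (d : ℕ) (L : ℝ) : MeasurableSet (cube d L) := by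
  have : cube d L = ⋂ i, (fun x : E d => L⁻¹ * x i) ⁻¹' Set.Ioc (-1 / 2 : ℝ) (-1 / 2 + 1) := by
    ext; simp [cube]
  rw [this]
  exact MeasurableSet.iInter fun i => (Continuous.measurable (by fun_prop)) measurableSet_Ioc

theorem exists_subset_cube {d : ℕ} {s : Set (E d)} (hs : Bornology.IsBounded s) :
    ∃ L : ℝ, 0 < L ∧ s ⊆ cube d L := by
  obtain ⟨R, hR⟩ := hs.exists_norm_le
  have hR' : 0 < 2 * |R| + 1 := by positivity
  refine ⟨2 * |R| + 1, hR', fun x hx i => ?_⟩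
  have h1 : |x i| ≤ |R| := (EuclideanSpace.norm_eq x ▸ (by
    have := PiLp.norm_apply_le x i
    rw [← EuclideanSpace.norm_eq]; exact this) : ‖x i‖ ≤ ‖x‖).trans ((hR x hx).trans (le_abs_self R))
  obtain ⟨h2, h3⟩ := abs_le.1 h1
  constructor
  · rw [lt_inv_mul_iff₀ hR']; linarith
  · rw [inv_mul_le_iff₀ hR']; linarith

theorem isBounded_cube (d : ℕ) {L : ℝ} (hL : 0 < L) :
    Bornology.IsBounded (cube d L) := by
  refine Bornology.IsBounded.subset (Metric.isBounded_closedBall (x := 0) (r := √d * L)) ?_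
  intro x hx
  rw [mem_closedBall_zero_iff, EuclideanSpace.norm_eq]
  rw [Real.sqrt_le_left (by positivity), mul_pow, Real.sq_sqrt (by positivity)]
  calc ∑ i, ‖x i‖ ^ 2 ≤ ∑ _i : Fin d, L ^ 2 := by
        refine Finset.sum_le_sum fun i _ => ?_
        rw [Real.norm_eq_abs, sq_abs, sq_le_sq, abs_of_pos hL, abs_le]
        obtain ⟨h1, h2⟩ := hx i
        rw [lt_inv_mul_iff₀ hL] at h1
        rw [inv_mul_le_iff₀ hL] at h2
        constructor <;> linarith
    _ = _ := by simp

/-- A measurable section of the covering of the torus, with values in the cube of side `L`. -/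
theorem exists_torus_section (d : ℕ) {L : ℝ} (hL : 0 < L) :
    ∃ σ : UnitAddTorus (Fin d) → E d, Measurable σ ∧
      (∀ t i, ((L⁻¹ * σ t i : ℝ) : UnitAddCircle) = t i) ∧
      (volume : Measure (UnitAddTorus (Fin d))).map σ =
        ENNReal.ofReal ((L ^ d)⁻¹) • volume.restrict (cube d L) := by
  let b : Fin d → ℝ := fun _ => -1 / 2
  let B : Set (Fin d → ℝ) := {x | ∀ i, x i ∈ Set.Ioc (b i) (b i + 1)}
  have hB : MeasurableSet B := by
    have : B = Set.univ.pi fun i => Set.Ioc (b i) (b i + 1) := by ext; simp [B]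
    rw [this]
    exact MeasurableSet.univ_pi fun i => measurableSet_Ioc
  have h1 := UnitAddTorus.measurePreserving_equivPiIoc b
  have h2 : MeasurePreserving (Subtype.val : B → Fin d → ℝ) (Measure.comap Subtype.val volume)
      (volume.restrict B) := ⟨measurable_subtype_coe, map_comap_subtype_coe hB volume⟩
  have h12 := h2.comp h1
  have h3 := PiLp.volume_preserving_toLp (Fin d)
  let Q' : Set (E d) := (fun x : E d => L • x) ⁻¹' cube d L
  have hQ' : (WithLp.toLp 2) ⁻¹' Q' = B := by
    ext x
    simp [Q', cube, B, b, inv_mul_cancel_left₀ hL.ne']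
  have hmQ' : MeasurableSet Q' :=
    (Continuous.measurable (by fun_prop)) (measurableSet_cube d L)
  have h4 := h3.restrict_preimage hmQ'
  rw [hQ'] at h4
  have h5 := h4.comp h12
  refine ⟨fun t => L • WithLp.toLp 2 (fun i => (AddCircle.equivIoc 1 (b i) (t i)).1), ?_, ?_, ?_⟩
  · exact (measurable_const_smul L).comp h5.measurable
  · intro t i
    simp only [PiLp.smul_apply, smul_eq_mul, inv_mul_cancel_left₀ hL.ne']
    exact (AddCircle.equivIoc 1 (b i)).left_inv (t i)
  · have h6 : MeasurePreserving (fun x : E d => L • x) (volume.restrict Q')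
        (ENNReal.ofReal ((L ^ d)⁻¹) • volume.restrict (cube d L)) := by
      refine ⟨measurable_const_smul L, ?_⟩
      rw [← Measure.restrict_map (measurable_const_smul L) (measurableSet_cube d L),
        Measure.map_addHaar_smul volume hL.ne']
      simp [abs_of_pos hL, Measure.restrict_smul]
    exact (h6.comp h5).map_eq

variable {m : ℕ}

/-- Frequencies for the cube of side `L`, shifted by a half in the first direction; none of them
vanishes. -/
def freq (L : ℝ) (k : Fin (m + 1) → ℤ) : E (m + 1) :=
  WithLp.toLp 2 fun i => 2 * Real.pi / L * (k i + if i = 0 then 1 / 2 else 0)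

/-- The plane wave with frequency `freq L k`. -/
def wave (L : ℝ) (k : Fin (m + 1) → ℤ) (x : E (m + 1)) : ℂ :=
  Complex.exp (Complex.I * (inner ℝ (freq L k) x : ℝ))

theorem le_norm_freq {L : ℝ} (hL : 0 < L) (k : Fin (m + 1) → ℤ) :
    Real.pi / L ≤ ‖freq L k‖ := by
  have h1 : ‖freq L k 0‖ ≤ ‖freq L k‖ := PiLp.norm_apply_le _ _
  refine le_trans ?_ h1
  have h2 : (1 : ℝ) / 2 ≤ |(k 0 : ℝ) + 1 / 2| := by
    rcases le_or_gt 0 (k 0) with h | h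
    · have : (0 : ℝ) ≤ k 0 := by exact_mod_cast h
      rw [abs_of_nonneg (by linarith)]; linarith
    · have : (k 0 : ℝ) ≤ -1 := by exact_mod_cast (by omega : k 0 ≤ -1)
      rw [abs_of_nonpos (by linarith)]; linarith
  simp only [freq, if_true, Real.norm_eq_abs, abs_mul, abs_div, abs_of_pos hL, abs_of_pos
    Real.pi_pos, abs_two]
  calc Real.pi / L = 2 * Real.pi / L * (1 / 2) := by ring
    _ ≤ _ := mul_le_mul_of_nonneg_left h2 (by positivity)

theorem norm_wave (L : ℝ) (k : Fin (m + 1) → ℤ) (x : E (m + 1)) : ‖wave L k x‖ = 1 := by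
  rw [wave, mul_comm]; exact Complex.norm_exp_ofReal_mul_I _

theorem continuous_wave (L : ℝ) (k : Fin (m + 1) → ℤ) : Continuous (wave (m := m) L k) := by
  unfold wave; fun_prop

/-- The half shift makes the waves antiperiodic in the first variable, so they are not functions on
the torus. The wave with `k = 0` carries the whole shift and has modulus one, and factoring it out
leaves the Fourier characters. -/
theorem wave_eq {L : ℝ} (hL : 0 < L) (k : Fin (m + 1) → ℤ) {t : UnitAddTorus (Fin (m + 1))}
    {x : E (m + 1)} (hx : ∀ i, ((L⁻¹ * x i : ℝ) : UnitAddCircle) = t i) :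
    wave L k x = UnitAddTorus.mFourier k t * wave L 0 x := by
  have h1 : UnitAddTorus.mFourier k t =
      ∏ i, Complex.exp (2 * Real.pi * Complex.I * k i * (L⁻¹ * x i : ℝ) / (1 : ℝ)) := by
    rw [UnitAddTorus.mFourier]
    change ∏ i, fourier (k i) (t i) = _
    refine Finset.prod_congr rfl fun i _ => ?_
    rw [← hx i, fourier_coe_apply]
  rw [h1, ← Complex.exp_sum, wave, wave, ← Complex.exp_add]
  congr 1
  simp only [PiLp.inner_apply, freq]
  push_cast
  rw [Finset.mul_sum, Finset.mul_sum, ← Finset.sum_add_distrib]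
  refine Finset.sum_congr rfl fun i _ => ?_
  have : (L : ℂ) ≠ 0 := by exact_mod_cast hL.ne'
  split_ifs <;> simp <;> field_simp

theorem integral_comp_section {d : ℕ} {L : ℝ} (hL : 0 < L) {σ : UnitAddTorus (Fin d) → E d}
    (hσ : Measurable σ) (hmap : (volume : Measure (UnitAddTorus (Fin d))).map σ =
        ENNReal.ofReal ((L ^ d)⁻¹) • volume.restrict (cube d L))
    {G : Type*} [NormedAddCommGroup G] [NormedSpace ℝ G] {h : E d → G}
    (hh : AEStronglyMeasurable h (volume.restrict (cube d L))) :
    ∫ t, h (σ t) = (L ^ d)⁻¹ • ∫ x in cube d L, h x := by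
  rw [← integral_map hσ.aemeasurable (by rw [hmap]; exact hh.smul_measure _), hmap,
    integral_smul_measure, ENNReal.toReal_ofReal (by positivity)]

/-- Orthogonality of plane waves. -/
theorem integral_norm_sum_wave_sq {L : ℝ} (hL : 0 < L) (S : Finset (Fin (m + 1) → ℤ))
    (a : (Fin (m + 1) → ℤ) → ℂ) :
    ∫ x in cube (m + 1) L, ‖∑ k ∈ S, a k * wave L k x‖ ^ 2 =
      L ^ (m + 1) * ∑ k ∈ S, ‖a k‖ ^ 2 := by
  obtain ⟨σ, hσ, hσt, hmap⟩ := exists_torus_section (m + 1) hL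
  have hc : Continuous fun x : E (m + 1) => ‖∑ k ∈ S, a k * wave L k x‖ ^ 2 := by
    exact (continuous_finsetSum S fun k _ =>
      continuous_const.mul (continuous_wave L k)).norm.pow 2
  have h1 := integral_comp_section hL hσ hmap (h := fun x => ‖∑ k ∈ S, a k * wave L k x‖ ^ 2)
    hc.aestronglyMeasurable
  -- The unimodular factor `wave L 0` is common to all terms and drops out of the norm.
  have h2 : ∀ t, ‖∑ k ∈ S, a k * wave L k (σ t)‖ ^ 2 =
      ‖∑ k ∈ S, a k * UnitAddTorus.mFourier k t‖ ^ 2 := by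
    intro t
    rw [Finset.sum_congr rfl fun k _ => show a k * wave L k (σ t) =
      a k * UnitAddTorus.mFourier k t * wave L 0 (σ t) by rw [wave_eq hL k (hσt t), mul_assoc],
      ← Finset.sum_mul, norm_mul, norm_wave, mul_one]
  have h3 : ∫ t, ‖∑ k ∈ S, a k * UnitAddTorus.mFourier (d := Fin (m + 1)) k t‖ ^ 2 =
      ∑ k ∈ S, ‖a k‖ ^ 2 := by
    have hor := UnitAddTorus.orthonormal_mFourier (d := Fin (m + 1))
    let g := ∑ k ∈ S, a k • UnitAddTorus.mFourierLp (d := Fin (m + 1)) 2 k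
    have hg1 : ‖g‖ ^ 2 = ∑ k ∈ S, ‖a k‖ ^ 2 := by
      have h := hor.inner_sum a a S
      have h' : inner ℂ g g = ((‖g‖ ^ 2 : ℝ) : ℂ) := by
        rw [inner_self_eq_norm_sq_to_K]; norm_cast
      rw [h'] at h
      have h'' : ((‖g‖ ^ 2 : ℝ) : ℂ) = ((∑ k ∈ S, ‖a k‖ ^ 2 : ℝ) : ℂ) := by
        rw [h]; push_cast
        refine Finset.sum_congr rfl fun k _ => ?_
        rw [Complex.conj_mul']
      exact_mod_cast h''
    have hg2 : ‖g‖ ^ 2 = ∫ t, ‖g t‖ ^ 2 := by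
      have h := MeasureTheory.L2.inner_def (𝕜 := ℂ) g g
      have h' : inner ℂ g g = ((‖g‖ ^ 2 : ℝ) : ℂ) := by
        rw [inner_self_eq_norm_sq_to_K]; norm_cast
      have h'' : ∀ t, inner ℂ (g t) (g t) = ((‖g t‖ ^ 2 : ℝ) : ℂ) := by
        intro t
        rw [inner_self_eq_norm_sq_to_K]; norm_cast
      simp_rw [h', h''] at h
      rw [integral_complex_ofReal] at h
      exact_mod_cast h
    rw [← hg1, hg2]
    refine integral_congr_ae ?_
    have hae : ∀ᵐ t, ∀ k ∈ S, UnitAddTorus.mFourierLp (d := Fin (m + 1)) 2 k t =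
        UnitAddTorus.mFourier k t := by
      rw [Filter.eventually_all_finset]
      exact fun k _ => UnitAddTorus.coeFn_mFourierLp 2 k
    have hae2 : ∀ᵐ t, ∀ k ∈ S, (a k • UnitAddTorus.mFourierLp (d := Fin (m + 1)) 2 k :
        Lp ℂ 2 _) t = a k • UnitAddTorus.mFourierLp (d := Fin (m + 1)) 2 k t := by
      rw [Filter.eventually_all_finset]
      exact fun k _ => Lp.coeFn_smul _ _
    filter_upwards [hae, hae2, Lp.coeFn_finsetSum S
      (fun k => a k • UnitAddTorus.mFourierLp (d := Fin (m + 1)) 2 k)] with t h4 h5 h6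
    rw [h6, Finset.sum_apply]
    congr 2
    refine Finset.sum_congr rfl fun k hk => ?_
    rw [h5 k hk, h4 k hk, smul_eq_mul]
  simp_rw [h2] at h1
  rw [h3, smul_eq_mul] at h1
  rw [h1, mul_inv_cancel_left₀ (by positivity)]

/-- Parseval's identity for plane waves. -/
theorem hasSum_sq_integral_wave {L : ℝ} (hL : 0 < L) {w : E (m + 1) → ℝ}
    (hw : MemLp w 2 (volume.restrict (cube (m + 1) L))) :
    HasSum (fun k => ‖∫ x in cube (m + 1) L, (w x : ℂ) * (starRingEnd ℂ) (wave L k x)‖ ^ 2)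
      (L ^ (m + 1) * ∫ x in cube (m + 1) L, w x ^ 2) := by
  obtain ⟨σ, hσ, hσt, hmap⟩ := exists_torus_section (m + 1) hL
  have hcw := continuous_wave (m := m) L
  -- Absorbing the common factor into `w` turns the wave coefficients of `w` into ordinary Fourier
  -- coefficients of `f₀`, up to the volume of the cube.
  let f₀ : E (m + 1) → ℂ := fun x => (w x : ℂ) * (starRingEnd ℂ) (wave L 0 x)
  have hf₀ : MemLp f₀ 2 (volume.restrict (cube (m + 1) L)) := by
    refine hw.of_le ?_ (Filter.Eventually.of_forall fun x => by simp [f₀, norm_wave])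
    exact (Complex.continuous_ofReal.comp_aestronglyMeasurable hw.1).mul
      ((Complex.continuous_conj.comp (hcw 0)).aestronglyMeasurable)
  have hf : MemLp (f₀ ∘ σ) 2 (volume : Measure (UnitAddTorus (Fin (m + 1)))) := by
    have h1 : MemLp f₀ 2 ((volume : Measure (UnitAddTorus (Fin (m + 1)))).map σ) := by
      rw [hmap]; exact hf₀.smul_measure ENNReal.ofReal_ne_top
    exact h1.comp_of_map hσ.aemeasurable
  have h := UnitAddTorus.hasSum_sq_mFourierCoeff hf.toLp
  have hcoef : ∀ k, UnitAddTorus.mFourierCoeff (hf.toLp) k =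
      (L ^ (m + 1))⁻¹ • ∫ x in cube (m + 1) L, (w x : ℂ) * (starRingEnd ℂ) (wave L k x) := by
    intro k
    rw [← integral_comp_section hL hσ hmap
      (h := fun x => (w x : ℂ) * (starRingEnd ℂ) (wave L k x))
      ((Complex.continuous_ofReal.comp_aestronglyMeasurable hw.1).mul
      ((Complex.continuous_conj.comp (hcw k)).aestronglyMeasurable))]
    refine integral_congr_ae ?_
    filter_upwards [hf.coeFn_toLp] with t ht
    rw [ht, UnitAddTorus.mFourier_neg, wave_eq hL k (hσt t)]
    simp only [f₀, Function.comp, smul_eq_mul, map_mul]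
    ring
  have hint : ∫ t, ‖hf.toLp _ t‖ ^ 2 = (L ^ (m + 1))⁻¹ * ∫ x in cube (m + 1) L, w x ^ 2 := by
    have h1 := integral_comp_section hL hσ hmap (h := fun x => w x ^ 2) (hw.1.pow 2)
    rw [smul_eq_mul] at h1
    rw [← h1]
    refine integral_congr_ae ?_
    filter_upwards [hf.coeFn_toLp] with t ht
    rw [ht]
    simp [f₀, norm_wave]
  simp_rw [hcoef, norm_smul, mul_pow] at h
  rw [hint] at h
  have h2 := h.mul_left ((L ^ (m + 1)) ^ 2)
  have hL' : (L ^ (m + 1)) ≠ 0 := by positivity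
  have h3 : ∀ r : ℝ, (L ^ (m + 1)) ^ 2 * (‖(L ^ (m + 1))⁻¹‖ ^ 2 * r) = r := fun r => by
    rw [norm_inv, Real.norm_eq_abs, abs_of_pos (by positivity : 0 < L ^ (m + 1)), ← mul_assoc,
      ← mul_pow, mul_inv_cancel₀ hL', one_pow, one_mul]
  have h4 : ∀ r : ℝ, (L ^ (m + 1)) ^ 2 * ((L ^ (m + 1))⁻¹ * r) = L ^ (m + 1) * r := fun r => by
    rw [sq, ← mul_assoc, mul_assoc (L ^ (m + 1)) (L ^ (m + 1)), mul_inv_cancel₀ hL', mul_one]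
  simp_rw [h3, h4] at h2
  exact h2

/-- A real trigonometric polynomial. -/
def trig (L : ℝ) (S : Finset (Fin (m + 1) → ℤ)) (a : (Fin (m + 1) → ℤ) → ℂ) (x : E (m + 1)) : ℝ :=
  (∑ k ∈ S, a k * wave L k x).re

theorem contDiff_trig (L : ℝ) (S : Finset (Fin (m + 1) → ℤ)) (a : (Fin (m + 1) → ℤ) → ℂ) :
    ContDiff ℝ ∞ (trig L S a) := by
  unfold trig wave
  refine Complex.reCLM.contDiff.comp (ContDiff.sum fun k _ => contDiff_const.mul ?_)
  refine ContDiff.cexp (contDiff_const.mul ?_)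
  exact Complex.ofRealCLM.contDiff.comp (innerSL ℝ (freq L k)).contDiff

theorem fderiv_trig (L : ℝ) (S : Finset (Fin (m + 1) → ℤ)) (a : (Fin (m + 1) → ℤ) → ℂ)
    (x v : E (m + 1)) :
    fderiv ℝ (trig L S a) x v =
      trig L S (fun k => a k * (Complex.I * (inner ℝ (freq L k) v : ℝ))) x := by
  have hd : DifferentiableAt ℝ (trig L S a) x :=
    (contDiff_trig L S a).differentiable (by simp) x
  rw [← hd.lineDeriv_eq_fderiv]
  refine HasLineDerivAt.lineDeriv ?_
  have hw : ∀ k, HasDerivAt (fun s : ℝ => wave L k (x + s • v))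
      (Complex.I * (inner ℝ (freq L k) v : ℝ) * wave L k x) 0 := by
    intro k
    have h1 : HasDerivAt (fun s : ℝ => inner ℝ (freq L k) (x + s • v))
        (inner ℝ (freq L k) v) 0 := by
      simp only [inner_add_right, inner_smul_right]
      simpa using ((hasDerivAt_id (0 : ℝ)).mul_const (inner ℝ (freq L k) v)).const_add
        (inner ℝ (freq L k) x)
    have h2 := (h1.ofReal_comp.const_mul Complex.I).cexp
    simp only [zero_smul, add_zero] at h2
    simpa only [wave, mul_comm] using h2
  have hs : HasDerivAt (fun s : ℝ => ∑ k ∈ S, a k * wave L k (x + s • v))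
      (∑ k ∈ S, a k * (Complex.I * (inner ℝ (freq L k) v : ℝ) * wave L k x)) 0 :=
    HasDerivAt.fun_sum fun k _ => (hw k).const_mul (a k)
  have hr := (Complex.reCLM.hasFDerivAt.comp_hasDerivAt (0 : ℝ) hs)
  simp only [← mul_assoc] at hr
  simp only [← mul_assoc]
  exact hr

theorem integral_trig_sq_le {L : ℝ} (hL : 0 < L) (S : Finset (Fin (m + 1) → ℤ))
    (a : (Fin (m + 1) → ℤ) → ℂ) :
    ∫ x in cube (m + 1) L, trig L S a x ^ 2 ≤ L ^ (m + 1) * ∑ k ∈ S, ‖a k‖ ^ 2 := by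
  rw [← integral_norm_sum_wave_sq hL]
  have hcw := continuous_wave (m := m) L
  have hint : ∀ g : E (m + 1) → ℝ, Continuous g → IntegrableOn g (cube (m + 1) L) := fun g hg =>
    (hg.continuousOn.integrableOn_compact
      (isBounded_cube _ hL).isCompact_closure).mono_set subset_closure
  refine integral_mono (hint _ ?_) (hint _ ((continuous_finsetSum S fun k _ =>
    continuous_const.mul (hcw k)).norm.pow 2)) fun x => ?_
  · exact ((contDiff_trig L S a).continuous).pow 2
  · have := Complex.abs_re_le_norm (∑ k ∈ S, a k * wave L k x)
    simp only [trig]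
    rw [← sq_abs]
    exact pow_le_pow_left₀ (abs_nonneg _) this 2

theorem integral_mul_trig {L : ℝ} {w : E (m + 1) → ℝ}
    (hw : Integrable w (volume.restrict (cube (m + 1) L))) (S : Finset (Fin (m + 1) → ℤ))
    (a : (Fin (m + 1) → ℤ) → ℂ) :
    ∫ x in cube (m + 1) L, w x * trig L S a x =
      (∑ k ∈ S, a k * ∫ x in cube (m + 1) L, (w x : ℂ) * wave L k x).re := by
  have hi : ∀ k, Integrable (fun x => (w x : ℂ) * wave L k x)
      (volume.restrict (cube (m + 1) L)) := fun k =>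
    (hw.ofReal (𝕜 := ℂ)).mul_bdd (c := 1) (continuous_wave L k).aestronglyMeasurable
      (Filter.Eventually.of_forall fun x => (norm_wave L k x).le)
  have h1 : ∀ x, w x * trig L S a x = (∑ k ∈ S, a k * ((w x : ℂ) * wave L k x)).re := by
    intro x
    rw [trig, ← Complex.re_ofReal_mul, Finset.mul_sum]
    congr 1
    exact Finset.sum_congr rfl fun k _ => by ring
  simp_rw [h1]
  have h2 := integral_re (𝕜 := ℂ) (integrable_finsetSum S fun k _ => (hi k).const_mul (a k))
  simp only [RCLike.re_to_complex] at h2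
  rw [h2, integral_finsetSum _ fun k _ => (hi k).const_mul (a k)]
  simp_rw [integral_const_mul]

/-- The divergence is an isomorphism modulo its kernel: a function is controlled by its pairings
with divergences of smooth fields. -/
theorem exists_infsup (m : ℕ) {L : ℝ} (hL : 0 < L) :
    ∃ C : ℝ, 0 < C ∧ ∀ w : E (m + 1) → ℝ, MemLp w 2 (volume.restrict (cube (m + 1) L)) →
      ∀ B : ℝ, 0 ≤ B → (∀ θ : E (m + 1) → E (m + 1), ContDiff ℝ ∞ θ →
        ∫ x in cube (m + 1) L, w x * divg θ x ≤
          B * (√(∫ x in cube (m + 1) L, ‖θ x‖ ^ 2) + √(∫ x in cube (m + 1) L, jacSq θ x))) →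
      ∫ x in cube (m + 1) L, w x ^ 2 ≤ (C * B) ^ 2 := by
  set Q := cube (m + 1) L with hQ
  set d : ℝ := ((m + 1 : ℕ) : ℝ) with hd
  have hd0 : 0 < d := by rw [hd]; positivity
  set V : ℝ := L ^ (m + 1) with hV
  have hV0 : 0 < V := by positivity
  -- The first summand pays for the `L²` norm of the test field, through the lower bound `π / L` on
  -- the frequencies; the second pays for its Jacobian.
  set C : ℝ := d * (L / Real.pi) + d with hC
  have hC0 : 0 < C := by have := Real.pi_pos; positivity
  refine ⟨C, hC0, fun w hw B hB hdiv => ?_⟩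
  have hfin : IsFiniteMeasure (volume.restrict Q) :=
    ⟨by rw [Measure.restrict_apply_univ]; exact (isBounded_cube _ hL).measure_lt_top⟩
  have hwi : Integrable w (volume.restrict Q) := hw.integrable one_le_two
  set c : (Fin (m + 1) → ℤ) → ℂ :=
    fun k => ∫ x in Q, (w x : ℂ) * (starRingEnd ℂ) (wave L k x) with hc
  have hsum := hasSum_sq_integral_wave hL hw
  have hcc : ∀ k, ∫ x in Q, (w x : ℂ) * wave L k x = (starRingEnd ℂ) (c k) := by
    intro k
    rw [hc, ← integral_conj]
    simp
  have hbound : ∀ S : Finset (Fin (m + 1) → ℤ), ∑ k ∈ S, ‖c k‖ ^ 2 ≤ V * (C * B) ^ 2 := by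
    intro S
    set X := ∑ k ∈ S, ‖c k‖ ^ 2 with hX
    have hX0 : 0 ≤ X := Finset.sum_nonneg fun k _ => sq_nonneg _
    have hfr : ∀ k : Fin (m + 1) → ℤ, 0 < ‖freq L k‖ := fun k =>
      lt_of_lt_of_le (by have := Real.pi_pos; positivity) (le_norm_freq hL k)
    -- The coefficients `-i ξ_j / |ξ|² c_k` are those of the gradient of the inverse Laplacian. The
    -- divergence of `θ` is thus the trigonometric polynomial with coefficients `c`, whose pairing
    -- with `w` is `X`. Division by `|ξ|²` is possible because no frequency vanishes.
    let b : Fin (m + 1) → (Fin (m + 1) → ℤ) → ℂ := fun j k =>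
      c k * (-Complex.I * ((freq L k j / ‖freq L k‖ ^ 2 : ℝ) : ℂ))
    let θ : E (m + 1) → E (m + 1) := fun x => WithLp.toLp 2 fun j => trig L S (b j) x
    have hθ : ContDiff ℝ ∞ θ := by
      rw [contDiff_piLp]
      exact fun j => contDiff_trig L S (b j)
    have hθd : ∀ x v j, (fderiv ℝ θ x v) j = trig L S
        (fun k => b j k * (Complex.I * (inner ℝ (freq L k) v : ℝ))) x := by
      intro x v j
      rw [← fderiv_trig]
      have h1 := (EuclideanSpace.proj (𝕜 := ℝ) j : E (m + 1) →L[ℝ] ℝ).hasFDerivAt.comp x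
        ((hθ.differentiable (by simp)) x).hasFDerivAt
      have h2 := h1.fderiv
      change fderiv ℝ (trig L S (b j)) x = _ at h2
      rw [h2]; rfl
    have hin : ∀ (k : Fin (m + 1) → ℤ) (i : Fin (m + 1)), inner ℝ (freq L k) (stdVec i) = freq L k i := by
      intro k i
      rw [stdVec, EuclideanSpace.inner_single_right]; simp
    have hdivθ : ∀ x, divg θ x = trig L S c x := by
      intro x
      simp only [divg, hθd, hin, trig]
      rw [← Complex.re_sum, Finset.sum_comm]
      congr 1
      refine Finset.sum_congr rfl fun k _ => ?_
      rw [← Finset.sum_mul]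
      congr 1
      have h1 : ∀ j, b j k * (Complex.I * ((freq L k j : ℝ) : ℂ)) =
          c k * ((freq L k j ^ 2 / ‖freq L k‖ ^ 2 : ℝ) : ℂ) := by
        intro j
        simp only [b]
        push_cast
        linear_combination (-c k * (freq L k j : ℂ) ^ 2 / (‖freq L k‖ : ℂ) ^ 2) * Complex.I_sq
      simp_rw [h1]
      rw [← Finset.mul_sum, ← Complex.ofReal_sum, ← Finset.sum_div, ← EuclideanSpace.real_norm_sq_eq,
        div_self (pow_ne_zero 2 (hfr k).ne')]
      simp
    have hcj : ∀ (k : Fin (m + 1) → ℤ) j, |freq L k j| ≤ ‖freq L k‖ := fun k j => PiLp.norm_apply_le (freq L k) j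
    have hbn : ∀ j k, ‖b j k‖ = ‖c k‖ * (|freq L k j| / ‖freq L k‖ ^ 2) := by
      intro j k
      simp [b]
    have hb1 : ∀ j k, ‖b j k‖ ≤ ‖c k‖ * (L / Real.pi) := by
      intro j k
      rw [hbn]
      refine mul_le_mul_of_nonneg_left ?_ (norm_nonneg _)
      have h1 : (Real.pi / L)⁻¹ = L / Real.pi := inv_div _ _
      calc |freq L k j| / ‖freq L k‖ ^ 2 ≤ ‖freq L k‖ / ‖freq L k‖ ^ 2 :=
            div_le_div_of_nonneg_right (hcj k j) (sq_nonneg _)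
        _ = ‖freq L k‖⁻¹ := by have := (hfr k).ne'; field_simp
        _ ≤ (Real.pi / L)⁻¹ := inv_anti₀ (by have := Real.pi_pos; positivity) (le_norm_freq hL k)
        _ = _ := h1
    have hb2 : ∀ i j k, ‖b j k * (Complex.I * ((freq L k i : ℝ) : ℂ))‖ ≤ ‖c k‖ := by
      intro i j k
      rw [norm_mul, hbn, norm_mul, Complex.norm_I, one_mul, Complex.norm_real, Real.norm_eq_abs,
        mul_assoc]
      refine mul_le_of_le_one_right (norm_nonneg _) ?_
      rw [div_mul_eq_mul_div, div_le_one (pow_pos (hfr k) 2), sq]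
      exact mul_le_mul (hcj k j) (hcj k i) (abs_nonneg _) (norm_nonneg _)
    have hint : ∀ a, IntegrableOn (fun x => trig L S a x ^ 2) Q := fun a =>
      ((((contDiff_trig L S a).continuous).pow 2).continuousOn.integrableOn_compact
      (isBounded_cube _ hL).isCompact_closure).mono_set subset_closure
    have hn1 : ∫ x in Q, ‖θ x‖ ^ 2 ≤ (d * (L / Real.pi)) ^ 2 * (V * X) := by
      have h1 : ∀ x, ‖θ x‖ ^ 2 = ∑ j, trig L S (b j) x ^ 2 := fun x => by
        rw [EuclideanSpace.real_norm_sq_eq]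
      simp_rw [h1]
      rw [integral_finsetSum _ fun j _ => hint (b j)]
      calc ∑ j, ∫ x in Q, trig L S (b j) x ^ 2
          ≤ ∑ _j : Fin (m + 1), (L / Real.pi) ^ 2 * (V * X) := by
            refine Finset.sum_le_sum fun j _ => (integral_trig_sq_le hL S (b j)).trans ?_
            rw [mul_left_comm, hX]
            refine mul_le_mul_of_nonneg_left ?_ hV0.le
            rw [Finset.mul_sum]
            refine Finset.sum_le_sum fun k _ => ?_
            rw [mul_comm, ← mul_pow]
            exact pow_le_pow_left₀ (norm_nonneg _) (hb1 j k) 2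
        _ = d * ((L / Real.pi) ^ 2 * (V * X)) := by simp [hd]
        _ ≤ d ^ 2 * ((L / Real.pi) ^ 2 * (V * X)) := by
            refine mul_le_mul_of_nonneg_right ?_ (by positivity)
            have : (1 : ℝ) ≤ d := by rw [hd]; push_cast; linarith [Nat.cast_nonneg (α := ℝ) m]
            nlinarith
        _ = _ := by ring
    have hn2 : ∫ x in Q, jacSq θ x ≤ d ^ 2 * (V * X) := by
      have h1 : ∀ x, jacSq θ x = ∑ i, ∑ j, trig L S
          (fun k => b j k * (Complex.I * ((freq L k i : ℝ) : ℂ))) x ^ 2 := fun x => by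
        simp only [jacSq]
        refine Finset.sum_congr rfl fun i _ => ?_
        rw [EuclideanSpace.real_norm_sq_eq]
        refine Finset.sum_congr rfl fun j _ => ?_
        rw [hθd]; simp_rw [hin]
      simp_rw [h1]
      rw [integral_finsetSum _ fun i _ => integrable_finsetSum _ fun j _ => hint _]
      calc ∑ i, ∫ x in Q, ∑ j, trig L S
              (fun k => b j k * (Complex.I * ((freq L k i : ℝ) : ℂ))) x ^ 2
          ≤ ∑ _i : Fin (m + 1), ∑ _j : Fin (m + 1), V * X := by
            refine Finset.sum_le_sum fun i _ => ?_
            rw [integral_finsetSum _ fun j _ => hint _]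
            refine Finset.sum_le_sum fun j _ => (integral_trig_sq_le hL S _).trans ?_
            refine mul_le_mul_of_nonneg_left (Finset.sum_le_sum fun k _ => ?_) hV0.le
            exact pow_le_pow_left₀ (norm_nonneg _) (hb2 i j k) 2
        _ = _ := by simp [hd]; ring
    have hpair : ∫ x in Q, w x * divg θ x = X := by
      simp_rw [hdivθ]
      rw [integral_mul_trig hwi, hX, Complex.re_sum]
      refine Finset.sum_congr rfl fun k _ => ?_
      rw [show ∫ x in cube (m + 1) L, (w x : ℂ) * wave L k x = _ from hcc k, Complex.mul_conj,
        Complex.ofReal_re, Complex.normSq_eq_norm_sq]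
    have hmain := hdiv θ hθ
    rw [hpair] at hmain
    have hs1 : √(∫ x in Q, ‖θ x‖ ^ 2) ≤ d * (L / Real.pi) * √(V * X) := by
      have h0 : 0 ≤ d * (L / Real.pi) := by have := Real.pi_pos; positivity
      refine (Real.sqrt_le_sqrt hn1).trans_eq ?_
      rw [Real.sqrt_mul (sq_nonneg _), Real.sqrt_sq h0]
    have hs2 : √(∫ x in Q, jacSq θ x) ≤ d * √(V * X) := by
      refine (Real.sqrt_le_sqrt hn2).trans_eq ?_
      rw [Real.sqrt_mul (sq_nonneg _), Real.sqrt_sq hd0.le]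
    have h2 : X ≤ B * C * √(V * X) := by
      calc X ≤ _ := hmain
        _ ≤ B * (d * (L / Real.pi) * √(V * X) + d * √(V * X)) :=
            mul_le_mul_of_nonneg_left (add_le_add hs1 hs2) hB
        _ = _ := by rw [hC]; ring
    -- The test field has norm of order `√X` while the pairing equals `X`; squaring allows one
    -- factor `X` to be cancelled.
    have h3 : X * X ≤ (V * (C * B) ^ 2) * X := by
      calc X * X ≤ (B * C * √(V * X)) * (B * C * √(V * X)) := mul_self_le_mul_self hX0 h2
        _ = (B * C) ^ 2 * (√(V * X) * √(V * X)) := by ring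
        _ = (B * C) ^ 2 * (V * X) := by rw [Real.mul_self_sqrt (by positivity)]
        _ = _ := by ring
    rcases hX0.eq_or_lt with h4 | h4
    · rw [← h4]; positivity
    · exact le_of_mul_le_mul_right h3 h4
  have := hasSum_le_of_sum_le hsum hbound
  exact le_of_mul_le_mul_left this hV0

end Fourier

end HDG

/-! ### Single-valued and conservative functions on the skeleton -/

namespace HDG

section NormalComponent

variable {d : ℕ} {F : Set (E d)}

theorem coeFn_dotN (n : E d) (r : L2Fv F) :
    dotN n r =ᵐ[(surf d).restrict F] fun x => inner ℝ n (r x) :=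
  ContinuousLinearMap.coeFn_compLpL _ r

theorem coeFn_smulN (n : E d) (μ : L2F F) :
    smulN n μ =ᵐ[(surf d).restrict F] fun x => μ x • n :=
  ContinuousLinearMap.coeFn_compLpL _ μ

theorem dotN_smulN {n : E d} (hn : ‖n‖ = 1) (μ : L2F F) : dotN n (smulN n μ) = μ := by
  refine Lp.ext ?_
  filter_upwards [coeFn_dotN n (smulN n μ), coeFn_smulN n μ] with x h1 h2
  rw [h1, h2, inner_smul_right, real_inner_self_eq_norm_sq, hn]; simp

theorem dotN_neg (n : E d) (r : L2Fv F) : dotN (-n) r = -dotN n r := by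
  refine Lp.ext ?_
  filter_upwards [coeFn_dotN n r, coeFn_dotN (-n) r, Lp.coeFn_neg (dotN n r)] with x h1 h2 h3
  rw [h2, h3, Pi.neg_apply, h1, inner_neg_left]

end NormalComponent

variable {m : ℕ} {Ω : Set (E (m + 1))}

/-! ### The boundary form and its cancellations. -/

namespace Mesh

section BoundaryForm

variable {T : Mesh Ω}

theorem bdryInner_comm (a b : T.Bdry) : T.bdryInner a b = T.bdryInner b a := by
  unfold bdryInner
  exact Finset.sum_congr rfl fun K _ => Finset.sum_congr rfl fun F _ => real_inner_comm _ _

theorem bdryInner_add_left (a a' b : T.Bdry) :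
    T.bdryInner (a + a') b = T.bdryInner a b + T.bdryInner a' b := by
  simp [bdryInner, inner_add_left, Finset.sum_add_distrib]

theorem bdryInner_smul_left (c : ℝ) (a b : T.Bdry) :
    T.bdryInner (c • a) b = c * T.bdryInner a b := by
  simp [bdryInner, inner_smul_left, Finset.mul_sum]

theorem bdryInner_add_right (a b b' : T.Bdry) :
    T.bdryInner a (b + b') = T.bdryInner a b + T.bdryInner a b' := by
  rw [bdryInner_comm, bdryInner_add_left, bdryInner_comm b, bdryInner_comm b']

theorem bdryInner_smul_right (c : ℝ) (a b : T.Bdry) :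
    T.bdryInner a (c • b) = c * T.bdryInner a b := by
  rw [bdryInner_comm, bdryInner_smul_left, bdryInner_comm]

theorem bdryInner_sub_left (a a' b : T.Bdry) :
    T.bdryInner (a - a') b = T.bdryInner a b - T.bdryInner a' b := by
  simp [bdryInner, inner_sub_left, Finset.sum_sub_distrib]

theorem bdryInner_sub_right (a b b' : T.Bdry) :
    T.bdryInner a (b - b') = T.bdryInner a b - T.bdryInner a b' := by
  simp [bdryInner, inner_sub_right, Finset.sum_sub_distrib]

theorem bdryInner_zero_right (a : T.Bdry) : T.bdryInner a 0 = 0 := by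
  simp [bdryInner]

theorem bdryInner_zero_left (a : T.Bdry) : T.bdryInner 0 a = 0 := by
  simp [bdryInner]

end BoundaryForm

variable (T : Mesh Ω)

/-- A sum over the element boundaries only sees a face `F` shared by two elements if the summand
vanishes on the other faces. -/
theorem sum_facets_eq_add (hm : 1 ≤ m) (g : ∀ K : T.Elem, T.Facet K → ℝ) {K K' : T.Elem}
    (hne : K ≠ K') {F : Set (E (m + 1))} (h : IsFacet K.1 F) (h' : IsFacet K'.1 F)
    (hg : ∀ (L : T.Elem) (G : T.Facet L), G.1 ≠ F → g L G = 0) :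
    ∑ K, ∑ F, g K F = g K ⟨F, h⟩ + g K' ⟨F, h'⟩ := by
  rw [← Fintype.sum_sigma (fun p : Σ K : T.Elem, T.Facet K => g p.1 p.2)]
  refine Fintype.sum_eq_add (⟨K, ⟨F, h⟩⟩ : Σ K : T.Elem, T.Facet K) ⟨K', ⟨F, h'⟩⟩
    (fun h => hne (congrArg Sigma.fst h)) ?_
  rintro ⟨L, ⟨G, hG⟩⟩ ⟨h1, h2⟩
  refine hg L _ fun hGF => ?_
  simp only at hGF
  subst hGF
  by_cases hLK : K = L
  · subst hLK; exact h1 rfl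
  · have := T.eq_of_isFacet hm hne hLK h h' hG
    subst this
    exact h2 rfl

/-- A sum over the element boundaries only sees a boundary face `F` if the summand vanishes on
the other faces. -/
theorem sum_facets_eq_single (hm : 1 ≤ m) (hΩ : IsConvexPolyhedralDomain Ω)
    (g : ∀ K : T.Elem, T.Facet K → ℝ) {K : T.Elem} {F : Set (E (m + 1))} (h : IsFacet K.1 F)
    (hF : F ⊆ frontier Ω)
    (hg : ∀ (L : T.Elem) (G : T.Facet L), G.1 ≠ F → g L G = 0) :
    ∑ K, ∑ F, g K F = g K ⟨F, h⟩ := by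
  rw [← Fintype.sum_sigma (fun p : Σ K : T.Elem, T.Facet K => g p.1 p.2)]
  refine Fintype.sum_eq_single (⟨K, ⟨F, h⟩⟩ : Σ K : T.Elem, T.Facet K) ?_
  rintro ⟨L, ⟨G, hG⟩⟩ h1
  refine hg L _ fun hGF => ?_
  simp only at hGF
  subst hGF
  by_cases hLK : K = L
  · subst hLK; exact h1 rfl
  · exact T.not_subset_frontier hm hΩ hLK h hG hF

open Classical in
/-- A sum over the element boundaries vanishes if the contributions of the two sides of every
interior face cancel and those of the boundary faces vanish. -/
theorem sum_facets_eq_zero (hm : 1 ≤ m) (hΩ : IsConvexPolyhedralDomain Ω)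
    (g : ∀ K : T.Elem, T.Facet K → ℝ)
    (h2 : ∀ (K K' : T.Elem), K ≠ K' → ∀ (F : Set (E (m + 1))) (h : IsFacet K.1 F)
      (h' : IsFacet K'.1 F), g K ⟨F, h⟩ + g K' ⟨F, h'⟩ = 0)
    (h1 : ∀ (K : T.Elem) (F : T.Facet K), F.1 ⊆ frontier Ω → g K F = 0) :
    ∑ K, ∑ F, g K F = 0 := by
  rw [← Fintype.sum_sigma (fun p : Σ K : T.Elem, T.Facet K => g p.1 p.2)]
  -- The involution exchanges the two sides of an interior face and fixes the boundary faces.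
  let nb : (Σ K : T.Elem, T.Facet K) → Σ K : T.Elem, T.Facet K := fun p =>
    if h : ∃ K' : T.Elem, p.1 ≠ K' ∧ IsFacet K'.1 p.2.1 then
      ⟨h.choose, ⟨p.2.1, h.choose_spec.2⟩⟩ else p
  have hnb : ∀ (K K' : T.Elem), K ≠ K' → ∀ (F : Set (E (m + 1))) (h : IsFacet K.1 F)
      (h' : IsFacet K'.1 F), nb ⟨K, ⟨F, h⟩⟩ = ⟨K', ⟨F, h'⟩⟩ := by
    intro K K' hne F h h'
    have hex : ∃ K' : T.Elem, K ≠ K' ∧ IsFacet K'.1 F := ⟨K', hne, h'⟩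
    have : hex.choose = K' :=
      T.eq_of_isFacet hm hex.choose_spec.1 hne h hex.choose_spec.2 h'
    simp only [nb]
    rw [dif_pos hex]
    -- The chosen element also occurs in the type of the facet proof, which has to be generalized
    -- before the element can be rewritten.
    generalize_proofs p1 p2
    revert p2
    rw [this]
    exact fun _ => rfl
  have hcase : ∀ p : Σ K : T.Elem, T.Facet K,
      (∃ (K K' : T.Elem) (_ : K ≠ K') (F : Set (E (m + 1))) (h : IsFacet K.1 F)
        (h' : IsFacet K'.1 F), p = ⟨K, ⟨F, h⟩⟩ ∧ nb p = ⟨K', ⟨F, h'⟩⟩) ∨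
      (p.2.1 ⊆ frontier Ω ∧ nb p = p) := by
    rintro ⟨K, ⟨F, h⟩⟩
    by_cases hF : F ⊆ frontier Ω
    · right
      refine ⟨hF, ?_⟩
      simp only [nb]
      rw [dif_neg]
      rintro ⟨K', hne, h'⟩
      exact T.not_subset_frontier hm hΩ hne h h' hF
    · left
      obtain ⟨K', hne, h'⟩ := T.exists_neighbor hm hΩ h hF
      exact ⟨K, K', hne, F, h, h', rfl, hnb K K' hne F h h'⟩
  refine Finset.sum_involution (fun p _ => nb p) ?_ ?_ (fun p _ => Finset.mem_univ _) ?_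
  · intro p _
    rcases hcase p with ⟨K, K', hne, F, h, h', rfl, h3⟩ | ⟨h3, h4⟩
    · rw [h3]; exact h2 K K' hne F h h'
    · rw [h4, h1 _ _ h3, add_zero]
  · intro p _ hp
    rcases hcase p with ⟨K, K', hne, F, h, h', rfl, h3⟩ | ⟨h3, h4⟩
    · rw [h3]; exact fun h4 => hne (congrArg Sigma.fst h4).symm
    · exact absurd (h1 _ _ h3) hp
  · intro p _
    rcases hcase p with ⟨K, K', hne, F, h, h', rfl, h3⟩ | ⟨h3, h4⟩
    · rw [h3]; exact hnb K' K hne.symm F h' h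
    · rw [h4, h4]

variable {T}

/-- `a` is single valued on `F`, and vanishes there if `F` is on the boundary. -/
def SingleValuedAt (a : T.Bdry) (F : Set (E (m + 1))) : Prop :=
  (∀ (K K' : T.Elem) (h : IsFacet K.1 F) (h' : IsFacet K'.1 F), a K ⟨F, h⟩ = a K' ⟨F, h'⟩) ∧
  (F ⊆ frontier Ω → ∀ (K : T.Elem) (h : IsFacet K.1 F), a K ⟨F, h⟩ = 0)

/-- The normal component `b` is conservative on `F`: the values from both sides cancel. -/
def ConservativeAt (b : T.Bdry) (F : Set (E (m + 1))) : Prop :=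
  ∀ (K K' : T.Elem), K ≠ K' → ∀ (h : IsFacet K.1 F) (h' : IsFacet K'.1 F),
    b K ⟨F, h⟩ + b K' ⟨F, h'⟩ = 0

theorem SingleValuedAt.congr {a a' : T.Bdry} {F : Set (E (m + 1))} (ha : SingleValuedAt a F)
    (h : ∀ K (h : IsFacet K.1 F), a' K ⟨F, h⟩ = a K ⟨F, h⟩) : SingleValuedAt a' F :=
  ⟨fun K K' h1 h2 => by rw [h, h, ha.1], fun hF K h1 => by rw [h, ha.2 hF]⟩

theorem ConservativeAt.congr {b b' : T.Bdry} {F : Set (E (m + 1))} (hb : ConservativeAt b F)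
    (h : ∀ K (h : IsFacet K.1 F), b' K ⟨F, h⟩ = b K ⟨F, h⟩) : ConservativeAt b' F :=
  fun K K' hne h1 h2 => by rw [h, h, hb K K' hne]

theorem SingleValuedAt.sub {a a' : T.Bdry} {F : Set (E (m + 1))} (ha : SingleValuedAt a F)
    (ha' : SingleValuedAt a' F) : SingleValuedAt (a - a') F := by
  refine ⟨fun K K' h1 h2 => ?_, fun hF K h1 => ?_⟩
  · simp only [Pi.sub_apply]; rw [ha.1 K K' h1 h2, ha'.1 K K' h1 h2]
  · simp only [Pi.sub_apply]; rw [ha.2 hF, ha'.2 hF, sub_zero]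

theorem ConservativeAt.sub {b b' : T.Bdry} {F : Set (E (m + 1))} (hb : ConservativeAt b F)
    (hb' : ConservativeAt b' F) : ConservativeAt (b - b') F := by
  intro K K' hne h1 h2
  simp only [Pi.sub_apply]
  rw [sub_add_sub_comm, hb K K' hne, hb' K K' hne, sub_zero]

/-- On an interior face the common value of `a` is paired with two opposite values of `b`. On a
boundary face `a` is zero, and `b` may be arbitrary. -/
theorem bdryInner_eq_zero (hm : 1 ≤ m) (hΩ : IsConvexPolyhedralDomain Ω) {a b : T.Bdry}
    (ha : ∀ F, SingleValuedAt a F) (hb : ∀ F, ConservativeAt b F) : T.bdryInner a b = 0 := by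
  refine T.sum_facets_eq_zero hm hΩ _ ?_ ?_
  · intro K K' hne F h h'
    rw [(ha F).1 K K' h h', ← inner_add_right, hb F K K' hne h h', inner_zero_right]
  · intro K F hF
    rw [(ha F.1).2 hF K F.2, inner_zero_left]

end Mesh

/-! ### Passing between weak and strong continuity across faces. -/

namespace FESpaces

variable {T : Mesh Ω} (S : FESpaces T)

open Classical in
theorem exists_single_M (F : T.Face) {x : L2F F.1} (hx : x ∈ S.M F.1) :
    ∃ μ : ∀ F : T.Face, S.M F.1, (μ F).1 = x ∧ ∀ G, G ≠ F → μ G = 0 :=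
  ⟨Pi.single F ⟨x, hx⟩, by rw [Pi.single_eq_same], fun G hG => Pi.single_eq_of_ne hG _⟩

open Classical in
theorem exists_single_N (F : T.Face) {x : L2Fv F.1} (hx : x ∈ S.N F.1) :
    ∃ r : S.Nh, (r F).1 = x ∧ ∀ G, G ≠ F → r G = 0 :=
  ⟨Pi.single F ⟨x, hx⟩, by rw [Pi.single_eq_same], fun G hG => Pi.single_eq_of_ne hG _⟩

variable {S}

theorem singleValuedAt_ofM {μ : ∀ F : T.Face, S.M F.1} (hμ : μ ∈ S.Mh) (F : Set (E (m + 1))) :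
    Mesh.SingleValuedAt (S.ofM μ) F := by
  refine ⟨fun K K' h h' => rfl, fun hF K h => ?_⟩
  have := hμ (T.toFace ⟨F, h⟩) hF
  simp only [ofM]
  rw [this]; rfl

theorem conservativeAt_ofN (hm : 1 ≤ m) (r : S.Nh) (F : Set (E (m + 1))) :
    Mesh.ConservativeAt (S.ofN r) F := by
  intro K K' hne h h'
  simp only [ofN]
  rw [T.normal_eq_neg hm hne h h', dotN_neg]
  exact add_neg_cancel _

/-- Testing with the members of `N_h` supported on one face. -/
theorem singleValuedAt_of_test (hm : 1 ≤ m) (hΩ : IsConvexPolyhedralDomain Ω) {a : T.Bdry}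
    {F : Set (E (m + 1))} (haM : ∀ K (h : IsFacet K.1 F), a K ⟨F, h⟩ ∈ S.M F)
    (ht : ∀ r : S.Nh, (∀ G : T.Face, G.1 ≠ F → r G = 0) → T.bdryInner a (S.ofN r) = 0) :
    Mesh.SingleValuedAt a F := by
  have hz : ∀ r : S.Nh, (∀ G : T.Face, G.1 ≠ F → r G = 0) →
      ∀ (L : T.Elem) (G : T.Facet L), G.1 ≠ F → inner ℝ (a L G) (S.ofN r L G) = 0 := by
    intro r hr L G hG
    simp only [ofN]
    rw [hr (T.toFace G) hG]; simp
  refine ⟨fun K K' h h' => ?_, fun hF K h => ?_⟩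
  · by_cases hne : K = K'
    · subst hne; rfl
    -- The jump itself is the test function: by `A1` the field `x n` is in `N(F)`, its normal
    -- components from the two sides are `x` and `-x`, and the tested form is `‖x‖²`.
    set x := a K ⟨F, h⟩ - a K' ⟨F, h'⟩ with hx
    have hxM : x ∈ S.M F := (S.M F).sub_mem (haM K h) (haM K' h')
    obtain ⟨r, hr, hr'⟩ := S.exists_single_N (T.toFace ⟨F, h⟩) (S.A1 K ⟨F, h⟩ x hxM)
    have hr'' : ∀ G : T.Face, G.1 ≠ F → r G = 0 := fun G hG =>
      hr' G (fun h => hG (congrArg Subtype.val h))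
    have h1 := ht r hr''
    rw [Mesh.bdryInner, T.sum_facets_eq_add hm _ hne h h' (hz r hr'')] at h1
    have e1 : S.ofN r K ⟨F, h⟩ = x := by
      simp only [ofN]; rw [hr, dotN_smulN (T.norm_normal _)]
    have e2 : S.ofN r K' ⟨F, h'⟩ = -x := by
      have := conservativeAt_ofN hm r F K K' hne h h'
      rw [e1] at this
      exact eq_neg_of_add_eq_zero_right this
    rw [e1, e2, inner_neg_right, ← sub_eq_add_neg, ← inner_sub_left, ← hx,
      inner_self_eq_zero] at h1
    exact sub_eq_zero.1 h1
  · obtain ⟨r, hr, hr'⟩ := S.exists_single_N (T.toFace ⟨F, h⟩) (S.A1 K ⟨F, h⟩ _ (haM K h))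
    have hr'' : ∀ G : T.Face, G.1 ≠ F → r G = 0 := fun G hG =>
      hr' G (fun h => hG (congrArg Subtype.val h))
    have h1 := ht r hr''
    rw [Mesh.bdryInner, T.sum_facets_eq_single hm hΩ _ h hF (hz r hr'')] at h1
    have e1 : S.ofN r K ⟨F, h⟩ = a K ⟨F, h⟩ := by
      simp only [ofN]; rw [hr, dotN_smulN (T.norm_normal _)]
    rwa [e1, inner_self_eq_zero] at h1

/-- Testing with the members of `M_h` supported on one face. -/
theorem conservativeAt_of_test (hm : 1 ≤ m) (hΩ : IsConvexPolyhedralDomain Ω) {b : T.Bdry}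
    {F : Set (E (m + 1))} (hbM : ∀ K (h : IsFacet K.1 F), b K ⟨F, h⟩ ∈ S.M F)
    (ht : ∀ μ ∈ S.Mh, (∀ G : T.Face, G.1 ≠ F → μ G = 0) → T.bdryInner b (S.ofM μ) = 0) :
    Mesh.ConservativeAt b F := by
  intro K K' hne h h'
  -- The sum of the two fluxes, extended by zero, belongs to `M_h` because a shared face is not on
  -- the boundary. Testing with it gives `‖x‖²`.
  set x := b K ⟨F, h⟩ + b K' ⟨F, h'⟩ with hx
  have hxM : x ∈ S.M F := (S.M F).add_mem (hbM K h) (hbM K' h')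
  obtain ⟨μ, hμ, hμ'⟩ := S.exists_single_M (T.toFace ⟨F, h⟩) hxM
  have hμ'' : ∀ G : T.Face, G.1 ≠ F → μ G = 0 := fun G hG =>
    hμ' G (fun h => hG (congrArg Subtype.val h))
  have h1 := ht μ (fun G hG => hμ'' G (fun h2 =>
    T.not_subset_frontier hm hΩ hne h h' (h2 ▸ hG))) hμ''
  rw [Mesh.bdryInner, T.sum_facets_eq_add hm _ hne h h' (fun L G hG => by
    simp only [ofM]; rw [hμ'' (T.toFace G) hG]; simp)] at h1
  have e1 : S.ofM μ K ⟨F, h⟩ = x := hμ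
  have e2 : S.ofM μ K' ⟨F, h'⟩ = x := hμ
  rwa [e1, e2, ← inner_add_left, ← hx, inner_self_eq_zero] at h1

theorem exists_elem (F : T.Face) : ∃ K : T.Elem, IsFacet K.1 F.1 := by
  obtain ⟨K, hK, h⟩ := (T.mem_faces F.1).1 F.2
  exact ⟨⟨K, hK⟩, h⟩

theorem exists_ofM_eq {a : T.Bdry} (haM : ∀ K (F : T.Facet K), a K F ∈ S.M F.1)
    (ha : ∀ F, Mesh.SingleValuedAt a F) : ∃ μ ∈ S.Mh, S.ofM μ = a := by
  choose k hk using fun F : T.Face => exists_elem F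
  refine ⟨fun F => ⟨a (k F) ⟨F.1, hk F⟩, haM (k F) ⟨F.1, hk F⟩⟩, fun F hF => ?_, ?_⟩
  · exact Subtype.ext ((ha F.1).2 hF _ _)
  · funext K F
    exact (ha F.1).1 _ _ _ _

/-- The field is built as `b n` from one chosen side of each face. On the other side its normal
component has the opposite sign, and so has `b` by conservativity. -/
theorem exists_ofN_eq (hm : 1 ≤ m) {b : T.Bdry} (hbM : ∀ K (F : T.Facet K), b K F ∈ S.M F.1)
    (hb : ∀ F, Mesh.ConservativeAt b F) : ∃ r : S.Nh, S.ofN r = b := by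
  choose k hk using fun F : T.Face => exists_elem F
  let r : S.Nh := fun F => ⟨smulN (T.normal (⟨F.1, hk F⟩ : T.Facet (k F))) (b (k F) ⟨F.1, hk F⟩),
    S.A1 (k F) ⟨F.1, hk F⟩ _ (hbM (k F) ⟨F.1, hk F⟩)⟩
  have hr : ∀ F : T.Face, S.ofN r (k F) ⟨F.1, hk F⟩ = b (k F) ⟨F.1, hk F⟩ := fun F =>
    dotN_smulN (T.norm_normal _) _
  refine ⟨r, ?_⟩
  funext K F
  by_cases hne : k (T.toFace F) = K
  · have h1 := hr (T.toFace F)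
    have : ∀ (L : T.Elem) (hL : IsFacet L.1 F.1), L = K →
        S.ofN r L ⟨F.1, hL⟩ = b L ⟨F.1, hL⟩ → S.ofN r K F = b K F := by
      rintro L hL rfl h; exact h
    exact this _ _ hne h1
  · have h1 := conservativeAt_ofN hm r F.1 _ _ hne (hk (T.toFace F)) F.2
    have h2 := hb F.1 _ _ hne (hk (T.toFace F)) F.2
    rw [hr (T.toFace F), ← h2] at h1
    exact add_left_cancel h1

theorem eq_of_ofM_eq {μ μ' : ∀ F : T.Face, S.M F.1} {F : T.Face}
    (h : ∀ K (hF : IsFacet K.1 F.1), S.ofM μ K ⟨F.1, hF⟩ = S.ofM μ' K ⟨F.1, hF⟩) : μ F = μ' F := by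
  obtain ⟨K, hK⟩ := exists_elem F
  exact Subtype.ext (h K hK)

theorem eq_of_ofN_eq {r r' : S.Nh} {F : T.Face}
    (h : ∀ K (hF : IsFacet K.1 F.1), S.ofN r K ⟨F.1, hF⟩ = S.ofN r' K ⟨F.1, hF⟩) : r F = r' F := by
  obtain ⟨K, hK⟩ := exists_elem F
  refine Subtype.ext ?_
  have h1 := S.normalN K ⟨F.1, hK⟩ (r F).1 (r F).2
  have h2 := S.normalN K ⟨F.1, hK⟩ (r' F).1 (r' F).2
  have h3 : dotN _ (r F).1 = dotN _ (r' F).1 := h K hK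
  rw [← h1, ← h2, h3]

end FESpaces
end HDG

/-! ### Integration over the mesh -/

namespace HDG

variable {m : ℕ} {Ω : Set (E (m + 1))}

namespace Mesh

variable (T : Mesh Ω)

theorem restrict_eq_sum (hΩ : IsConvexPolyhedralDomain Ω) :
    volume.restrict Ω = ∑ K : T.Elem, volume.restrict K.1 := by
  have hint : ∀ K : T.Elem, volume.restrict (interior K.1) = volume.restrict K.1 := fun K =>
    Measure.restrict_congr_set (interior_ae_eq_of_null_frontier
      ((T.elem_polytope K).convex.addHaar_frontier volume))
  have h1 : (⋃ K : T.Elem, K.1 : Set (E (m + 1))) = closure Ω := by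
    rw [← T.cover, Set.iUnion_subtype]
  have h2 : volume.restrict Ω = volume.restrict (closure Ω) :=
    (Measure.restrict_congr_set (closure_ae_eq_of_null_frontier
      (hΩ.convex.addHaar_frontier volume))).symm
  rw [h2, ← h1, Measure.restrict_iUnion_ae, Measure.sum_fintype]
  · intro K K' hne
    have h3 : AEDisjoint volume (interior K.1) (interior K'.1) := (T.elem_disjoint hne).aedisjoint
    exact h3.congr
      (interior_ae_eq_of_null_frontier ((T.elem_polytope K).convex.addHaar_frontier volume)).symm
      (interior_ae_eq_of_null_frontier ((T.elem_polytope K').convex.addHaar_frontier volume)).symm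
  · exact fun K => (T.elem_polytope K).isClosed.measurableSet.nullMeasurableSet

theorem restrict_elem_le (hΩ : IsConvexPolyhedralDomain Ω) (K : T.Elem) :
    volume.restrict K.1 ≤ volume.restrict Ω := by
  rw [T.restrict_eq_sum hΩ]
  exact Finset.single_le_sum (f := fun K : T.Elem => (volume.restrict K.1 : Measure (E (m + 1))))
    (fun _ _ => Measure.zero_le _) (Finset.mem_univ K)

theorem sum_setIntegral (hΩ : IsConvexPolyhedralDomain Ω) {g : E (m + 1) → ℝ}
    (hg : IntegrableOn g Ω) : ∑ K : T.Elem, ∫ x in K.1, g x = ∫ x in Ω, g x := by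
  rw [T.restrict_eq_sum hΩ, integral_finsetSum_measure]
  exact fun K _ => Integrable.mono_measure hg (T.restrict_elem_le hΩ K)

/-- The classes of `f` on the elements replace the integrals of the load by inner products, so that
Hilbert space estimates apply. -/
theorem exists_load (hΩ : IsConvexPolyhedralDomain Ω) {f : E (m + 1) → ℝ}
    (hf : MemLp f 2 (volume.restrict Ω)) :
    ∃ ℓ : ∀ K : T.Elem, L2 K.1,
      (∀ (K : T.Elem) (w : L2 K.1), ∫ x in K.1, f x * w x = inner ℝ (ℓ K) w) ∧
      ∑ K, ‖ℓ K‖ ^ 2 = ∫ x in Ω, f x ^ 2 := by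
  have hK : ∀ K : T.Elem, MemLp f 2 (volume.restrict K.1) := fun K =>
    hf.mono_measure (T.restrict_elem_le hΩ K)
  refine ⟨fun K => (hK K).toLp f, fun K w => ?_, ?_⟩
  · rw [L2.inner_def]
    refine integral_congr_ae ?_
    filter_upwards [(hK K).coeFn_toLp] with x hx
    rw [hx]; simp [mul_comm]
  · rw [← T.sum_setIntegral hΩ hf.integrable_sq]
    refine Finset.sum_congr rfl fun K _ => ?_
    rw [← real_inner_self_eq_norm_sq, L2.inner_def]
    refine integral_congr_ae ?_
    filter_upwards [(hK K).coeFn_toLp] with x hx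
    rw [hx]; simp [sq]

/-- A continuous field has the same value on both sides of a face, and the normals are opposite, so
its normal component is conservative. -/
theorem exists_normalTrace (hm : 1 ≤ m) {θ : E (m + 1) → E (m + 1)} (hθ : Continuous θ) :
    ∃ t : T.Bdry, (∀ (K : T.Elem) (F : T.Facet K),
      t K F =ᵐ[(surf (m + 1)).restrict F.1] fun x => inner ℝ (θ x) (T.normal F)) ∧
      ∀ F, ConservativeAt t F := by
  have hmem : ∀ (K : T.Elem) (F : T.Facet K),
      MemLp (fun x => inner ℝ (θ x) (T.normal F)) 2 ((surf (m + 1)).restrict F.1) := by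
    intro K F
    obtain ⟨c, hF⟩ := T.exists_isFacetWith hm F
    have := isFiniteMeasure_surf_facet hm T F
    have hc : Continuous fun x => inner ℝ (θ x) (T.normal F) := by fun_prop
    obtain ⟨C, hC⟩ := hF.isCompact.exists_bound_of_continuousOn hc.continuousOn
    refine MemLp.of_bound hc.aestronglyMeasurable C ?_
    exact (ae_restrict_iff' hF.isClosed.measurableSet).2 (ae_of_all _ hC)
  refine ⟨fun K F => (hmem K F).toLp _, fun K F => (hmem K F).coeFn_toLp, ?_⟩
  intro F K K' hne h h'
  refine Lp.ext ?_
  filter_upwards [(hmem K ⟨F, h⟩).coeFn_toLp, (hmem K' ⟨F, h'⟩).coeFn_toLp,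
    Lp.coeFn_add ((hmem K ⟨F, h⟩).toLp _) ((hmem K' ⟨F, h'⟩).toLp _),
    Lp.coeFn_zero ℝ 2 ((surf (m + 1)).restrict F)] with x h1 h2 h3 h4
  rw [h3, h4, Pi.add_apply, h1, h2, T.normal_eq_neg hm hne h h', inner_neg_right]
  simp

/-- The elementwise function is extended by zero to a cube containing `Ω`. The extension need only
be in `L²`, so jumps do no harm, and the constant depends on the cube alone and not on the mesh. -/
theorem exists_infsup (hΩ : IsConvexPolyhedralDomain Ω) :
    ∃ C : ℝ, 0 < C ∧ ∀ (T : Mesh Ω) (u : ∀ K : T.Elem, L2 K.1) (B : ℝ), 0 ≤ B →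
      (∀ θ : E (m + 1) → E (m + 1), ContDiff ℝ ∞ θ →
        ∑ K : T.Elem, ∫ x in K.1, u K x * divg θ x ≤
          B * (√(∫ x in Ω, ‖θ x‖ ^ 2) + √(∫ x in Ω, jacSq θ x))) →
      ∑ K, ‖u K‖ ^ 2 ≤ (C * B) ^ 2 := by
  obtain ⟨L, hL, hsub⟩ := exists_subset_cube hΩ.isBounded
  obtain ⟨C, hC, hinf⟩ := HDG.exists_infsup m hL
  refine ⟨C, hC, fun T u B hB hu => ?_⟩
  have hint : ∀ K : T.Elem, volume.restrict (interior K.1) = volume.restrict K.1 := fun K =>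
    Measure.restrict_congr_set (interior_ae_eq_of_null_frontier
      ((T.elem_polytope K).convex.addHaar_frontier volume))
  have hsubK : ∀ K : T.Elem, interior K.1 ⊆ cube (m + 1) L := fun K =>
    (interior_mono (T.elem_subset K)).trans (hΩ.interior_closure.trans_subset hsub)
  have hmeas : ∀ K : T.Elem, MeasurableSet (interior K.1) := fun K => isOpen_interior.measurableSet
  have hrr : ∀ K : T.Elem, (volume.restrict (cube (m + 1) L)).restrict (interior K.1) =
      volume.restrict K.1 := fun K => by
    rw [Measure.restrict_restrict (hmeas K), Set.inter_eq_left.2 (hsubK K), hint]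
  have hglue : ∀ g : T.Elem → E (m + 1) → ℝ, (∀ K, IntegrableOn (g K) K.1) →
      ∫ x in cube (m + 1) L, ∑ K : T.Elem, (interior K.1).indicator (g K) x =
        ∑ K : T.Elem, ∫ x in K.1, g K x := by
    intro g hg
    rw [integral_finsetSum]
    · refine Finset.sum_congr rfl fun K _ => ?_
      rw [integral_indicator (hmeas K), hrr]
    · intro K _
      rw [integrable_indicator_iff (hmeas K), IntegrableOn, hrr]
      exact hg K
  -- The interiors of the elements are truly disjoint, so the square of the sum is the sum of the
  -- squares at every point; only null sets are lost.
  set w : E (m + 1) → ℝ := fun x => ∑ K : T.Elem, (interior K.1).indicator (u K) x with hw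
  have hwmem : MemLp w 2 (volume.restrict (cube (m + 1) L)) := by
    refine memLp_finsetSum _ fun K _ => ?_
    rw [memLp_indicator_iff_restrict (hmeas K), hrr]
    exact Lp.memLp _
  have hsq : ∀ x, w x ^ 2 = ∑ K : T.Elem, (interior K.1).indicator (fun x => u K x ^ 2) x := by
    intro x
    by_cases hx : ∃ K : T.Elem, x ∈ interior K.1
    · obtain ⟨K, hK⟩ := hx
      have h0 : ∀ K' : T.Elem, K' ≠ K → x ∉ interior K'.1 := fun K' hne hx' =>
        (T.elem_disjoint hne).le_bot ⟨hx', hK⟩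
      rw [hw]
      simp only
      rw [Fintype.sum_eq_single K (fun K' hne => Set.indicator_of_notMem (h0 K' hne) _),
        Fintype.sum_eq_single K (fun K' hne => Set.indicator_of_notMem (h0 K' hne) _),
        Set.indicator_of_mem hK, Set.indicator_of_mem hK]
    · push Not at hx
      simp [hw, Set.indicator_of_notMem (hx _)]
  have hcube : ∀ g : E (m + 1) → ℝ, Continuous g → IntegrableOn g (cube (m + 1) L) := by
    intro g hg
    have hb := (isBounded_cube (m + 1) hL).closure
    exact (hg.continuousOn.integrableOn_compact
      (Metric.isCompact_of_isClosed_isBounded isClosed_closure hb)).mono_set subset_closure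
  have hmono : ∀ g : E (m + 1) → ℝ, Continuous g → (∀ x, 0 ≤ g x) →
      ∫ x in Ω, g x ≤ ∫ x in cube (m + 1) L, g x := fun g hg h0 =>
    setIntegral_mono_set (hcube g hg) (ae_of_all _ h0) (Filter.Eventually.of_forall hsub)
  have key := hinf w hwmem B hB ?_
  · simp only [hsq] at key
    rw [hglue _ (fun K => (Lp.memLp (u K)).integrable_sq)] at key
    refine le_trans (le_of_eq (Finset.sum_congr rfl fun K _ => ?_)) key
    rw [← real_inner_self_eq_norm_sq, L2.inner_def]
    simp [sq]
  · intro θ hθ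
    have hdc : Continuous (divg θ) := by
      unfold divg
      have := hθ.continuous_fderiv (by simp)
      fun_prop
    have hjc : Continuous (jacSq θ) := by
      unfold jacSq
      have := hθ.continuous_fderiv (by simp)
      fun_prop
    have e1 : ∫ x in cube (m + 1) L, w x * divg θ x =
        ∑ K : T.Elem, ∫ x in K.1, u K x * divg θ x := by
      rw [← hglue]
      · refine integral_congr_ae (ae_of_all _ fun x => ?_)
        simp only [hw, Finset.sum_mul]
        exact Finset.sum_congr rfl fun K _ => by
          by_cases hx : x ∈ interior K.1 <;> simp [hx]
      · intro K
        have := (T.elem_polytope K).isFiniteMeasure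
        obtain ⟨D, hD⟩ := (T.elem_polytope K).isCompact.exists_bound_of_continuousOn
          hdc.continuousOn
        refine Integrable.mul_bdd (c := D) ((Lp.memLp (u K)).integrable (by norm_num))
          hdc.aestronglyMeasurable ?_
        exact (ae_restrict_iff' (T.elem_polytope K).isClosed.measurableSet).2 (ae_of_all _ hD)
    rw [e1]
    -- Norms over `Ω` are at most norms over the cube, so the assumed bound implies the one required
    -- on the cube.
    refine (hu θ hθ).trans (mul_le_mul_of_nonneg_left (add_le_add ?_ ?_) hB)
    · exact Real.sqrt_le_sqrt (hmono _ (by have := hθ.continuous; fun_prop) fun x => by positivity)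
    · exact Real.sqrt_le_sqrt (hmono _ hjc fun x => Finset.sum_nonneg fun i _ => by positivity)

end Mesh

namespace FESpaces

variable {T : Mesh Ω} (S : FESpaces T)

theorem exists_projection {θ : E (m + 1) → E (m + 1)} (hθ : Continuous θ) :
    ∃ p : S.Vh, (∀ K, ∀ v ∈ S.V K,
      inner ℝ (p K).1.1 v.1 = ∫ x in K.1, inner ℝ (θ x) (v.1 x)) ∧
      ∀ K, ‖(p K).1.1‖ ^ 2 ≤ ∫ x in K.1, ‖θ x‖ ^ 2 := by
  have key : ∀ K : T.Elem, ∃ p : S.V K, (∀ v ∈ S.V K,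
      inner ℝ p.1.1 v.1 = ∫ x in K.1, inner ℝ (θ x) (v.1 x)) ∧
      ‖p.1.1‖ ^ 2 ≤ ∫ x in K.1, ‖θ x‖ ^ 2 := by
    intro K
    have := (T.elem_polytope K).isFiniteMeasure
    obtain ⟨D, hD⟩ := (T.elem_polytope K).isCompact.exists_bound_of_continuousOn hθ.continuousOn
    have hmem : MemLp θ 2 (volume.restrict K.1) :=
      MemLp.of_bound hθ.aestronglyMeasurable D
        ((ae_restrict_iff' (T.elem_polytope K).isClosed.measurableSet).2 (ae_of_all _ hD))
    have := S.finV K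
    -- The projection is taken in `L²(K)^d`, onto the field components of `S.V K`; a member of `S.V
    -- K` with the projected field is then picked.
    let U : Submodule ℝ (L2v K.1) := (S.V K).map (LinearMap.fst ℝ _ _)
    obtain ⟨p, hp, hpe⟩ := (U.starProjection_apply_mem (hmem.toLp θ) :
      U.starProjection (hmem.toLp θ) ∈ U)
    refine ⟨⟨p, hp⟩, fun v hv => ?_, ?_⟩
    swap
    · have h2 : ‖p.1‖ ≤ ‖hmem.toLp θ‖ := by
        have h3 : p.1 = U.starProjection (hmem.toLp θ) := hpe
        rw [h3]; exact U.norm_starProjection_apply_le _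
      refine (pow_le_pow_left₀ (norm_nonneg _) h2 2).trans (le_of_eq ?_)
      rw [← real_inner_self_eq_norm_sq, L2.inner_def]
      refine integral_congr_ae ?_
      filter_upwards [hmem.coeFn_toLp] with x hx
      rw [hx, real_inner_self_eq_norm_sq]
    have h1 := U.starProjection_inner_eq_zero (hmem.toLp θ) v.1 ⟨v, hv, rfl⟩
    rw [inner_sub_left, sub_eq_zero, ← hpe] at h1
    refine h1.symm.trans ?_
    rw [L2.inner_def]
    refine integral_congr_ae ?_
    filter_upwards [hmem.coeFn_toLp] with x hx
    rw [hx]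
  choose p hp hp' using key
  exact ⟨p, hp, hp'⟩

end FESpaces
end HDG

/-! ### Energy identity, duality and uniqueness -/

namespace HDG

theorem sum_inner_le {ι : Type*} [Fintype ι] {H : ι → Type*} [∀ i, NormedAddCommGroup (H i)]
    [∀ i, InnerProductSpace ℝ (H i)] (x y : ∀ i, H i) :
    ∑ i, inner ℝ (x i) (y i) ≤ √(∑ i, ‖x i‖ ^ 2) * √(∑ i, ‖y i‖ ^ 2) :=
  (Finset.sum_le_sum fun i _ => real_inner_le_norm (x i) (y i)).trans
    (Real.sum_mul_le_sqrt_mul_sqrt _ _ _)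

variable {m : ℕ} {Ω : Set (E (m + 1))} {T : Mesh Ω}

theorem Mesh.bdryInner_le (a b : T.Bdry) :
    T.bdryInner a b ≤ √(∑ K, ∑ F, ‖a K F‖ ^ 2) * √(∑ K, ∑ F, ‖b K F‖ ^ 2) := by
  have := sum_inner_le (fun p : Σ K : T.Elem, T.Facet K => a p.1 p.2) (fun p => b p.1 p.2)
  simpa only [Mesh.bdryInner, Fintype.sum_sigma] using this

/-- This turns the factor `h^{1/2}` of the approximation property into a constant depending only on
`Ω`. -/
theorem Mesh.size_le (hΩ : IsConvexPolyhedralDomain Ω) (T : Mesh Ω) :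
    T.size ≤ Metric.diam (closure Ω) :=
  Real.iSup_le (fun K => Metric.diam_mono (T.elem_subset K) hΩ.isBounded.closure)
    Metric.diam_nonneg

/-! ### The core problem: energy identity, duality identity and uniqueness. -/

namespace FESpaces

variable (S : FESpaces T)

instance instSMulVh : SMul ℝ S.Vh := (Pi.module T.Elem (fun K => S.V K) ℝ).toSMul

instance instSMulWh : SMul ℝ S.Wh := (Pi.module T.Elem (fun K => S.W K) ℝ).toSMul

instance instModuleVh : Module ℝ S.Vh := Pi.module T.Elem (fun K => S.V K) ℝ

instance instModuleWh : Module ℝ S.Wh := Pi.module T.Elem (fun K => S.W K) ℝ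

theorem ntrace_add (q q' : S.Vh) : S.ntrace (q + q') = S.ntrace q + S.ntrace q' := rfl
theorem ntrace_sub (q q' : S.Vh) : S.ntrace (q - q') = S.ntrace q - S.ntrace q' := rfl
theorem ntrace_smul (c : ℝ) (q : S.Vh) : S.ntrace (c • q) = c • S.ntrace q := rfl
theorem trace_add (u u' : S.Wh) : S.trace (u + u') = S.trace u + S.trace u' := rfl
theorem trace_sub (u u' : S.Wh) : S.trace (u - u') = S.trace u - S.trace u' := rfl
theorem trace_smul (c : ℝ) (u : S.Wh) : S.trace (c • u) = c • S.trace u := rfl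
theorem ofM_add (μ μ' : ∀ F : T.Face, S.M F.1) : S.ofM (μ + μ') = S.ofM μ + S.ofM μ' := rfl
theorem ofM_smul (c : ℝ) (μ : ∀ F : T.Face, S.M F.1) : S.ofM (c • μ) = c • S.ofM μ := rfl

/-- The numerical flux `q·n + τ (u - a)`. -/
def flux (τ : ∀ K : T.Elem, T.Facet K → ℝ) (q : S.Vh) (u : S.Wh) (a : T.Bdry) : T.Bdry :=
  fun K F => S.ntrace q K F + τ K F • (S.trace u K F - a K F)

/-- The problem underlying all formulations: a single-valued numerical trace `a` with a
conservative numerical flux, and load `ℓ`. -/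
structure IsCoreSolution (τ : ∀ K : T.Elem, T.Facet K → ℝ) (ℓ : ∀ K : T.Elem, L2 K.1)
    (q : S.Vh) (u : S.Wh) (a : T.Bdry) : Prop where
  grad : S.GradEq q u a
  div : ∀ w : S.Wh, -(∑ K, inner ℝ (q K).1.1 (w K).1.2.1) +
    T.bdryInner (S.flux τ q u a) (S.trace w) = ∑ K, inner ℝ (ℓ K) (w K).1.1
  mem : ∀ (K : T.Elem) (F : T.Facet K), a K F ∈ S.M F.1
  single : ∀ F, Mesh.SingleValuedAt a F
  conservative : ∀ F, Mesh.ConservativeAt (S.flux τ q u a) F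

variable {S} {τ : ∀ K : T.Elem, T.Facet K → ℝ} {ℓ : ∀ K : T.Elem, L2 K.1}
  {q : S.Vh} {u : S.Wh} {a : T.Bdry}

theorem flux_mem (q : S.Vh) (u : S.Wh) (ha : ∀ (K : T.Elem) (F : T.Facet K), a K F ∈ S.M F.1)
    (K : T.Elem) (F : T.Facet K) : S.flux τ q u a K F ∈ S.M F.1 :=
  (S.M F.1).add_mem (S.A3 K F _ (q K).2)
    ((S.M F.1).smul_mem _ ((S.M F.1).sub_mem (S.A4 K F _ (u K).2) (ha K F)))

theorem flux_sub (q q' : S.Vh) (u u' : S.Wh) (a a' : T.Bdry) :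
    S.flux τ (q - q') (u - u') (a - a') = S.flux τ q u a - S.flux τ q' u' a' := by
  funext K F
  simp only [flux, ntrace_sub, trace_sub, Pi.sub_apply, smul_sub]
  abel

theorem flux_add (q q' : S.Vh) (u u' : S.Wh) (a a' : T.Bdry) :
    S.flux τ (q + q') (u + u') (a + a') = S.flux τ q u a + S.flux τ q' u' a' := by
  funext K F
  simp only [flux, ntrace_add, trace_add, Pi.add_apply, smul_sub, smul_add]
  abel

theorem flux_smul (c : ℝ) (q : S.Vh) (u : S.Wh) (a : T.Bdry) :
    S.flux τ (c • q) (c • u) (c • a) = c • S.flux τ q u a := by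
  funext K F
  simp only [flux, ntrace_smul, trace_smul, Pi.smul_apply, smul_sub, smul_add,
    smul_comm c (τ K F)]

theorem IsCoreSolution.sub {ℓ' : ∀ K : T.Elem, L2 K.1} {q' : S.Vh} {u' : S.Wh} {a' : T.Bdry}
    (h : S.IsCoreSolution τ ℓ q u a) (h' : S.IsCoreSolution τ ℓ' q' u' a') :
    S.IsCoreSolution τ (ℓ - ℓ') (q - q') (u - u') (a - a') where
  grad v := by
    have h1 := h.grad v
    have h2 := h'.grad v
    simp only [Pi.sub_apply, Submodule.coe_sub, Prod.fst_sub, inner_sub_left,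
      Finset.sum_sub_distrib, Mesh.bdryInner_sub_left]
    linarith
  div w := by
    have h1 := h.div w
    have h2 := h'.div w
    simp only [Pi.sub_apply, Submodule.coe_sub, Prod.fst_sub, inner_sub_left,
      Finset.sum_sub_distrib, Mesh.bdryInner_sub_left, flux_sub]
    linarith
  mem K F := (S.M F.1).sub_mem (h.mem K F) (h'.mem K F)
  single F := (h.single F).sub (h'.single F)
  conservative F := by
    rw [flux_sub]
    exact (h.conservative F).sub (h'.conservative F)

theorem sum_green (q : S.Vh) (u : S.Wh) :
    (∑ K, inner ℝ (q K).1.1 (u K).1.2.1) + ∑ K, inner ℝ (u K).1.1 (q K).1.2.1 =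
      T.bdryInner (S.ntrace q) (S.trace u) := by
  rw [← Finset.sum_add_distrib]
  refine Finset.sum_congr rfl fun K _ => ?_
  rw [real_inner_comm (q K).1.2.1]
  exact S.hdivV K _ (q K).2 _ (S.h1W K _ (u K).2)

theorem bdryInner_flux_sub (q : S.Vh) (u : S.Wh) (a : T.Bdry) :
    T.bdryInner (S.flux τ q u a) (S.trace u - a) =
      T.bdryInner (S.ntrace q) (S.trace u - a) +
        ∑ K : T.Elem, ∑ F : T.Facet K, τ K F * ‖S.trace u K F - a K F‖ ^ 2 := by
  simp only [Mesh.bdryInner, ← Finset.sum_add_distrib]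
  refine Finset.sum_congr rfl fun K _ => Finset.sum_congr rfl fun F _ => ?_
  simp only [flux, Pi.sub_apply]
  rw [inner_add_left, real_inner_smul_left, real_inner_self_eq_norm_sq]

/-- Test with `v = q` and `w = u`. Green's formula removes the volume terms containing derivatives,
and the pairing of `a` with the flux vanishes by `bdryInner_eq_zero`. -/
theorem IsCoreSolution.energy (hm : 1 ≤ m) (hΩ : IsConvexPolyhedralDomain Ω)
    (h : S.IsCoreSolution τ ℓ q u a) :
    (∑ K, ‖(q K).1.1‖ ^ 2) +
        (∑ K : T.Elem, ∑ F : T.Facet K, τ K F * ‖S.trace u K F - a K F‖ ^ 2) =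
      ∑ K, inner ℝ (ℓ K) (u K).1.1 := by
  have h1 := h.grad q
  have h2 := h.div u
  have h3 := sum_green q u
  have h4 := bdryInner_flux_sub (τ := τ) q u a
  have h5 := Mesh.bdryInner_eq_zero hm hΩ h.single h.conservative
  rw [Mesh.bdryInner_comm] at h5
  have h6 := Mesh.bdryInner_comm a (S.ntrace q)
  rw [Mesh.bdryInner_sub_right, Mesh.bdryInner_sub_right] at h4
  simp only [real_inner_self_eq_norm_sq] at h1
  linarith

/-- Integrate by parts on each element, replace `θ` by its projection `p` against `∇u`, which is
allowed since `∇W(K) ⊂ V(K)`, integrate back, and use the gradient equation with `v = p`. The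
leftover `⟨a, θ·n⟩` is zero because `a` is single valued with zero boundary values, so `θ` may be
any smooth field. -/
theorem sum_integral_mul_divg (hm : 1 ≤ m) (hΩ : IsConvexPolyhedralDomain Ω)
    (hg : S.GradEq q u a) (ha : ∀ F, Mesh.SingleValuedAt a F) {θ : E (m + 1) → E (m + 1)}
    (hθ : ContDiff ℝ ∞ θ) {p : S.Vh} (hp : ∀ K, ∀ v ∈ S.V K,
      inner ℝ (p K).1.1 v.1 = ∫ x in K.1, inner ℝ (θ x) (v.1 x)) {t : T.Bdry}
    (ht : ∀ (K : T.Elem) (F : T.Facet K),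
      t K F =ᵐ[(surf (m + 1)).restrict F.1] fun x => inner ℝ (θ x) (T.normal F))
    (htc : ∀ F, Mesh.ConservativeAt t F) :
    ∑ K : T.Elem, ∫ x in K.1, (u K).1.1 x * divg θ x =
      (∑ K, inner ℝ (q K).1.1 (p K).1.1) + T.bdryInner (S.trace u - a) (t - S.ntrace p) := by
  have h1 : (∑ K, inner ℝ (p K).1.1 (u K).1.2.1) +
      (∑ K : T.Elem, ∫ x in K.1, (u K).1.1 x * divg θ x) = T.bdryInner (S.trace u) t := by
    rw [← Finset.sum_add_distrib]
    refine Finset.sum_congr rfl fun K _ => ?_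
    obtain ⟨v, hv, hve⟩ := S.gradW K _ (u K).2
    rw [← hve, hp K v hv, hve]
    have h2 := S.h1W K _ (u K).2 θ hθ
    simp only [real_inner_comm] at h2 ⊢
    rw [h2]
    refine Finset.sum_congr rfl fun F _ => ?_
    rw [L2.inner_def]
    refine integral_congr_ae ?_
    filter_upwards [ht K F] with x hx
    rw [hx]
    simp [trace, mul_comm]
  have h2 := sum_green p u
  have h3 := hg p
  have h4 := Mesh.bdryInner_eq_zero hm hΩ ha htc
  rw [Mesh.bdryInner_sub_left, Mesh.bdryInner_sub_right, Mesh.bdryInner_sub_right,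
    Mesh.bdryInner_comm (S.trace u) (S.ntrace p)]
  linarith

/-- The energy identity gives `q = 0` and `u = a` on the element boundaries. Then both terms of
`sum_integral_mul_divg` vanish for every `θ`, and the inf-sup inequality with `B = 0` gives `u = 0`.
-/
theorem IsCoreSolution.eq_zero (hm : 1 ≤ m) (hΩ : IsConvexPolyhedralDomain Ω)
    (hτ : ∀ K F, 0 < τ K F) (h : S.IsCoreSolution τ 0 q u a) : q = 0 ∧ u = 0 ∧ a = 0 := by
  have h1 := h.energy hm hΩ
  simp only [Pi.zero_apply, inner_zero_left, Finset.sum_const_zero] at h1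
  have hX : 0 ≤ ∑ K, ‖(q K).1.1‖ ^ 2 := Finset.sum_nonneg fun K _ => by positivity
  have hY0 : ∀ K : T.Elem, ∀ F : T.Facet K, 0 ≤ τ K F * ‖S.trace u K F - a K F‖ ^ 2 :=
    fun K F => mul_nonneg (hτ K F).le (by positivity)
  have hY : 0 ≤ ∑ K : T.Elem, ∑ F : T.Facet K, τ K F * ‖S.trace u K F - a K F‖ ^ 2 :=
    Finset.sum_nonneg fun K _ => Finset.sum_nonneg fun F _ => hY0 K F
  have hX' : ∑ K, ‖(q K).1.1‖ ^ 2 = 0 := by linarith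
  have hY' : ∑ K : T.Elem, ∑ F : T.Facet K, τ K F * ‖S.trace u K F - a K F‖ ^ 2 = 0 := by
    linarith
  have hq1 : ∀ K, (q K).1.1 = 0 := fun K => by
    have := (Finset.sum_eq_zero_iff_of_nonneg (fun K _ => by positivity)).1 hX' K
      (Finset.mem_univ K)
    simpa using this
  have hq : q = 0 := funext fun K =>
    Subtype.ext (Mesh.IsHdiv.eq_zero hm (S.hdivV K _ (q K).2) (hq1 K))
  have hta : S.trace u - a = 0 := by
    funext K F
    have h2 := (Finset.sum_eq_zero_iff_of_nonneg
      (fun K _ => Finset.sum_nonneg fun F _ => hY0 K F)).1 hY' K (Finset.mem_univ K)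
    have h3 := (Finset.sum_eq_zero_iff_of_nonneg (fun F _ => hY0 K F)).1 h2 F (Finset.mem_univ F)
    have h4 := (mul_eq_zero.1 h3).resolve_left (hτ K F).ne'
    simpa using h4
  have hu : u = 0 := by
    obtain ⟨C, hC, hinf⟩ := Mesh.exists_infsup hΩ
    have h2 := hinf T (fun K => (u K).1.1) 0 le_rfl fun θ hθ => by
      obtain ⟨p, hp, -⟩ := S.exists_projection hθ.continuous
      obtain ⟨t, ht, htc⟩ := T.exists_normalTrace hm hθ.continuous
      rw [sum_integral_mul_divg hm hΩ h.grad h.single hθ hp ht htc, hta, hq]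
      simp [Mesh.bdryInner_zero_left]
    rw [mul_zero, zero_pow two_ne_zero] at h2
    refine funext fun K => Subtype.ext (Mesh.IsH1.eq_zero hm (S.h1W K _ (u K).2) ?_)
    have h3 := (Finset.sum_eq_zero_iff_of_nonneg (fun K _ => by positivity)).1
      (h2.antisymm (Finset.sum_nonneg fun K _ => by positivity)) K (Finset.mem_univ K)
    simpa using h3
  refine ⟨hq, hu, ?_⟩
  rw [hu] at hta
  have : S.trace (0 : S.Wh) = 0 := rfl
  rw [this, zero_sub, neg_eq_zero] at hta
  exact hta

theorem IsCoreSolution.unique (hm : 1 ≤ m) (hΩ : IsConvexPolyhedralDomain Ω)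
    (hτ : ∀ K F, 0 < τ K F) {q' : S.Vh} {u' : S.Wh} {a' : T.Bdry}
    (h : S.IsCoreSolution τ ℓ q u a) (h' : S.IsCoreSolution τ ℓ q' u' a') :
    q = q' ∧ u = u' ∧ a = a' := by
  have h1 := h.sub h'
  rw [sub_self] at h1
  obtain ⟨h2, h3, h4⟩ := h1.eq_zero hm hΩ hτ
  exact ⟨sub_eq_zero.1 h2, sub_eq_zero.1 h3, sub_eq_zero.1 h4⟩

end FESpaces
end HDG

/-! ### Existence and stability -/

namespace HDG

variable {m : ℕ} {Ω : Set (E (m + 1))} {T : Mesh Ω}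

namespace FESpaces

variable {S : FESpaces T} {τ : ∀ K : T.Elem, T.Facet K → ℝ} {ℓ : ∀ K : T.Elem, L2 K.1}
  {q : S.Vh} {u : S.Wh} {a : T.Bdry}

theorem finiteDimensional_trial (S : FESpaces T) :
    FiniteDimensional ℝ (S.Vh × S.Wh × S.Mh) := by
  have h1 : FiniteDimensional ℝ S.Vh := by
    have := S.finV
    exact Module.Finite.pi (M := fun K => S.V K)
  have h2 : FiniteDimensional ℝ S.Wh := by
    have := S.finW
    exact Module.Finite.pi (M := fun K => S.W K)
  have h3 : FiniteDimensional ℝ S.Mh := by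
    have := fun F : T.Face => S.finM F.1 F.2
    have : FiniteDimensional ℝ (∀ F : T.Face, S.M F.1) := Module.Finite.pi
    exact FiniteDimensional.finiteDimensional_submodule _
  infer_instance

/-- The bilinear form of the Dirichlet-type method. -/
def bilin (S : FESpaces T) (τ : ∀ K : T.Elem, T.Facet K → ℝ) :
    (S.Vh × S.Wh × S.Mh) →ₗ[ℝ] (S.Vh × S.Wh × S.Mh) →ₗ[ℝ] ℝ :=
  LinearMap.mk₂ ℝ (fun x y =>
    ((∑ K, inner ℝ (x.1 K).1.1 (y.1 K).1.1) - (∑ K, inner ℝ (x.2.1 K).1.1 (y.1 K).1.2.1)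
      + T.bdryInner (S.ofM x.2.2.1) (S.ntrace y.1)) +
    (-(∑ K, inner ℝ (x.1 K).1.1 (y.2.1 K).1.2.1) +
      T.bdryInner (S.flux τ x.1 x.2.1 (S.ofM x.2.2.1)) (S.trace y.2.1)) +
    T.bdryInner (S.flux τ x.1 x.2.1 (S.ofM x.2.2.1)) (S.ofM y.2.2.1))
    (fun x x' y => by
      simp only [Prod.fst_add, Prod.snd_add, Pi.add_apply, Submodule.coe_add, inner_add_left,
        Finset.sum_add_distrib, ofM_add, flux_add, Mesh.bdryInner_add_left]
      ring)
    (fun c x y => by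
      simp only [Prod.smul_fst, Prod.smul_snd, Pi.smul_apply, Submodule.coe_smul,
        real_inner_smul_left, ← Finset.mul_sum, ofM_smul, flux_smul, Mesh.bdryInner_smul_left,
        smul_eq_mul]
      ring)
    (fun x y y' => by
      simp only [Prod.fst_add, Prod.snd_add, Pi.add_apply, Submodule.coe_add, inner_add_right,
        Finset.sum_add_distrib, ofM_add, ntrace_add, trace_add, Mesh.bdryInner_add_right]
      ring)
    (fun c x y => by
      simp only [Prod.smul_fst, Prod.smul_snd, Pi.smul_apply, Submodule.coe_smul,
        real_inner_smul_right, ← Finset.mul_sum, ofM_smul, ntrace_smul, trace_smul,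
        Mesh.bdryInner_smul_right, smul_eq_mul]
      ring)

theorem IsCoreSolution.of_ofM (hm : 1 ≤ m) (hΩ : IsConvexPolyhedralDomain Ω) (μ : S.Mh)
    (hg : S.GradEq q u (S.ofM μ.1))
    (hd : ∀ w : S.Wh, -(∑ K, inner ℝ (q K).1.1 (w K).1.2.1) +
      T.bdryInner (S.flux τ q u (S.ofM μ.1)) (S.trace w) = ∑ K, inner ℝ (ℓ K) (w K).1.1)
    (hf : ∀ ν ∈ S.Mh, T.bdryInner (S.flux τ q u (S.ofM μ.1)) (S.ofM ν) = 0) :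
    S.IsCoreSolution τ ℓ q u (S.ofM μ.1) := by
  have hmem : ∀ (K : T.Elem) (F : T.Facet K), S.ofM μ.1 K F ∈ S.M F.1 := fun K F =>
    (μ.1 (T.toFace F)).2
  exact ⟨hg, hd, hmem, singleValuedAt_ofM μ.2, fun F => conservativeAt_of_test hm hΩ
    (fun K h => flux_mem q u hmem K ⟨F, h⟩) fun ν hν _ => hf ν hν⟩

theorem isCoreSolution_of_bilin (hm : 1 ≤ m) (hΩ : IsConvexPolyhedralDomain Ω)
    {x : S.Vh × S.Wh × S.Mh}
    (h : ∀ y, S.bilin τ x y = ∑ K, inner ℝ (ℓ K) (y.2.1 K).1.1) :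
    S.IsCoreSolution τ ℓ x.1 x.2.1 (S.ofM x.2.2.1) := by
  have hM0 : S.ofM (0 : ∀ F : T.Face, S.M F.1) = 0 := rfl
  have hV0 : S.ntrace 0 = 0 := rfl
  have hW0 : S.trace 0 = 0 := rfl
  refine IsCoreSolution.of_ofM hm hΩ _ (fun v => ?_) (fun w => ?_) (fun ν hν => ?_)
  · simpa [bilin, hM0, hW0, Mesh.bdryInner_zero_right] using h (v, 0, 0)
  · simpa [bilin, hM0, hV0, Mesh.bdryInner_zero_right] using h (0, w, 0)
  · simpa [bilin, hV0, hW0, Mesh.bdryInner_zero_right] using h (0, 0, ⟨ν, hν⟩)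

/-- The Dirichlet-type method is a linear map from a finite-dimensional space to its dual. Its
kernel consists of core solutions with zero load, so the map is injective and therefore surjective.
-/
theorem exists_isCoreSolution (hm : 1 ≤ m) (hΩ : IsConvexPolyhedralDomain Ω)
    (hτ : ∀ K F, 0 < τ K F) (ℓ : ∀ K : T.Elem, L2 K.1) :
    ∃ (q : S.Vh) (u : S.Wh) (a : T.Bdry), S.IsCoreSolution τ ℓ q u a := by
  have := S.finiteDimensional_trial
  have hinj : Function.Injective (S.bilin τ) := by
    rw [injective_iff_map_eq_zero]
    intro x hx
    have h1 : S.IsCoreSolution τ 0 x.1 x.2.1 (S.ofM x.2.2.1) :=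
      isCoreSolution_of_bilin hm hΩ fun y => by rw [hx]; simp
    obtain ⟨h2, h3, h4⟩ := h1.eq_zero hm hΩ hτ
    refine Prod.ext h2 (Prod.ext h3 (Subtype.ext (funext fun F => ?_)))
    refine eq_of_ofM_eq fun K hF => ?_
    rw [h4]; rfl
  have hsurj : Function.Surjective (S.bilin τ) :=
    (LinearMap.injective_iff_surjective_of_finrank_eq_finrank
      (Subspace.dual_finrank_eq (K := ℝ) (V := S.Vh × S.Wh × S.Mh)).symm).1 hinj
  let φ : (S.Vh × S.Wh × S.Mh) →ₗ[ℝ] ℝ :=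
    { toFun := fun y => ∑ K, inner ℝ (ℓ K) (y.2.1 K).1.1
      map_add' := fun y y' => by
        simp [inner_add_right, Finset.sum_add_distrib]
      map_smul' := fun c y => by
        simp only [Prod.smul_fst, Prod.smul_snd, Pi.smul_apply, Submodule.coe_smul,
          real_inner_smul_right, ← Finset.mul_sum, RingHom.id_apply, smul_eq_mul] }
  obtain ⟨x, hx⟩ := hsurj φ
  exact ⟨_, _, _, isCoreSolution_of_bilin hm hΩ fun y => by rw [hx]; rfl⟩

/-- In the duality identity, `(q, p)` is bounded using that the projection is a contraction. In the
boundary term, `u - a` costs `τ₀^{-1/2}` times the root of the energy, and `θ·n - p·n` is bounded by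
the approximation property with `h` at most the diameter of `closure Ω`. -/
theorem IsCoreSolution.sum_integral_mul_divg_le (hm : 1 ≤ m) (hΩ : IsConvexPolyhedralDomain Ω)
    {A τ₀ : ℝ} (hτ₀ : 0 < τ₀) (hS : S.HasNormalApproximation A) (hτ : ∀ K F, τ₀ ≤ τ K F)
    (h : S.IsCoreSolution τ ℓ q u a) {R : ℝ} (hR : (∑ K, ‖(q K).1.1‖ ^ 2) +
      (∑ K : T.Elem, ∑ F : T.Facet K, τ K F * ‖S.trace u K F - a K F‖ ^ 2) ≤ R)
    {θ : E (m + 1) → E (m + 1)} (hθ : ContDiff ℝ ∞ θ) :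
    ∑ K : T.Elem, ∫ x in K.1, (u K).1.1 x * divg θ x ≤
      √R * (1 + |A| * √(Metric.diam (closure Ω)) / √τ₀) *
        (√(∫ x in Ω, ‖θ x‖ ^ 2) + √(∫ x in Ω, jacSq θ x)) := by
  obtain ⟨p, hp, hpn⟩ := S.exists_projection hθ.continuous
  obtain ⟨t, ht, htc⟩ := T.exists_normalTrace hm hθ.continuous
  rw [sum_integral_mul_divg hm hΩ h.grad h.single hθ hp ht htc]
  set X := ∑ K, ‖(q K).1.1‖ ^ 2
  set Y := ∑ K : T.Elem, ∑ F : T.Facet K, τ K F * ‖S.trace u K F - a K F‖ ^ 2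
  have hX : 0 ≤ X := Finset.sum_nonneg fun K _ => by positivity
  have hY : 0 ≤ Y := Finset.sum_nonneg fun K _ => Finset.sum_nonneg fun F _ =>
    mul_nonneg (hτ₀.le.trans (hτ K F)) (by positivity)
  have h1 : ∑ K, inner ℝ (q K).1.1 (p K).1.1 ≤ √R * √(∫ x in Ω, ‖θ x‖ ^ 2) := by
    refine (sum_inner_le _ _).trans (mul_le_mul (Real.sqrt_le_sqrt (by linarith))
      (Real.sqrt_le_sqrt ?_) (Real.sqrt_nonneg _) (Real.sqrt_nonneg _))
    rw [← T.sum_setIntegral hΩ]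
    · exact Finset.sum_le_sum fun K _ => hpn K
    · have hc : Continuous fun x => ‖θ x‖ ^ 2 := by have := hθ.continuous; fun_prop
      exact (hc.continuousOn.integrableOn_compact (Metric.isCompact_of_isClosed_isBounded
        isClosed_closure hΩ.isBounded.closure)).mono_set subset_closure
  have h2 : √(∑ K : T.Elem, ∑ F : T.Facet K, ‖(S.trace u - a) K F‖ ^ 2) ≤ √R / √τ₀ := by
    rw [← Real.sqrt_div' _ hτ₀.le]
    refine Real.sqrt_le_sqrt ?_
    rw [le_div_iff₀ hτ₀]
    refine le_trans ?_ (show Y ≤ R by linarith)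
    simp only [Finset.sum_mul]
    refine Finset.sum_le_sum fun K _ => Finset.sum_le_sum fun F _ => ?_
    rw [mul_comm]
    exact mul_le_mul_of_nonneg_right (hτ K F) (by positivity)
  have h3 : √(∑ K : T.Elem, ∑ F : T.Facet K, ‖(t - S.ntrace p) K F‖ ^ 2) ≤
      |A| * √(Metric.diam (closure Ω)) * √(∫ x in Ω, jacSq θ x) := by
    have h4 := hS θ hθ p fun v => Finset.sum_congr rfl fun K _ => hp K _ (v K).2
    have h5 : ∑ K : T.Elem, ∑ F : T.Facet K, ‖(t - S.ntrace p) K F‖ ^ 2 =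
        ∑ K : T.Elem, ∑ F : T.Facet K,
          ∫ x in F.1, (inner ℝ (θ x) (T.normal F) - S.ntrace p K F x) ^ 2 ∂(surf (m + 1)) := by
      refine Finset.sum_congr rfl fun K _ => Finset.sum_congr rfl fun F _ => ?_
      rw [← real_inner_self_eq_norm_sq, L2.inner_def]
      refine integral_congr_ae ?_
      filter_upwards [ht K F, Lp.coeFn_sub (t K F) (S.ntrace p K F)] with x hx hx'
      simp only [Pi.sub_apply] at hx' ⊢
      rw [hx', hx]
      simp [sq]
    rw [h5]
    refine h4.trans (mul_le_mul_of_nonneg_right (mul_le_mul (le_abs_self A)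
      (Real.sqrt_le_sqrt (T.size_le hΩ)) (Real.sqrt_nonneg _) (abs_nonneg A))
      (Real.sqrt_nonneg _))
  have h6 := (Mesh.bdryInner_le (S.trace u - a) (t - S.ntrace p)).trans
    (mul_le_mul h2 h3 (Real.sqrt_nonneg _) (by positivity))
  set P := √(∫ x in Ω, ‖θ x‖ ^ 2)
  set J := √(∫ x in Ω, jacSq θ x)
  have hP : 0 ≤ P := Real.sqrt_nonneg _
  have hJ : 0 ≤ J := Real.sqrt_nonneg _
  set κ := |A| * √(Metric.diam (closure Ω)) / √τ₀ with hκ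
  have hκ0 : 0 ≤ κ := by positivity
  have h7 : √R / √τ₀ * (|A| * √(Metric.diam (closure Ω)) * J) = √R * κ * J := by
    rw [hκ]; ring
  -- These are the cross terms that complete `P + κ J` to the product `(1 + κ)(P + J)`.
  have h8 : 0 ≤ √R * (κ * P + J) := by positivity
  rw [h7] at h6
  calc _ ≤ √R * P + √R * κ * J := add_le_add h1 h6
    _ ≤ √R * P + √R * κ * J + √R * (κ * P + J) := le_add_of_nonneg_right h8
    _ = _ := by ring

/-- The energy `R` equals `(ℓ, u) ≤ ‖ℓ‖ ‖u‖`, while duality and the inf-sup inequality give `‖u‖ ≤ C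
κ √R`. Cancelling `√R` leaves a bound by the load alone. -/
theorem exists_stability (hm : 1 ≤ m) (hΩ : IsConvexPolyhedralDomain Ω) (A : ℝ) {τ₀ : ℝ}
    (hτ₀ : 0 < τ₀) : ∃ C : ℝ, 0 < C ∧ ∀ (T : Mesh Ω) (S : FESpaces T),
      S.HasNormalApproximation A → ∀ τ : (∀ K : T.Elem, T.Facet K → ℝ), (∀ K F, τ₀ ≤ τ K F) →
      ∀ (ℓ : ∀ K : T.Elem, L2 K.1) (q : S.Vh) (u : S.Wh) (a : T.Bdry),
        S.IsCoreSolution τ ℓ q u a →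
        (∑ K, ‖(q K).1.1‖ ^ 2) +
            (∑ K : T.Elem, ∑ F : T.Facet K, τ K F * ‖S.trace u K F - a K F‖ ^ 2) ≤
          C * ∑ K, ‖ℓ K‖ ^ 2 := by
  obtain ⟨C, hC, hinf⟩ := Mesh.exists_infsup hΩ
  set κ := 1 + |A| * √(Metric.diam (closure Ω)) / √τ₀
  have hκ : 0 < κ := by positivity
  refine ⟨(C * κ) ^ 2, by positivity, fun T S hS τ hτ ℓ q u a h => ?_⟩
  have he := h.energy hm hΩ
  set R := (∑ K, ‖(q K).1.1‖ ^ 2) +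
    (∑ K : T.Elem, ∑ F : T.Facet K, τ K F * ‖S.trace u K F - a K F‖ ^ 2) with hR
  have hR0 : 0 ≤ R := add_nonneg (Finset.sum_nonneg fun K _ => by positivity)
    (Finset.sum_nonneg fun K _ => Finset.sum_nonneg fun F _ =>
      mul_nonneg (hτ₀.le.trans (hτ K F)) (by positivity))
  have h1 := hinf T (fun K => (u K).1.1) (√R * κ) (by positivity) fun θ hθ =>
    h.sum_integral_mul_divg_le hm hΩ hτ₀ hS hτ hR.ge hθ
  have h2 : R ≤ √(∑ K, ‖ℓ K‖ ^ 2) * (C * (√R * κ)) := by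
    rw [he]
    refine (sum_inner_le _ _).trans (mul_le_mul_of_nonneg_left ?_ (Real.sqrt_nonneg _))
    rw [← he]
    exact Real.sqrt_le_iff.2 ⟨by positivity, h1⟩
  set G := ∑ K, ‖ℓ K‖ ^ 2
  have hG : 0 ≤ G := Finset.sum_nonneg fun K _ => by positivity
  have h3 := Real.sq_sqrt hR0
  have h4 : √R ≤ √G * (C * κ) := by
    rcases (Real.sqrt_nonneg R).eq_or_lt with h0 | h0
    · rw [← h0]; positivity
    · refine le_of_mul_le_mul_right ?_ h0
      calc √R * √R = R := by rw [← sq, h3]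
        _ ≤ _ := h2
        _ = _ := by ring
  calc R = √R ^ 2 := h3.symm
    _ ≤ (√G * (C * κ)) ^ 2 := pow_le_pow_left₀ (Real.sqrt_nonneg _) h4 2
    _ = _ := by rw [mul_pow, Real.sq_sqrt hG]; ring

end FESpaces
end HDG

/-! ### The unified, Dirichlet, Neumann and mixed formulations -/

namespace HDG

variable {m : ℕ} {Ω : Set (E (m + 1))} {T : Mesh Ω}

namespace FESpaces

variable {S : FESpaces T} {τ : ∀ K : T.Elem, T.Facet K → ℝ} {f : E (m + 1) → ℝ}
  {ℓ : ∀ K : T.Elem, L2 K.1} {q : S.Vh} {u : S.Wh} {a : T.Bdry}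

theorem divEq_iff (hℓ : ∀ (K : T.Elem) (w : L2 K.1), ∫ x in K.1, f x * w x = inner ℝ (ℓ K) w)
    {b : T.Bdry} : S.DivEq f q b ↔
      ∀ w : S.Wh, -(∑ K, inner ℝ (q K).1.1 (w K).1.2.1) + T.bdryInner b (S.trace w) =
        ∑ K, inner ℝ (ℓ K) (w K).1.1 := by
  simp only [DivEq, hℓ]

section Unified

variable {qhat : S.TNh} {uhat : S.TMh}

theorem IsUnifiedSolution.flux_eq (h : S.IsUnifiedSolution τ f q u qhat uhat) :
    S.flux τ q u (S.ofTM uhat) = S.ofTN qhat := by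
  funext K F
  have h1 := h.2.2.2.2 K F
  rw [sub_add_eq_add_sub, sub_eq_zero] at h1
  exact h1

/-- Testing with `N_h` makes the trace single valued with zero boundary values, testing with `M_h`
makes the flux conservative, and the pointwise relation identifies the flux with `q·n + τ(u - û)`.
-/
theorem IsUnifiedSolution.isCoreSolution (hm : 1 ≤ m) (hΩ : IsConvexPolyhedralDomain Ω)
    (hℓ : ∀ (K : T.Elem) (w : L2 K.1), ∫ x in K.1, f x * w x = inner ℝ (ℓ K) w)
    (h : S.IsUnifiedSolution τ f q u qhat uhat) :
    S.IsCoreSolution τ ℓ q u (S.ofTM uhat) := by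
  have hmem : ∀ (K : T.Elem) (F : T.Facet K), S.ofTM uhat K F ∈ S.M F.1 := fun K F =>
    (uhat K F).2
  refine ⟨h.1, ?_, hmem, fun F => ?_, fun F => ?_⟩
  · rw [h.flux_eq]; exact (divEq_iff hℓ).1 h.2.1
  · exact singleValuedAt_of_test hm hΩ (fun K h => hmem K ⟨F, h⟩) fun r _ => h.2.2.2.1 r
  · refine conservativeAt_of_test (S := S) hm hΩ (fun K h => flux_mem q u hmem K ⟨F, h⟩) ?_
    intro μ hμ _
    rw [h.flux_eq]
    exact h.2.2.1 μ hμ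

theorem IsCoreSolution.isUnifiedSolution (hm : 1 ≤ m) (hΩ : IsConvexPolyhedralDomain Ω)
    (hℓ : ∀ (K : T.Elem) (w : L2 K.1), ∫ x in K.1, f x * w x = inner ℝ (ℓ K) w)
    (h : S.IsCoreSolution τ ℓ q u a) (hu : S.ofTM uhat = a) (hq : S.ofTN qhat = S.flux τ q u a) :
    S.IsUnifiedSolution τ f q u qhat uhat := by
  refine ⟨hu ▸ h.grad, ?_, fun μ hμ => ?_, fun r => ?_, fun K F => ?_⟩
  · rw [hq]; exact (divEq_iff hℓ).2 h.div
  · rw [hq, Mesh.bdryInner_comm]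
    exact Mesh.bdryInner_eq_zero hm hΩ (singleValuedAt_ofM hμ) h.conservative
  · rw [hu]
    exact Mesh.bdryInner_eq_zero hm hΩ h.single (conservativeAt_ofN hm r)
  · rw [hu, hq, flux]; abel

theorem eq_of_ofTN_eq {r r' : S.TNh} (h : S.ofTN r = S.ofTN r') : r = r' := by
  funext K F
  refine Subtype.ext ?_
  have h1 : dotN (T.normal F) (r K F).1 = dotN (T.normal F) (r' K F).1 := congrFun (congrFun h K) F
  rw [← S.normalN K F _ (r K F).2, h1, S.normalN K F _ (r' K F).2]

theorem eq_of_ofTM_eq {μ μ' : S.TMh} (h : S.ofTM μ = S.ofTM μ') : μ = μ' := by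
  funext K F
  exact Subtype.ext (congrFun (congrFun h K) F)

theorem exists_ofTN_eq {b : T.Bdry} (hb : ∀ (K : T.Elem) (F : T.Facet K), b K F ∈ S.M F.1) :
    ∃ r : S.TNh, S.ofTN r = b :=
  ⟨fun K F => ⟨smulN (T.normal F) (b K F), S.A1 K F _ (hb K F)⟩,
    funext fun K => funext fun F => dotN_smulN (T.norm_normal F) (b K F)⟩

theorem existsUnique_isUnifiedSolution (hm : 1 ≤ m) (hΩ : IsConvexPolyhedralDomain Ω)
    (hτ : ∀ K F, 0 < τ K F)
    (hℓ : ∀ (K : T.Elem) (w : L2 K.1), ∫ x in K.1, f x * w x = inner ℝ (ℓ K) w) :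
    ∃! s : S.Vh × S.Wh × S.TNh × S.TMh,
      S.IsUnifiedSolution τ f s.1 s.2.1 s.2.2.1 s.2.2.2 ∧
        S.EitherSingleValued s.2.2.1 s.2.2.2 := by
  obtain ⟨q, u, a, h⟩ := exists_isCoreSolution (S := S) hm hΩ hτ ℓ
  obtain ⟨r, hr⟩ := exists_ofTN_eq (S := S) (flux_mem (τ := τ) q u h.mem)
  refine ⟨(q, u, r, fun K F => ⟨a K F, h.mem K F⟩), ⟨?_, fun F => Or.inl fun K K' h1 h2 => ?_⟩, ?_⟩
  · exact h.isUnifiedSolution hm hΩ hℓ rfl hr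
  · exact Subtype.ext ((h.single F).1 K K' h1 h2)
  · rintro ⟨q', u', r', μ'⟩ ⟨h', -⟩
    simp only at h'
    obtain ⟨rfl, rfl, h3⟩ := (h'.isCoreSolution hm hΩ hℓ).unique hm hΩ hτ h
    have h4 : r' = r := eq_of_ofTN_eq (by rw [hr, ← h'.flux_eq, h3])
    have h5 : μ' = fun K F => ⟨a K F, h.mem K F⟩ := eq_of_ofTM_eq h3
    rw [h4, h5]

end Unified

theorem isDirichletSolution_iff (hm : 1 ≤ m) (hΩ : IsConvexPolyhedralDomain Ω)
    (hℓ : ∀ (K : T.Elem) (w : L2 K.1), ∫ x in K.1, f x * w x = inner ℝ (ℓ K) w) {uhat : S.Mh} :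
    S.IsDirichletSolution τ f q u uhat ↔ S.IsCoreSolution τ ℓ q u (S.ofM uhat.1) := by
  refine ⟨fun h => IsCoreSolution.of_ofM hm hΩ uhat h.1 ((divEq_iff hℓ).1 h.2.1) h.2.2,
    fun h => ⟨h.grad, (divEq_iff hℓ).2 h.div, fun μ hμ => ?_⟩⟩
  rw [Mesh.bdryInner_comm]
  exact Mesh.bdryInner_eq_zero hm hΩ (singleValuedAt_ofM hμ) h.conservative

theorem existsUnique_isDirichletSolution (hm : 1 ≤ m) (hΩ : IsConvexPolyhedralDomain Ω)
    (hτ : ∀ K F, 0 < τ K F)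
    (hℓ : ∀ (K : T.Elem) (w : L2 K.1), ∫ x in K.1, f x * w x = inner ℝ (ℓ K) w) :
    ∃! s : S.Vh × S.Wh × S.Mh, S.IsDirichletSolution τ f s.1 s.2.1 s.2.2 := by
  obtain ⟨q, u, a, h⟩ := exists_isCoreSolution (S := S) hm hΩ hτ ℓ
  obtain ⟨μ, hμ, rfl⟩ := exists_ofM_eq h.mem h.single
  refine ⟨(q, u, ⟨μ, hμ⟩), (isDirichletSolution_iff hm hΩ hℓ).2 h, ?_⟩
  rintro ⟨q', u', μ'⟩ h'
  obtain ⟨h1, h2, h3⟩ := ((isDirichletSolution_iff hm hΩ hℓ).1 h').unique hm hΩ hτ h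
  refine Prod.ext h1 (Prod.ext h2 (Subtype.ext (funext fun F => ?_)))
  exact eq_of_ofM_eq fun K hF => congrFun (congrFun h3 K) _

section Neumann

variable {qhat : S.Nh}

/-- Since `τ ≠ 0`, the relation between trace and flux can be solved for either one. This lemma and
the next are the two directions of that passage. -/
theorem flux_add_inv_smul (hτ : ∀ K F, 0 < τ K F) (b : T.Bdry) (K : T.Elem) (F : T.Facet K)
    (ha : a K F = S.trace u K F + (τ K F)⁻¹ • (S.ntrace q K F - b K F)) :
    S.flux τ q u a K F = b K F := by
  rw [flux, ha, sub_add_cancel_left, smul_neg, smul_inv_smul₀ (hτ K F).ne']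
  abel

theorem eq_trace_add_inv_smul (hτ : ∀ K F, 0 < τ K F) {b : T.Bdry} (K : T.Elem) (F : T.Facet K)
    (hb : b K F = S.flux τ q u a K F) :
    S.trace u K F + (τ K F)⁻¹ • (S.ntrace q K F - b K F) = a K F := by
  rw [hb, flux, sub_add_cancel_left, smul_neg, inv_smul_smul₀ (hτ K F).ne']
  abel

theorem trace_add_inv_smul_mem (q : S.Vh) (u : S.Wh) (r : S.Nh) (c : ℝ) (K : T.Elem)
    (F : T.Facet K) :
    S.trace u K F + c • (S.ntrace q K F - S.ofN r K F) ∈ S.M F.1 :=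
  (S.M F.1).add_mem (S.A4 K F _ (u K).2) ((S.M F.1).smul_mem _
    ((S.M F.1).sub_mem (S.A3 K F _ (q K).2) (S.A2 K F _ (r (T.toFace F)).2)))

/-- The roles of the Dirichlet-type method are exchanged: conservativity is built into `N_h`, and
single-valuedness of the recovered trace comes from the test equation. -/
theorem IsNeumannSolution.exists_isCoreSolution (hm : 1 ≤ m) (hΩ : IsConvexPolyhedralDomain Ω)
    (hτ : ∀ K F, 0 < τ K F)
    (hℓ : ∀ (K : T.Elem) (w : L2 K.1), ∫ x in K.1, f x * w x = inner ℝ (ℓ K) w)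
    (h : S.IsNeumannSolution τ f q u qhat) :
    ∃ a, S.IsCoreSolution τ ℓ q u a ∧ S.ofN qhat = S.flux τ q u a := by
  let a : T.Bdry := fun K F => S.trace u K F + (τ K F)⁻¹ • (S.ntrace q K F - S.ofN qhat K F)
  have hfl : S.flux τ q u a = S.ofN qhat := by
    funext K F
    exact flux_add_inv_smul hτ _ K F rfl
  have hmem : ∀ (K : T.Elem) (F : T.Facet K), a K F ∈ S.M F.1 := fun K F =>
    trace_add_inv_smul_mem q u qhat _ K F
  refine ⟨a, ⟨h.1, ?_, hmem, fun F => ?_, fun F => ?_⟩, hfl.symm⟩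
  · rw [hfl]; exact (divEq_iff hℓ).1 h.2.1
  · exact singleValuedAt_of_test hm hΩ (fun K h => hmem K ⟨F, h⟩) fun r _ => h.2.2 r
  · rw [hfl]; exact conservativeAt_ofN hm qhat F

theorem IsCoreSolution.isNeumannSolution (hm : 1 ≤ m) (hΩ : IsConvexPolyhedralDomain Ω)
    (hτ : ∀ K F, 0 < τ K F)
    (hℓ : ∀ (K : T.Elem) (w : L2 K.1), ∫ x in K.1, f x * w x = inner ℝ (ℓ K) w)
    (h : S.IsCoreSolution τ ℓ q u a) (hq : S.ofN qhat = S.flux τ q u a) :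
    S.IsNeumannSolution τ f q u qhat := by
  have ha : (fun K F => S.trace u K F + (τ K F)⁻¹ • (S.ntrace q K F - S.ofN qhat K F)) = a := by
    funext K F
    exact eq_trace_add_inv_smul hτ K F (congrFun (congrFun hq K) F)
  unfold IsNeumannSolution
  simp only
  rw [ha, hq]
  exact ⟨h.grad, (divEq_iff hℓ).2 h.div, fun r =>
    Mesh.bdryInner_eq_zero hm hΩ h.single (conservativeAt_ofN hm r)⟩

theorem existsUnique_isNeumannSolution (hm : 1 ≤ m) (hΩ : IsConvexPolyhedralDomain Ω)
    (hτ : ∀ K F, 0 < τ K F)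
    (hℓ : ∀ (K : T.Elem) (w : L2 K.1), ∫ x in K.1, f x * w x = inner ℝ (ℓ K) w) :
    ∃! s : S.Vh × S.Wh × S.Nh, S.IsNeumannSolution τ f s.1 s.2.1 s.2.2 := by
  obtain ⟨q, u, a, h⟩ := FESpaces.exists_isCoreSolution (S := S) hm hΩ hτ ℓ
  obtain ⟨r, hr⟩ := exists_ofN_eq hm (flux_mem (τ := τ) q u h.mem) h.conservative
  refine ⟨(q, u, r), h.isNeumannSolution hm hΩ hτ hℓ hr, ?_⟩
  rintro ⟨q', u', r'⟩ h'
  obtain ⟨a', h', hr'⟩ := h'.exists_isCoreSolution hm hΩ hτ hℓ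
  simp only at h' hr'
  obtain ⟨rfl, rfl, rfl⟩ := h'.unique hm hΩ hτ h
  have : r' = r := funext fun F => eq_of_ofN_eq fun K hF => by rw [hr, hr']
  rw [this]

end Neumann

section Mixed

variable {D : Set T.Face} {qhat : S.NhOff D} {uhat : S.MhOn D}

theorem IsMixedSolution.exists_isCoreSolution (hm : 1 ≤ m) (hΩ : IsConvexPolyhedralDomain Ω)
    (hτ : ∀ K F, 0 < τ K F)
    (hℓ : ∀ (K : T.Elem) (w : L2 K.1), ∫ x in K.1, f x * w x = inner ℝ (ℓ K) w)
    (h : S.IsMixedSolution τ f D q u qhat uhat) :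
    ∃ a, S.IsCoreSolution τ ℓ q u a ∧
      (∀ (K : T.Elem) (F : T.Facet K), T.toFace F ∈ D → S.ofM uhat.1 K F = a K F) ∧
      ∀ (K : T.Elem) (F : T.Facet K), T.toFace F ∉ D →
        S.ofN qhat.1 K F = S.flux τ q u a K F := by
  classical
  obtain ⟨hg, hd, hμ, hr⟩ := h
  set a : T.Bdry := fun K F =>
    if T.toFace F ∈ D then S.ofM uhat.1 K F
    else S.trace u K F + (τ K F)⁻¹ • (S.ntrace q K F - S.ofN qhat.1 K F) with ha
  have hon : ∀ (K : T.Elem) (F : T.Facet K), T.toFace F ∈ D → a K F = S.ofM uhat.1 K F :=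
    fun K F hF => if_pos hF
  have hoff : ∀ (K : T.Elem) (F : T.Facet K), T.toFace F ∉ D →
      a K F = S.trace u K F + (τ K F)⁻¹ • (S.ntrace q K F - S.ofN qhat.1 K F) :=
    fun K F hF => if_neg hF
  have hfoff : ∀ (K : T.Elem) (F : T.Facet K), T.toFace F ∉ D →
      S.flux τ q u a K F = S.ofN qhat.1 K F := fun K F hF =>
    flux_add_inv_smul hτ _ K F (hoff K F hF)
  have hfl : (fun K F => if T.toFace F ∈ D then
      S.ntrace q K F + τ K F • (S.trace u K F - S.ofM uhat.1 K F)
      else S.ofN qhat.1 K F) = S.flux τ q u a := by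
    funext K F
    split_ifs with hF
    · rw [flux, hon K F hF]
    · exact (hfoff K F hF).symm
  have hmem : ∀ (K : T.Elem) (F : T.Facet K), a K F ∈ S.M F.1 := by
    intro K F
    by_cases hF : T.toFace F ∈ D
    · rw [hon K F hF]; exact (uhat.1 (T.toFace F)).2
    · rw [hoff K F hF]; exact trace_add_inv_smul_mem q u qhat.1 _ K F
  rw [hfl] at hd hμ
  refine ⟨a, ⟨hg, (divEq_iff hℓ).1 hd, hmem, fun F => ?_, fun F => ?_⟩,
    fun K F hF => (hon K F hF).symm, fun K F hF => (hfoff K F hF).symm⟩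
  -- Both continuity conditions are local to a face. On a face of `D` the trace is single valued by
  -- construction and the flux is conservative by testing; off `D` it is the other way round.
  · by_cases hF : ∃ hF : F ∈ T.faces, (⟨F, hF⟩ : T.Face) ∈ D
    · obtain ⟨hF, hFD⟩ := hF
      exact (singleValuedAt_ofM uhat.2.1 F).congr fun K h => hon K ⟨F, h⟩ hFD
    · refine singleValuedAt_of_test hm hΩ (fun K h => hmem K ⟨F, h⟩) fun r h0 => hr r ?_
      exact fun G hG => h0 G fun hGF => hF ⟨hGF ▸ G.2, by
        subst hGF; exact hG⟩
  · by_cases hF : ∃ hF : F ∈ T.faces, (⟨F, hF⟩ : T.Face) ∉ D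
    · obtain ⟨hF, hFD⟩ := hF
      exact (conservativeAt_ofN hm qhat.1 F).congr fun K h => hfoff K ⟨F, h⟩ hFD
    · refine conservativeAt_of_test (S := S) hm hΩ (fun K h => flux_mem q u hmem K ⟨F, h⟩) ?_
      refine fun μ hμM h0 => hμ μ ⟨hμM, fun G hG => h0 G fun hGF => hF ⟨hGF ▸ G.2, ?_⟩⟩
      subst hGF; exact hG

theorem IsCoreSolution.isMixedSolution (hm : 1 ≤ m) (hΩ : IsConvexPolyhedralDomain Ω)
    (hτ : ∀ K F, 0 < τ K F)
    (hℓ : ∀ (K : T.Elem) (w : L2 K.1), ∫ x in K.1, f x * w x = inner ℝ (ℓ K) w)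
    (h : S.IsCoreSolution τ ℓ q u a)
    (hu : ∀ (K : T.Elem) (F : T.Facet K), T.toFace F ∈ D → S.ofM uhat.1 K F = a K F)
    (hq : ∀ (K : T.Elem) (F : T.Facet K), T.toFace F ∉ D →
      S.ofN qhat.1 K F = S.flux τ q u a K F) :
    S.IsMixedSolution τ f D q u qhat uhat := by
  classical
  have ha : (fun K F => if T.toFace F ∈ D then S.ofM uhat.1 K F
      else S.trace u K F + (τ K F)⁻¹ • (S.ntrace q K F - S.ofN qhat.1 K F)) = a := by
    funext K F
    split_ifs with hF
    · exact hu K F hF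
    · exact eq_trace_add_inv_smul hτ K F (hq K F hF)
  have hb : (fun K F => if T.toFace F ∈ D then
      S.ntrace q K F + τ K F • (S.trace u K F - S.ofM uhat.1 K F)
      else S.ofN qhat.1 K F) = S.flux τ q u a := by
    funext K F
    split_ifs with hF
    · rw [hu K F hF]; rfl
    · exact hq K F hF
  have h1 : S.GradEq q u a ∧ S.DivEq f q (S.flux τ q u a) ∧
      (∀ μ ∈ S.MhOn D, T.bdryInner (S.flux τ q u a) (S.ofM μ) = 0) ∧
      (∀ r ∈ S.NhOff D, T.bdryInner a (S.ofN r) = 0) :=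
    ⟨h.grad, (divEq_iff hℓ).2 h.div, fun μ hμ => by
      rw [Mesh.bdryInner_comm]
      exact Mesh.bdryInner_eq_zero hm hΩ (singleValuedAt_ofM hμ.1) h.conservative,
      fun r _ => Mesh.bdryInner_eq_zero hm hΩ h.single (conservativeAt_ofN hm r)⟩
  rw [← hb] at h1
  nth_rewrite 1 [← ha] at h1
  unfold IsMixedSolution
  simp only
  convert h1

open Classical in
theorem existsUnique_isMixedSolution (hm : 1 ≤ m) (hΩ : IsConvexPolyhedralDomain Ω)
    (hτ : ∀ K F, 0 < τ K F)
    (hℓ : ∀ (K : T.Elem) (w : L2 K.1), ∫ x in K.1, f x * w x = inner ℝ (ℓ K) w)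
    (D : Set T.Face) :
    ∃! s : S.Vh × S.Wh × S.NhOff D × S.MhOn D,
      S.IsMixedSolution τ f D s.1 s.2.1 s.2.2.1 s.2.2.2 := by
  obtain ⟨q, u, a, h⟩ := FESpaces.exists_isCoreSolution (S := S) hm hΩ hτ ℓ
  obtain ⟨r, hr⟩ := exists_ofN_eq hm (flux_mem (τ := τ) q u h.mem) h.conservative
  obtain ⟨μ, hμ, hμa⟩ := exists_ofM_eq h.mem h.single
  -- The single-valued representatives of the flux and of the trace of the core solution are cut off
  -- to the faces where each of them is the unknown.
  let r₀ : S.NhOff D := ⟨fun F => if F ∈ D then 0 else r F, fun F hF => if_pos hF⟩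
  let μ₀ : S.MhOn D := ⟨fun F => if F ∈ D then μ F else 0,
    fun F hF => by simp only [hμ F hF, ite_self], fun F hF => if_neg hF⟩
  have hr₀ : ∀ (K : T.Elem) (F : T.Facet K), T.toFace F ∉ D →
      S.ofN r₀.1 K F = S.flux τ q u a K F := fun K F hF => by
    rw [← hr]; simp only [ofN, r₀, if_neg hF]
  have hμ₀ : ∀ (K : T.Elem) (F : T.Facet K), T.toFace F ∈ D →
      S.ofM μ₀.1 K F = a K F := fun K F hF => by
    rw [← hμa]; simp only [ofM, μ₀, if_pos hF]
  refine ⟨(q, u, r₀, μ₀), h.isMixedSolution hm hΩ hτ hℓ hμ₀ hr₀, ?_⟩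
  rintro ⟨q', u', r', μ'⟩ h'
  obtain ⟨a', h', hμ', hr'⟩ := h'.exists_isCoreSolution hm hΩ hτ hℓ
  simp only at h' hμ' hr'
  obtain ⟨rfl, rfl, rfl⟩ := h'.unique hm hΩ hτ h
  have e1 : r' = r₀ := by
    refine Subtype.ext (funext fun F => ?_)
    by_cases hF : F ∈ D
    · rw [r'.2 F hF, r₀.2 F hF]
    · exact eq_of_ofN_eq fun K hK => by rw [hr' K ⟨F.1, hK⟩ hF, hr₀ K ⟨F.1, hK⟩ hF]
  have e2 : μ' = μ₀ := by
    refine Subtype.ext (funext fun F => ?_)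
    by_cases hF : F ∈ D
    · exact eq_of_ofM_eq fun K hK => by rw [hμ' K ⟨F.1, hK⟩ hF, hμ₀ K ⟨F.1, hK⟩ hF]
    · rw [μ'.2.2 F hF, μ₀.2.2 F hF]
  rw [e1, e2]

end Mixed

end FESpaces
end HDG

end

/-! ### Stability and well-posedness. -/

theorem mainTheorem2 (d : ℕ) (hd : d = 2 ∨ d = 3) (Ω : Set (HDG.E d))
    (hΩ : HDG.IsConvexPolyhedralDomain Ω) :
    (∀ A τ₀ : ℝ, 0 < τ₀ → ∃ C : ℝ, 0 < C ∧
      ∀ (T : HDG.Mesh Ω) (S : HDG.FESpaces T), S.HasNormalApproximation A →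
      ∀ τ : (∀ K : T.Elem, T.Facet K → ℝ), (∀ K F, τ₀ ≤ τ K F) →
      ∀ f : HDG.E d → ℝ, MeasureTheory.MemLp f 2 (MeasureTheory.volume.restrict Ω) →
      ∀ (q : S.Vh) (u : S.Wh) (qhat : S.TNh) (uhat : S.TMh),
        S.IsUnifiedSolution τ f q u qhat uhat → S.EitherSingleValued qhat uhat →
        (∑ K, ‖(q K).1.1‖ ^ 2) +
            (∑ K : T.Elem, ∑ F : T.Facet K, τ K F * ‖S.trace u K F - S.ofTM uhat K F‖ ^ 2) ≤
          C * ∫ x in Ω, f x ^ 2) ∧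
    (∀ (T : HDG.Mesh Ω) (S : HDG.FESpaces T)
      (τ : ∀ K : T.Elem, T.Facet K → ℝ), (∀ K F, 0 < τ K F) →
      ∀ f : HDG.E d → ℝ, MeasureTheory.MemLp f 2 (MeasureTheory.volume.restrict Ω) →
        (∃! s : S.Vh × S.Wh × S.Mh, S.IsDirichletSolution τ f s.1 s.2.1 s.2.2) ∧
        (∃! s : S.Vh × S.Wh × S.Nh, S.IsNeumannSolution τ f s.1 s.2.1 s.2.2) ∧
        (∀ D : Set T.Face, ∃! s : S.Vh × S.Wh × S.NhOff D × S.MhOn D,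
          S.IsMixedSolution τ f D s.1 s.2.1 s.2.2.1 s.2.2.2) ∧
        (∃! s : S.Vh × S.Wh × S.TNh × S.TMh,
          S.IsUnifiedSolution τ f s.1 s.2.1 s.2.2.1 s.2.2.2 ∧
            S.EitherSingleValued s.2.2.1 s.2.2.2)) := by
  obtain ⟨m, hm, rfl⟩ : ∃ m, 1 ≤ m ∧ d = m + 1 := ⟨d - 1, by omega, by omega⟩
  refine ⟨fun A τ₀ hτ₀ => ?_, fun T S τ hτ f hf => ?_⟩
  · obtain ⟨C, hC, h⟩ := HDG.FESpaces.exists_stability hm hΩ A hτ₀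
    refine ⟨C, hC, fun T S hS τ hτ f hf q u qhat uhat hs _ => ?_⟩
    obtain ⟨ℓ, hℓ, hℓf⟩ := T.exists_load hΩ hf
    rw [← hℓf]
    exact h T S hS τ hτ ℓ q u _ (hs.isCoreSolution hm hΩ hℓ)
  · obtain ⟨ℓ, hℓ, -⟩ := T.exists_load hΩ hf
    exact ⟨HDG.FESpaces.existsUnique_isDirichletSolution hm hΩ hτ hℓ,
      HDG.FESpaces.existsUnique_isNeumannSolution hm hΩ hτ hℓ,
      HDG.FESpaces.existsUnique_isMixedSolution hm hΩ hτ hℓ,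
      HDG.FESpaces.existsUnique_isUnifiedSolution hm hΩ hτ hℓ⟩
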